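/- Let $(M,\Delta,g)$ be a contact sub-Riemannian manifold of dimension $2n+1$: $\Delta$ is a smooth rank-$2n$ distribution that is locally the kernel of a smooth $1$-form $\omega$ with $\omega\wedge(d\omega)^n\neq 0$, and $g$ is a smooth scalar product on $\Delta$. Let $H(p,q)=\frac12\sup_{v\in\Delta_q\setminus 0}\langle p,v\rangle^2/g_q(v,v)$ be its Hamiltonian on $T^*M$, let $\mathcal E_{q_0}(t,p)$ be the position at time $t$ of the integral curve of the Hamiltonian vector field $\vec H$ issued from $(p,q_0)$, and let the first conjugate time $t_c(p)$ be the smallest $t>0$ such that $\mathcal E_{q_0}(t,\cdot)$ is critical at $p$ ($t_c(p)=+\infty$ if there is none). Let $q_0\in M$ and assume that near $q_0$ the structure is in Agrachev–Gauthier normal form with distinct nilpotent invariants $b_1>b_2>\dots>b_n>0$: there are local coordinates $(x_1,\dots,x_{2n},z)$ centred at $q_0$ and an orthonormal frame $X_1,\dots,X_{2n}$ of $(\Delta,g)$ such that, $(X)_j$ denoting the $j$-th component of $X$ (the $(2n+1)$-st being the $\partial_z$-component), $X_k(q_0)=\partial_{x_k}$, $(X_k)_l=(X_l)_k$, $\sum_l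 (X_l)_k x_l=x_k$ for $1\le k,l\le 2n$, $\sum_l (X_l)_{2n+1}x_l=0$, and the linear parts at $q_0$ of $(X_{2i-1})_{2n+1}$ and $(X_{2i})_{2n+1}$ are $\frac{b_i}{2}x_{2i}$ and $-\frac{b_i}{2}x_{2i-1}$. Write $(h_1,\dots,h_{2n},h_0)$ for the covector $\sum_k h_k\,dx_k+h_0\,dz$ at $q_0$. Let $\bar h\in\mathbb R^{2n}$ with $(\bar h_3,\dots,\bar h_{2n})\neq 0$. For $h\in\mathbb R^{2n}$ and $\tau,\eta>0$ let $$p_\eta(h)=(\sqrt\eta\,h_1,\sqrt\eta\,h_2,h_3,\dots,h_{2n},\eta^{-1}),\qquad G(\tau,h,\eta)=\mathcal E_{q_0}(\eta\tau,p_\eta(h))$$ (in the coordinates $(x,z)$), and let $\tau_c(\eta)=t_c(p_\eta(\bar h))/\eta$ be the rescaled first conjugate time. Then, for every $\tau>0$ and $h\in\mathbb R^{2n}$, $G$ has an expansion $G(\tau,h,\eta)=\sum_{k=0}^{5}\eta^{k/2}G^{(k/2)}(\tau,h)+o(\eta^{5/2})$ as $\eta\to0^+$, and $G^{(5/2)}(2\pi/b_1,\cdot)$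 is differentiable. Put $$\gamma_{ij}=\frac{\partial G^{(5/2)}_i}{\partial h_j}\Big(\frac{2\pi}{b_1},\bar h\Big)\quad(i,j\in\{1,2\}),\qquad K=\sum_{i=2}^n(\bar h_{2i-1}^2+\bar h_{2i}^2)\Big(1-\frac{b_i}{b_1}\pi\cot\frac{b_i\pi}{b_1}\Big),$$ $$\begin{aligned}P(\delta\tau)=&-K\,\delta\tau^2+\delta\tau\Big(\frac{2\pi}{b_1}(\bar h_1^2+\bar h_2^2)-K(\gamma_{11}+\gamma_{22})\Big)\\&+\frac{2\pi}{b_1}\Big(\bar h_2^2\gamma_{11}+\bar h_1^2\gamma_{22}-\bar h_1\bar h_2(\gamma_{21}+\gamma_{12})\Big)+K(\gamma_{21}\gamma_{12}-\gamma_{11}\gamma_{22}),\end{aligned}$$ and let $D$ be the discriminant of $P$. 1. If $D\ge 0$, let $\delta\tau^*$ be the smallest root of $P$. Then for all small $\eta>0$ the first conjugate time is attained, and $\tau_c(\eta)=\frac{2\pi}{b_1}+\eta\,\delta\tau^*+o(\eta)$ as $\eta\to0^+$. 2. If $D<0$, then $\limsup_{\eta\to0^+}\left|\tau_c(\eta)-\frac{2\pi}{b_1}\right|>0$,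 that is, the first conjugate time is not a perturbation of $2\pi/b_1$. -/

import Mathlib

open Set Filter Topology
open scoped Manifold ContDiff

/-- Index set of the horizontal coordinates `x_1, …, x_{2n}`: the pair `(i, 0)` stands for
`2i - 1` and `(i, 1)` for `2i` (with `i` counted from `0`). -/
abbrev HIdx (n : ℕ) : Type := Fin n × Fin 2

/-- The coordinate space `ℝ^{2n+1}`, with points `y = (x, z)`: the coordinate `x_k` is
`y (some k)` and the coordinate `z` is `y none`. -/
abbrev Coord (n : ℕ) : Type := EuclideanSpace ℝ (Option (HIdx n))

namespace ContactSR

noncomputable section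

variable {n : ℕ} {M : Type*} [TopologicalSpace M] [ChartedSpace (Coord n) M]

/-- The value at `v ∈ T_q M` of the covector `p ∈ T_q^* M`.  In Mathlib every tangent space
`T_q M` is a copy of the model space, so a covector at `q` is a linear form on the
model space, and a point of `T^* M` is a pair `(q, p)`. -/
def pairing (q : M) (p : Coord n →L[ℝ] ℝ) (v : TangentSpace 𝓘(ℝ, Coord n) q) : ℝ := p v

/-- A distribution of subspaces of the tangent spaces together with a scalar product on each of
them (no regularity yet). -/
structure HorizontalMetric (n : ℕ) (M : Type*) [TopologicalSpace M]
    [ChartedSpace (Coord n) M] where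
  /-- the distribution `Δ` -/
  Δ : ∀ q : M, Submodule ℝ (TangentSpace 𝓘(ℝ, Coord n) q)
  /-- the scalar product `g_q` on `Δ_q` -/
  g : ∀ q : M, Δ q →ₗ[ℝ] Δ q →ₗ[ℝ] ℝ
  symm : ∀ q v w, g q v w = g q w v
  pos : ∀ q v, v ≠ 0 → 0 < g q v v

/-- `X` is a smooth orthonormal frame of `(Δ, g)` on `U`. -/
structure IsFrame [IsManifold 𝓘(ℝ, Coord n) ∞ M] (S : HorizontalMetric n M) (U : Set M)
    (X : HIdx n → ∀ q : M, TangentSpace 𝓘(ℝ, Coord n) q) : Prop where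
  smooth : ∀ k, ContMDiffOn 𝓘(ℝ, Coord n) (𝓘(ℝ, Coord n)).tangent ∞
    (fun q => (⟨q, X k q⟩ : TangentBundle 𝓘(ℝ, Coord n) M)) U
  span : ∀ q ∈ U, Submodule.span ℝ (range fun k => X k q) = S.Δ q
  orthonormal : ∀ q ∈ U, ∀ k l, ∃ (hk : X k q ∈ S.Δ q) (hl : X l q ∈ S.Δ q),
    S.g q ⟨X k q, hk⟩ ⟨X l q, hl⟩ = if k = l then 1 else 0

/-- `(M, Δ, g)` is a contact sub-Riemannian manifold of dimension `2n+1`.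

Smoothness of `Δ` (of rank `2n`) and of `g` is the existence of smooth local orthonormal frames.
For a local `1`-form `ω` with kernel `Δ`, the condition `ω ∧ (dω)^n ≠ 0` says that `dω` is
nondegenerate on `Δ`; as `dω(X, Y) = -ω([X, Y])` for horizontal `X, Y`, it says that
no nonzero `v = ∑ a_k X_k(q)` has `∑ a_k [X_k, X_l](q) ∈ Δ_q` for all `l`. -/
structure IsContact [IsManifold 𝓘(ℝ, Coord n) ∞ M] (S : HorizontalMetric n M) : Prop where
  exists_frame : ∀ q : M, ∃ U : Set M, IsOpen U ∧ q ∈ U ∧ ∃ X, IsFrame S U X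
  nondegenerate : ∀ (q : M) (U : Set M) (X : HIdx n → ∀ q : M, TangentSpace 𝓘(ℝ, Coord n) q),
    IsOpen U → q ∈ U → IsFrame S U X → ∀ a : HIdx n → ℝ, a ≠ 0 →
      ∃ l, ∑ k, a k • VectorField.mlieBracket 𝓘(ℝ, Coord n) (X k) (X l) q ∉ S.Δ q

/-- The sub-Riemannian Hamiltonian `H(p, q) = ½ sup_{v ∈ Δ_q ∖ 0} ⟨p, v⟩² / g_q(v, v)`. -/
def hamiltonian (S : HorizontalMetric n M) (q : M) (p : Coord n →L[ℝ] ℝ) : ℝ :=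
  1 / 2 * ⨆ v : {v : S.Δ q // v ≠ 0}, pairing q p v.1.1 ^ 2 / S.g q v.1 v.1

/-- The differential of a chart `ψ` at `q`. -/
def chartDiff (ψ : OpenPartialHomeomorph M (Coord n)) (q : M) : Coord n →L[ℝ] Coord n :=
  mfderiv 𝓘(ℝ, Coord n) 𝓘(ℝ, Coord n) ψ q

/-- The differential of the inverse of a chart `ψ` at `y`. -/
def chartSymmDiff (ψ : OpenPartialHomeomorph M (Coord n)) (y : Coord n) :
    Coord n →L[ℝ] Coord n :=
  mfderiv 𝓘(ℝ, Coord n) 𝓘(ℝ, Coord n) ψ.symm y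

/-- The Hamiltonian in the canonical coordinates `(y, ξ)` of `T^* M` given by a chart `ψ`. -/
def chartHamiltonian (S : HorizontalMetric n M) (ψ : OpenPartialHomeomorph M (Coord n))
    (y : Coord n) (ξ : Coord n →L[ℝ] ℝ) : ℝ :=
  hamiltonian S (ψ.symm y) (ξ.comp (chartDiff ψ (ψ.symm y)))

/-- The position of `c = (q, p)` in the chart `ψ`. -/
def chartPos (ψ : OpenPartialHomeomorph M (Coord n)) (c : ℝ → M × (Coord n →L[ℝ] ℝ)) (t : ℝ) :
    Coord n :=
  ψ (c t).1

/-- The covector of `c = (q, p)` in the chart `ψ`, that is `ξ = p ∘ (dψ_q)⁻¹`. -/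
def chartMom (ψ : OpenPartialHomeomorph M (Coord n)) (c : ℝ → M × (Coord n →L[ℝ] ℝ)) (t : ℝ) :
    Coord n →L[ℝ] ℝ :=
  (c t).2.comp (chartSymmDiff ψ (chartPos ψ c t))

/-- `c = (q, p)` is a normal extremal on the time set `s`: in all smooth local coordinates it
solves Hamilton's equations `y' = ∂H/∂ξ` (tested against linear forms `α`), `ξ' = -∂H/∂y`. -/
structure IsNormalExtremal (S : HorizontalMetric n M) (c : ℝ → M × (Coord n →L[ℝ] ℝ))
    (s : Set ℝ) : Prop where
  continuousOn : ContinuousOn (fun t => (c t).1) s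
  position : ∀ ψ ∈ IsManifold.maximalAtlas 𝓘(ℝ, Coord n) ∞ M, ∀ t ∈ s, (c t).1 ∈ ψ.source →
    ∃ v : Coord n, HasDerivWithinAt (chartPos ψ c) v s t ∧
      ∀ α : Coord n →L[ℝ] ℝ,
        α v = fderiv ℝ (fun ξ => chartHamiltonian S ψ (chartPos ψ c t) ξ) (chartMom ψ c t) α
  momentum : ∀ ψ ∈ IsManifold.maximalAtlas 𝓘(ℝ, Coord n) ∞ M, ∀ t ∈ s, (c t).1 ∈ ψ.source →
    HasDerivWithinAt (chartMom ψ c)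
      (-fderiv ℝ (fun y => chartHamiltonian S ψ y (chartMom ψ c t)) (chartPos ψ c t)) s t

/-- The normal extremal with initial point `(q₀, p)` is defined on `[0, t]`. -/
def ExpDefined (S : HorizontalMetric n M) (q₀ : M) (t : ℝ) (p : Coord n →L[ℝ] ℝ) : Prop :=
  ∃ c : ℝ → M × (Coord n →L[ℝ] ℝ), c 0 = (q₀, p) ∧ IsNormalExtremal S c (Icc 0 t)

open Classical in
/-- The sub-Riemannian exponential `ℰ_{q₀}(t, p)`: the position at time `t` of the normal extremal
issued from `(q₀, p)` (with the value `q₀` where it is not defined). -/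
def expMap (S : HorizontalMetric n M) (q₀ : M) (t : ℝ) (p : Coord n →L[ℝ] ℝ) : M :=
  if h : ExpDefined S q₀ t p then (h.choose t).1 else q₀

/-- The set of conjugate times for `p ∈ T_{q₀}^* M`: the times `t > 0` at which `ℰ_{q₀}(t, ·)` is
defined and critical at `p`. -/
def conjugateTimes (S : HorizontalMetric n M) (q₀ : M) (p : Coord n →L[ℝ] ℝ) : Set ℝ :=
  {t | 0 < t ∧ ExpDefined S q₀ t p ∧
    ¬ Function.Surjective
      (mfderiv 𝓘(ℝ, Coord n →L[ℝ] ℝ) 𝓘(ℝ, Coord n) (expMap S q₀ t) p)}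

/-- The first conjugate time `t_c(p)`, equal to `+∞` if there is no conjugate time. -/
def firstConjugateTime (S : HorizontalMetric n M) (q₀ : M) (p : Coord n →L[ℝ] ℝ) : EReal :=
  sInf ((fun t : ℝ => (t : EReal)) '' conjugateTimes S q₀ p)

/-- The vector field `X` written in the coordinates `φ = (x, z)`. -/
def inCoord (φ : OpenPartialHomeomorph M (Coord n))
    (X : ∀ q : M, TangentSpace 𝓘(ℝ, Coord n) q) (y : Coord n) : Coord n :=
  chartDiff φ (φ.symm y) (X (φ.symm y))

/-- The coordinates `φ = (x, z)` and the frame `X` put `(Δ, g)` in Agrachev–Gauthier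
normal form at `q₀`, with nilpotent invariants `b`.  The linear part of the vertical components is
that of the nilpotent frame
`∂_{x_{2i-1}} + (b_i / 2) x_{2i} ∂_z`, `∂_{x_{2i}} - (b_i / 2) x_{2i-1} ∂_z`.
The normalization of the contact form (that `∂_z` is its Reeb field, `∏ b_i = 1 / n!`) is part of
the full normal form but is not required here. -/
structure IsNormalForm [IsManifold 𝓘(ℝ, Coord n) ∞ M]
    (S : HorizontalMetric n M) (q₀ : M) (b : Fin n → ℝ)
    (φ : OpenPartialHomeomorph M (Coord n))
    (X : HIdx n → ∀ q : M, TangentSpace 𝓘(ℝ, Coord n) q) : Prop where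
  chart : φ ∈ IsManifold.maximalAtlas 𝓘(ℝ, Coord n) ∞ M
  mem_source : q₀ ∈ φ.source
  map_base : φ q₀ = 0
  frame : IsFrame S φ.source X
  /-- `X_k(q₀) = ∂_{x_k}` -/
  frame_base : ∀ k, inCoord φ (X k) 0 = EuclideanSpace.single (some k) 1
  /-- `(X_k)_l = (X_l)_k` -/
  horizontal_symm : ∀ y ∈ φ.target, ∀ k l,
    inCoord φ (X k) y (some l) = inCoord φ (X l) y (some k)
  /-- `∑_l (X_l)_k x_l = x_k` -/
  horizontal_radial : ∀ y ∈ φ.target, ∀ k,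
    ∑ l, inCoord φ (X l) y (some k) * y (some l) = y (some k)
  /-- `∑_l (X_l)_{2n+1} x_l = 0` -/
  vertical_radial : ∀ y ∈ φ.target, ∑ l, inCoord φ (X l) y none * y (some l) = 0
  vertical_odd : ∀ (i : Fin n) (v : Coord n),
    fderiv ℝ (fun y => inCoord φ (X (i, 0)) y none) 0 v = b i / 2 * v (some (i, 1))
  vertical_even : ∀ (i : Fin n) (v : Coord n),
    fderiv ℝ (fun y => inCoord φ (X (i, 1)) y none) 0 v = -(b i / 2) * v (some (i, 0))

/-- The linear form `(x, z) ↦ ∑ h_k x_k + h₀ z`. -/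
def linForm (h : HIdx n → ℝ) (h₀ : ℝ) : Coord n →L[ℝ] ℝ :=
  ∑ k, h k • EuclideanSpace.proj (𝕜 := ℝ) (some k) + h₀ • EuclideanSpace.proj (𝕜 := ℝ) none

/-- The covector `∑ h_k dx_k + h₀ dz` at `q₀`.  In normal form `X_k(q₀) = ∂_{x_k}` and
`X_0 = ∂_z`, so it is the covector `(h, h₀)` with `h_k = ⟨p, X_k(q₀)⟩`, `h₀ = ⟨p, X_0(q₀)⟩`
(see `pairing_covector`). -/
def covector (φ : OpenPartialHomeomorph M (Coord n)) (q₀ : M) (h : HIdx n → ℝ) (h₀ : ℝ) :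
    Coord n →L[ℝ] ℝ :=
  (linForm h h₀).comp (chartDiff φ q₀)

theorem linForm_apply (h : HIdx n → ℝ) (h₀ : ℝ) (v : Coord n) :
    linForm h h₀ v = ∑ k, h k * v (some k) + h₀ * v none := by
  simp [linForm]

theorem pairing_covector [IsManifold 𝓘(ℝ, Coord n) ∞ M] {S : HorizontalMetric n M} {q₀ : M}
    {b : Fin n → ℝ} {φ : OpenPartialHomeomorph M (Coord n)}
    {X : HIdx n → ∀ q : M, TangentSpace 𝓘(ℝ, Coord n) q} (hφ : IsNormalForm S q₀ b φ X)
    (h : HIdx n → ℝ) (h₀ : ℝ) (k : HIdx n) :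
    pairing q₀ (covector φ q₀ h h₀) (X k q₀) = h k := by
  have h1 : φ.symm 0 = q₀ := by rw [← hφ.map_base, φ.left_inv hφ.mem_source]
  have h2 : chartDiff φ q₀ (X k q₀) = EuclideanSpace.single (some k) 1 := by
    have h3 : (fun q => chartDiff φ q (X k q)) (φ.symm 0) = EuclideanSpace.single (some k) 1 := hφ.frame_base k
    rw [h1] at h3
    exact h3
  have h4 : pairing q₀ (covector φ q₀ h h₀) (X k q₀) =
      linForm h h₀ (chartDiff φ q₀ (X k q₀)) := rfl
  rw [h4, h2, linForm_apply]
  simp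

/-- The blown-up `h = (√η h̄_1, √η h̄_2, h̄_3, …, h̄_{2n})`. -/
def blowup [NeZero n] (hbar : HIdx n → ℝ) (η : ℝ) : HIdx n → ℝ :=
  fun k => if k.1 = 0 then √η * hbar k else hbar k

/-- `G(τ, h̄, η) = ℰ_{q₀}(η τ, (√η h̄_1, √η h̄_2, h̄_3, …, h̄_{2n}, η⁻¹))`, in the
coordinates `φ`. -/
def blowupExp [NeZero n] (S : HorizontalMetric n M) (q₀ : M)
    (φ : OpenPartialHomeomorph M (Coord n)) (τ : ℝ) (hbar : HIdx n → ℝ) (η : ℝ) : Coord n :=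
  φ (expMap S q₀ (η * τ) (covector φ q₀ (blowup hbar η) η⁻¹))

/-- `f(η) = ∑_{k ≤ N} η^{k/2} c_k + o(η^{N/2})` as `η → 0⁺`. -/
def HasHalfPowerExpansion (f : ℝ → Coord n) (c : ℕ → Coord n) (N : ℕ) : Prop :=
  (fun η => f η - ∑ k ∈ Finset.range (N + 1), (√η) ^ k • c k) =o[𝓝[>] 0] fun η => (√η) ^ N

/-- The rescaled first conjugate time `τ_c = t_c / η` of the covector
`(√η h̄_1, √η h̄_2, h̄_3, …, h̄_{2n}, η⁻¹)`. -/
def rescaledConjugateTime [NeZero n] (S : HorizontalMetric n M) (q₀ : M)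
    (φ : OpenPartialHomeomorph M (Coord n)) (hbar : HIdx n → ℝ) (η : ℝ) : EReal :=
  firstConjugateTime S q₀ (covector φ q₀ (blowup hbar η) η⁻¹) / (η : EReal)

/-- `K = ∑_{i ≥ 2} (h̄_{2i-1}² + h̄_{2i}²) (1 - (b_i / b_1) π cot (b_i π / b_1))`. -/
def constK [NeZero n] (b : Fin n → ℝ) (hbar : HIdx n → ℝ) : ℝ :=
  ∑ i ∈ Finset.univ.filter (fun i : Fin n => i ≠ 0),
    (hbar (i, 0) ^ 2 + hbar (i, 1) ^ 2) *
      (1 - b i / b 0 * Real.pi * Real.cot (b i * Real.pi / b 0))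

/-- The partial derivatives `γ i j = ∂G_i / ∂h̄_j` at `h̄`, for `i, j ∈ {1, 2}`, of a function
`G = G^{(5/2)}` of `h̄`. -/
def gradG [NeZero n] (G : (HIdx n → ℝ) → Coord n) (hbar : HIdx n → ℝ) (i j : Fin 2) : ℝ :=
  fderiv ℝ G hbar (Pi.single (0, j) 1) (some (0, i))

/-- Coefficient of `δτ` in `P`, where `γ i j = ∂G^{(5/2)}_i / ∂h̄_j`. -/
def coeffOne [NeZero n] (b : Fin n → ℝ) (hbar : HIdx n → ℝ) (γ : Fin 2 → Fin 2 → ℝ) : ℝ :=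
  2 * Real.pi / b 0 * (hbar (0, 0) ^ 2 + hbar (0, 1) ^ 2) - constK b hbar * (γ 0 0 + γ 1 1)

/-- Constant coefficient of `P`, where `γ i j = ∂G^{(5/2)}_i / ∂h̄_j`. -/
def coeffZero [NeZero n] (b : Fin n → ℝ) (hbar : HIdx n → ℝ) (γ : Fin 2 → Fin 2 → ℝ) : ℝ :=
  2 * Real.pi / b 0 * (hbar (0, 1) ^ 2 * γ 0 0 + hbar (0, 0) ^ 2 * γ 1 1
      - hbar (0, 0) * hbar (0, 1) * (γ 1 0 + γ 0 1)) +
    constK b hbar * (γ 1 0 * γ 0 1 - γ 0 0 * γ 1 1)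

/-- The quadratic polynomial `P(δτ)`. -/
def polyP [NeZero n] (b : Fin n → ℝ) (hbar : HIdx n → ℝ) (γ : Fin 2 → Fin 2 → ℝ) (δ : ℝ) : ℝ :=
  -constK b hbar * δ ^ 2 + coeffOne b hbar γ * δ + coeffZero b hbar γ

/-- The discriminant of `P`. -/
def discP [NeZero n] (b : Fin n → ℝ) (hbar : HIdx n → ℝ) (γ : Fin 2 → Fin 2 → ℝ) : ℝ :=
  discrim (-constK b hbar) (coeffOne b hbar γ) (coeffZero b hbar γ)

end

end ContactSR

/-! Put η = s² and α = 2π/b₁, and look at the time ε = ητ. The dilation (x, z) ↦ (εx, ε²z) turns the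
trajectory on [0, ε] issued from the blown-up covector into a time-one trajectory with covector (s
h₁, s h₂, h₃, …, h₂ₙ, τ), for a frame which depends smoothly on ε and is the nilpotent frame at ε =
0 (`IsNormalForm.exists_dilated`, `expMap_dilCov`). Conjugate times become zeros of det J(s, τ),
where J is `jac` at `scaledPt h (s, τ)`, and J is smooth up to s = 0 (`mem_conjugateTimes_iff`).

For s = 0 everything is explicit. The horizontal end point of pair i is governed by a 2×2 block of
determinant sinc² + cosc² at the angle b_i τ, which first vanishes at the angle 2π. Once the pairs
are eliminated, the vertical derivative is a sum of positive weights (`vertical_fderiv`,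
`reduced_area_deriv_pos`). Hence J(0, τ) is invertible for τ < α (`jac_nil_det_ne_zero`). At τ = α
only the block of the first pair degenerates: the complementary block stays invertible, and the zz
entry of its inverse is α²/K.

The Schur complement on the first pair then satisfies α · Schur = (τ − α)Ψ + s²T with Ψ → 1 and T →
N = γ − (α/K) h hᵀ, where h = (h₁, h₂) (`schur_expansion`). The rotation block produces (τ − α)Ψ and
its derivative in ε produces γ; the off-diagonal blocks are of order s with limit h/α in the z slot,
whence the rank-one term. As P(x) = −K det(x·1 + N) (`polyP_eq`), the zeros of det J near α sit at τ
≈ α + s²x with P(x) = 0.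

If the discriminant is negative, det J has no zero in a fixed neighbourhood of α. If it is positive,
the smallest root is simple and persists by a change of sign. A double root could disappear under a
perturbation; what saves it is that the end point map is Lagrangian, so the Schur complement is
symmetric up to a factor tending to 1 (`schurMom_transpose_mul_schurComp`, `schurMom_tendsto`). A
symmetric 2×2 matrix of trace zero has determinant ≤ 0, and following the trace through zero yields
a root (`eventually_exists_root_of_double`).

The coefficients γ are second derivatives of the end point map, in ε and in the covector. The same
second derivatives appear in the term of order 5/2 of the exponential map, and their symmetry gives
the link (`gradG_expCoeff`). -/

namespace ContactSR
noncomputable section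

/-! ### Smooth dependence of the time-one flow on the initial point, by the inverse function theorem
on paths. -/

section TimeOneFlow

set_option linter.unusedSectionVars false

universe u

variable {E F : Type u} [NormedAddCommGroup E] [NormedSpace ℝ E] [NormedAddCommGroup F]
  [NormedSpace ℝ F]

/-- Pointwise application of a continuous family of linear maps to a continuous path. -/
def pathApply : C(unitInterval, E →L[ℝ] F) →L[ℝ] C(unitInterval, E) →L[ℝ] C(unitInterval, F) :=
  LinearMap.mkContinuous₂
    (LinearMap.mk₂ ℝ
      (fun (A : C(unitInterval, E →L[ℝ] F)) (v : C(unitInterval, E)) =>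
        (⟨fun t => A t (v t), by fun_prop⟩ : C(unitInterval, F)))
      (fun A B v => by ext t; simp) (fun c A v => by ext t; simp)
      (fun A v w => by ext t; simp) (fun c A v => by ext t; simp)) 1
    (fun A v => by
      rw [one_mul, ContinuousMap.norm_le _ (by positivity)]
      intro t
      exact ((A t).le_opNorm (v t)).trans (by gcongr <;> exact ContinuousMap.norm_coe_le_norm _ t))

@[simp] theorem pathApply_apply (A : C(unitInterval, E →L[ℝ] F)) (v : C(unitInterval, E))
    (t : unitInterval) : pathApply A v t = A t (v t) := rfl

/-- Composition of continuous paths with a continuous map. -/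
def superpose (f : C(E, F)) (u : C(unitInterval, E)) : C(unitInterval, F) := f.comp u

@[simp] theorem superpose_apply (f : C(E, F)) (u : C(unitInterval, E)) (t : unitInterval) :
    superpose f u t = f (u t) := rfl

/-- The range of the path is compact, so the derivative of `f` varies by at most `c` within one
radius `δ` valid at all its points. The mean value inequality on the balls of radius `δ` then gives
an estimate uniform in time. -/
theorem hasFDerivAt_superpose (f : C(E, F)) (f' : C(E, E →L[ℝ] F))
    (hf : ∀ x, HasFDerivAt f (f' x) x) (u : C(unitInterval, E)) :
    HasFDerivAt (superpose f) (pathApply (superpose f' u)) u := by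
  rw [hasFDerivAt_iff_isLittleO_nhds_zero, Asymptotics.isLittleO_iff]
  intro c hc
  have hK : IsCompact (range u) := isCompact_range u.continuous
  have h1 := hK.uniformContinuousAt_of_continuousAt f' (fun x _ => f'.continuous.continuousAt)
    (Metric.dist_mem_uniformity hc)
  obtain ⟨δ, hδ, h2⟩ := Metric.mem_uniformity_dist.1 h1
  filter_upwards [Metric.ball_mem_nhds (0 : C(unitInterval, E)) hδ] with v hv
  rw [mem_ball_zero_iff] at hv
  rw [ContinuousMap.norm_le _ (by positivity)]
  intro t
  have hvt : ‖v t‖ ≤ ‖v‖ := ContinuousMap.norm_coe_le_norm _ t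
  have h3 := (convex_ball (u t) δ).norm_image_sub_le_of_norm_hasFDerivWithin_le' (f := f)
    (f' := f') (φ := f' (u t)) (C := c) (x := u t) (y := u t + v t)
    (fun x _ => (hf x).hasFDerivWithinAt)
    (fun x hx => by
      have h4 := @h2 (u t) x (by rw [dist_comm]; exact hx) (mem_range_self t)
      change dist (f' (u t)) (f' x) < c at h4
      rw [dist_comm, dist_eq_norm] at h4
      exact h4.le) (Metric.mem_ball_self hδ)
    (by rw [mem_ball_iff_norm]; simpa using hvt.trans_lt hv)
  simp only [add_sub_cancel_left] at h3
  calc _ = ‖f (u t + v t) - f (u t) - f' (u t) (v t)‖ := rfl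
    _ ≤ c * ‖v t‖ := h3
    _ ≤ c * ‖v‖ := by gcongr

/-- The derivative of a superposition operator is the superposition operator of the derivative,
followed by the bounded linear map `pathApply`. The target is generalised in the induction because
each differentiation replaces `F` by `E →L[ℝ] F`. -/
theorem contDiff_superpose_nat (n : ℕ) : ∀ {F : Type u} [NormedAddCommGroup F] [NormedSpace ℝ F]
    (f : C(E, F)), ContDiff ℝ n f → ContDiff ℝ n (superpose f) := by
  induction n with
  | zero =>
    intro F _ _ f hf
    rw [Nat.cast_zero, contDiff_zero]
    exact ContinuousMap.continuous_postcomp f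
  | succ n ih =>
    intro F _ _ f hf
    rw [Nat.cast_add, Nat.cast_one] at hf ⊢
    rw [contDiff_succ_iff_hasFDerivAt] at hf ⊢
    obtain ⟨f', hf', hd⟩ := hf
    refine ⟨fun u => pathApply (superpose ⟨f', hf'.continuous⟩ u), ?_, fun u => ?_⟩
    · exact (ContinuousLinearMap.contDiff (𝕜 := ℝ) (E := C(unitInterval, E →L[ℝ] F))
        (F := C(unitInterval, E) →L[ℝ] C(unitInterval, F)) pathApply).comp (ih ⟨f', hf'.continuous⟩ hf')
    · exact hasFDerivAt_superpose f ⟨f', hf'.continuous⟩ hd u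

theorem contDiff_superpose (f : C(E, F)) (hf : ContDiff ℝ ∞ f) :
    ContDiff ℝ ∞ (superpose f) := by
  rw [contDiff_infty] at hf ⊢
  exact fun n => contDiff_superpose_nat n f (hf n)

/-- A path in the unit interval, extended to the line by constants. -/
def extendPath (v : C(unitInterval, E)) (t : ℝ) : E := v (projIcc 0 1 zero_le_one t)

theorem continuous_extendPath (v : C(unitInterval, E)) : Continuous (extendPath v) :=
  v.continuous.comp continuous_projIcc

theorem extendPath_of_mem (v : C(unitInterval, E)) {t : ℝ} (ht : t ∈ Icc (0 : ℝ) 1) :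
    extendPath v t = v ⟨t, ht⟩ := by
  rw [extendPath, projIcc_of_mem zero_le_one ht]

theorem norm_extendPath_le (v : C(unitInterval, E)) (t : ℝ) : ‖extendPath v t‖ ≤ ‖v‖ :=
  ContinuousMap.norm_coe_le_norm _ _

/-- Integration from `0` on paths. -/
def pathIntegral : C(unitInterval, E) →L[ℝ] C(unitInterval, E) :=
  LinearMap.mkContinuous
    { toFun := fun v => ⟨fun t => ∫ s in (0 : ℝ)..t, extendPath v s,
        (intervalIntegral.continuous_primitive
          (fun _ _ => (continuous_extendPath v).intervalIntegrable _ _) 0).comp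
          continuous_subtype_val⟩
      map_add' := fun v w => by
        ext t
        exact intervalIntegral.integral_add ((continuous_extendPath v).intervalIntegrable _ _)
          ((continuous_extendPath w).intervalIntegrable _ _)
      map_smul' := fun c v => by
        ext t
        exact intervalIntegral.integral_smul c _ }
    1 (fun v => by
      rw [one_mul, ContinuousMap.norm_le _ (norm_nonneg _)]
      intro t
      refine (intervalIntegral.norm_integral_le_of_norm_le_const
        (fun s _ => norm_extendPath_le v s)).trans ?_
      have h0 := t.2.1
      have h1 := t.2.2
      rw [sub_zero, abs_of_nonneg h0]
      exact mul_le_of_le_one_right (norm_nonneg _) h1)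

theorem pathIntegral_apply (v : C(unitInterval, E)) (t : unitInterval) :
    pathIntegral v t = ∫ s in (0 : ℝ)..t, extendPath v s := rfl

/-- The Volterra operator `v ↦ ∫ A v`. -/
def volterra (A : C(unitInterval, E →L[ℝ] E)) : C(unitInterval, E) →L[ℝ] C(unitInterval, E) :=
  pathIntegral.comp (pathApply A)

/-- Iterated integration runs over a simplex, and its volume supplies the factorial. -/
theorem volterra_pow_le (A : C(unitInterval, E →L[ℝ] E)) (n : ℕ) (v : C(unitInterval, E))
    (t : unitInterval) :
    ‖(volterra A ^ n) v t‖ ≤ ‖A‖ ^ n * (t : ℝ) ^ n / n.factorial * ‖v‖ := by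
  induction n generalizing t with
  | zero => simpa using ContinuousMap.norm_coe_le_norm v t
  | succ n ih =>
    rw [pow_succ', mul_apply_eq_comp]
    change ‖∫ s in (0 : ℝ)..t, extendPath (pathApply A ((volterra A ^ n) v)) s‖ ≤ _
    have h0 := t.2.1
    have h1 := t.2.2
    have hi : IntervalIntegrable
        (fun s : ℝ => ‖A‖ * (‖A‖ ^ n * s ^ n / n.factorial * ‖v‖)) MeasureTheory.volume 0 t :=
      Continuous.intervalIntegrable (by fun_prop) _ _
    refine (intervalIntegral.norm_integral_le_of_norm_le h0 ?_ hi).trans_eq ?_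
    · refine MeasureTheory.ae_of_all _ fun s hs => ?_
      have hs' : s ∈ Icc (0 : ℝ) 1 := ⟨hs.1.le, hs.2.trans h1⟩
      rw [extendPath_of_mem _ hs', pathApply_apply]
      refine ((A _).le_opNorm _).trans ?_
      gcongr
      · exact ContinuousMap.norm_coe_le_norm _ _
      · exact ih ⟨s, hs'⟩
    · have h2 : (fun s : ℝ => ‖A‖ * (‖A‖ ^ n * s ^ n / n.factorial * ‖v‖)) =
          fun s => (‖A‖ ^ (n + 1) / n.factorial * ‖v‖) * s ^ n := by
        funext s; ring
      rw [h2, intervalIntegral.integral_const_mul, integral_pow, Nat.factorial_succ]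
      have : (n.factorial : ℝ) ≠ 0 := by positivity
      have : (n : ℝ) + 1 ≠ 0 := by positivity
      push_cast
      field_simp
      simp

/-- By the factorial bound some power Vⁿ has norm < 1, so 1 − Vⁿ is a unit by the Neumann series. As
1 − V is a factor of 1 − Vⁿ and commutes with the cofactor, it is a unit too, with no smallness
assumption on `A`. -/
theorem isUnit_one_sub_volterra [CompleteSpace E] (A : C(unitInterval, E →L[ℝ] E)) :
    IsUnit (1 - volterra A) := by
  obtain ⟨n, hn⟩ : ∃ n : ℕ, ‖A‖ ^ n / n.factorial < 1 :=
    (((FloorSemiring.tendsto_pow_div_factorial_atTop ‖A‖).eventually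
      (gt_mem_nhds zero_lt_one))).exists
  have h1 : ‖volterra A ^ n‖ < 1 := by
    refine lt_of_le_of_lt (ContinuousLinearMap.opNorm_le_bound _ (by positivity) fun v => ?_) hn
    rw [ContinuousMap.norm_le _ (by positivity)]
    intro t
    refine (volterra_pow_le A n v t).trans ?_
    have h0 := t.2.1
    have h1 := t.2.2
    gcongr
    exact mul_le_of_le_one_right (by positivity) (pow_le_one₀ h0 h1)
  have h2 : IsUnit (1 - volterra A ^ n) := 
    isUnit_one_sub_of_norm_lt_one (R := C(unitInterval, E) →L[ℝ] C(unitInterval, E)) h1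
  have h3 := mul_neg_geom_sum (volterra A) n
  have h4 : Commute (1 - volterra A) (∑ i ∈ Finset.range n, volterra A ^ i) := by
    refine Commute.sum_right _ _ _ fun i _ => ?_
    exact (Commute.one_left _).sub_left (Commute.self_pow _ _)
  rw [← h3] at h2
  exact (h4.isUnit_mul_iff.1 h2).1

/-- The constant path. -/
def constPath : E →L[ℝ] C(unitInterval, E) :=
  LinearMap.mkContinuous
    { toFun := fun x => ContinuousMap.const _ x
      map_add' := fun x y => rfl
      map_smul' := fun c x => rfl } 1
    (fun x => by
      rw [one_mul, ContinuousMap.norm_le _ (norm_nonneg _)]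
      intro t
      exact le_rfl)

@[simp] theorem constPath_apply (x : E) (t : unitInterval) : constPath x t = x := rfl

/-- The defect `u - ∫ f(u)` of a path. -/
def defect (f : C(E, E)) (u : C(unitInterval, E)) : C(unitInterval, E) :=
  u - pathIntegral (superpose f u)

theorem contDiff_defect (f : C(E, E)) (hf : ContDiff ℝ ∞ f) : ContDiff ℝ ∞ (defect f) :=
  contDiff_id.sub ((pathIntegral (E := E)).contDiff.comp (contDiff_superpose f hf))

/-- The derivative of a smooth map, as a continuous map. -/
def fderivMap (f : C(E, F)) (hf : ContDiff ℝ ∞ f) : C(E, E →L[ℝ] F) :=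
  ⟨fderiv ℝ f, hf.continuous_fderiv (by simp)⟩

theorem hasFDerivAt_defect (f : C(E, E)) (hf : ContDiff ℝ ∞ f) (u : C(unitInterval, E)) :
    HasFDerivAt (defect f) (1 - volterra (superpose (fderivMap f hf) u)) u := by
  have h1 := hasFDerivAt_superpose f (fderivMap f hf)
    (fun x => (hf.differentiable (by simp) x).hasFDerivAt) u
  exact (hasFDerivAt_id u).sub ((pathIntegral (E := E)).hasFDerivAt.comp u h1)

variable [CompleteSpace E]

theorem hasDerivAt_integral_extendPath (v : C(unitInterval, E)) (t : ℝ) :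
    HasDerivAt (fun t => ∫ s in (0 : ℝ)..t, extendPath v s) (extendPath v t) t :=
  intervalIntegral.integral_hasDerivAt_right ((continuous_extendPath v).intervalIntegrable _ _)
    ((continuous_extendPath v).stronglyMeasurableAtFilter _ _)
    (continuous_extendPath v).continuousAt

/-- A path with `u = v + ∫ w` where `v` is constant has derivative `w`. -/
theorem hasDerivWithinAt_of_eq_integral {u w : C(unitInterval, E)} {x : E}
    (h : u - pathIntegral w = constPath x) {t : ℝ} (ht : t ∈ Icc (0 : ℝ) 1) :
    HasDerivWithinAt (extendPath u) (extendPath w t) (Icc 0 1) t := by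
  have h1 : ∀ s ∈ Icc (0 : ℝ) 1, extendPath u s = x + ∫ r in (0 : ℝ)..s, extendPath w r := by
    intro s hs
    rw [extendPath_of_mem _ hs]
    have := congrArg (fun v : C(unitInterval, E) => v ⟨s, hs⟩) h
    simp only [ContinuousMap.sub_apply, constPath_apply, pathIntegral_apply] at this
    rw [← this]; simp
  exact ((hasDerivAt_integral_extendPath w t).const_add x).hasDerivWithinAt.congr h1 (h1 t ht)

/-- Conversely, a differentiable curve is the integral of its derivative. -/
theorem sub_integral_eq_const {u w : C(unitInterval, E)}
    (h : ∀ t ∈ Icc (0 : ℝ) 1, HasDerivWithinAt (extendPath u) (extendPath w t) (Icc 0 1) t) :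
    u - pathIntegral w = constPath (u 0) := by
  ext t
  have h1 : ∫ s in (0 : ℝ)..t, extendPath w s = extendPath u t - extendPath u 0 := by
    refine intervalIntegral.integral_eq_sub_of_hasDeriv_right_of_le t.2.1
      (continuous_extendPath u).continuousOn (fun s hs => ?_)
      ((continuous_extendPath w).intervalIntegrable _ _)
    have hs1 : s < 1 := hs.2.trans_le t.2.2
    exact ((h s ⟨hs.1.le, hs1.le⟩).hasDerivAt (Icc_mem_nhds hs.1 hs1)).hasDerivWithinAt
  rw [ContinuousMap.sub_apply, pathIntegral_apply, h1, extendPath_of_mem u t.2,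
    extendPath_of_mem u (left_mem_Icc.2 zero_le_one)]
  simp

theorem extendPath_superpose (f : C(E, F)) (u : C(unitInterval, E)) (t : ℝ) :
    extendPath (superpose f u) t = f (extendPath u t) := rfl

theorem hasDerivWithinAt_of_defect {f : C(E, E)} {u : C(unitInterval, E)} {x : E}
    (h : defect f u = constPath x) {t : ℝ} (ht : t ∈ Icc (0 : ℝ) 1) :
    HasDerivWithinAt (extendPath u) (f (extendPath u t)) (Icc 0 1) t :=
  hasDerivWithinAt_of_eq_integral h ht

theorem initial_of_defect {f : C(E, E)} {u : C(unitInterval, E)} {x : E}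
    (h : defect f u = constPath x) : u 0 = x := by
  have := congrArg (fun v : C(unitInterval, E) => v 0) h
  simpa [defect, pathIntegral_apply] using this

theorem exists_lipschitzOnWith_closedBall [FiniteDimensional ℝ E] {f : E → F}
    (hf : ContDiff ℝ 1 f) (R : ℝ) :
    ∃ K, LipschitzOnWith K f (Metric.closedBall 0 R) := by
  obtain ⟨C, hC⟩ := ((isCompact_closedBall (0 : E) R).image
    (hf.continuous_fderiv (by simp))).isBounded.exists_norm_le
  refine ⟨Real.toNNReal C, (convex_closedBall (0 : E) R).lipschitzOnWith_of_nnnorm_fderiv_le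
    (𝕜 := ℝ) (fun x _ => hf.differentiable (by simp) x) fun x hx => ?_⟩
  rw [← NNReal.coe_le_coe]
  exact (hC _ (mem_image_of_mem _ hx)).trans (Real.le_coe_toNNReal C)

/-- Both paths stay in one closed ball, where `f` is Lipschitz, so uniqueness for differential
equations applies although `f` need not be globally Lipschitz. -/
theorem defect_injective [FiniteDimensional ℝ E] {f : C(E, E)} (hf : ContDiff ℝ ∞ f)
    {u v : C(unitInterval, E)} {x : E} (hu : defect f u = constPath x)
    (hv : defect f v = constPath x) : u = v := by
  obtain ⟨K, hK⟩ := exists_lipschitzOnWith_closedBall (hf.of_le (by simp)) (max ‖u‖ ‖v‖)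
  have hmem : ∀ t ∈ Ico (0 : ℝ) 1, Icc (0 : ℝ) 1 ∈ 𝓝[≥] t := fun t ht =>
    Icc_mem_nhdsGE_of_mem ht
  have key := ODE_solution_unique_of_mem_Icc_right (v := fun _ => f)
    (s := fun _ => Metric.closedBall 0 (max ‖u‖ ‖v‖)) (K := K) (f := extendPath u)
    (g := extendPath v) (a := 0) (b := 1) (fun _ _ => hK) (continuous_extendPath u).continuousOn
    (fun t ht => (hasDerivWithinAt_of_defect hu ⟨ht.1, ht.2.le⟩).mono_of_mem_nhdsWithin
      (hmem t ht))
    (fun t _ => by simpa using Or.inl (norm_extendPath_le u t))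
    (continuous_extendPath v).continuousOn
    (fun t ht => (hasDerivWithinAt_of_defect hv ⟨ht.1, ht.2.le⟩).mono_of_mem_nhdsWithin
      (hmem t ht))
    (fun t _ => by simpa using Or.inr (norm_extendPath_le v t))
    (by
      rw [extendPath_of_mem u (left_mem_Icc.2 zero_le_one),
        extendPath_of_mem v (left_mem_Icc.2 zero_le_one)]
      exact (initial_of_defect hu).trans (initial_of_defect hv).symm)
  ext t
  have := key t.2
  rwa [extendPath_of_mem u t.2, extendPath_of_mem v t.2] at this

/-- The initial points from which the flow of `f` is defined up to time `1`. -/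
def flowDomain (f : C(E, E)) : Set E := {x | ∃ u, defect f u = constPath x}

open Classical in
/-- The trajectory of `f` on the unit interval with a given initial point. -/
def flowPath (f : C(E, E)) (x : E) : C(unitInterval, E) :=
  if h : x ∈ flowDomain f then h.choose else 0

theorem defect_flowPath {f : C(E, E)} {x : E} (hx : x ∈ flowDomain f) :
    defect f (flowPath f x) = constPath x := by
  rw [flowPath, dif_pos hx]
  exact hx.choose_spec

theorem flowPath_eq [FiniteDimensional ℝ E] {f : C(E, E)} (hf : ContDiff ℝ ∞ f) {x : E}
    {u : C(unitInterval, E)} (hu : defect f u = constPath x) : flowPath f x = u :=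
  defect_injective hf (defect_flowPath ⟨u, hu⟩) hu

theorem exists_defect_equiv (f : C(E, E)) (hf : ContDiff ℝ ∞ f) (u : C(unitInterval, E)) :
    ∃ e : C(unitInterval, E) ≃L[ℝ] C(unitInterval, E),
      HasFDerivAt (defect f) (e : C(unitInterval, E) →L[ℝ] C(unitInterval, E)) u := by
  obtain ⟨U, hU⟩ := isUnit_one_sub_volterra (superpose (fderivMap f hf) u)
  refine ⟨ContinuousLinearEquiv.unitsEquiv ℝ _ U, ?_⟩
  have h : ((ContinuousLinearEquiv.unitsEquiv ℝ _ U : C(unitInterval, E) ≃L[ℝ] C(unitInterval, E)) :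
      C(unitInterval, E) →L[ℝ] C(unitInterval, E)) = (U : _ →L[ℝ] _) := by
    ext v; rfl
  rw [h, hU]
  exact hasFDerivAt_defect f hf u

/-- Smooth dependence on the initial point. -/
theorem contDiffAt_flowPath [FiniteDimensional ℝ E] {f : C(E, E)} (hf : ContDiff ℝ ∞ f) {x : E}
    (hx : x ∈ flowDomain f) :
    flowDomain f ∈ 𝓝 x ∧ ContDiffAt ℝ ∞ (flowPath f) x := by
  -- The flow is the local inverse of `defect f` composed with the inclusion of constant paths, so
  -- it is as smooth as this inverse.
  obtain ⟨e, he⟩ := exists_defect_equiv f hf (flowPath f x)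
  have hc : ContDiffAt ℝ ∞ (defect f) (flowPath f x) := (contDiff_defect f hf).contDiffAt
  have h1 := hc.to_localInverse he (by simp)
  rw [defect_flowPath hx] at h1
  have hs : HasStrictFDerivAt (defect f)
      (e : C(unitInterval, E) →L[ℝ] C(unitInterval, E)) (flowPath f x) :=
    hc.hasStrictFDerivAt' he (by simp)
  -- The local inverse produces trajectories for all nearby initial points, which shows that the
  -- domain is a neighbourhood of `x`.
  have h2 := hs.eventually_right_inverse
  rw [defect_flowPath hx] at h2
  have h3 : ∀ᶠ y in 𝓝 x, defect f (hc.localInverse he (by simp) (constPath y)) = constPath y :=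
    (constPath (E := E)).continuous.continuousAt.eventually h2
  refine ⟨h3.mono fun y hy => ⟨_, hy⟩, ?_⟩
  refine (h1.comp x (constPath (E := E)).contDiff.contDiffAt).congr_of_eventuallyEq ?_
  exact h3.mono fun y hy => flowPath_eq hf hy

theorem isOpen_flowDomain [FiniteDimensional ℝ E] {f : C(E, E)} (hf : ContDiff ℝ ∞ f) :
    IsOpen (flowDomain f) :=
  isOpen_iff_mem_nhds.2 fun _ hx => (contDiffAt_flowPath hf hx).1

/-- The derivative of the flow solves the linearized equation. -/
theorem fderiv_flowPath [FiniteDimensional ℝ E] {f : C(E, E)} (hf : ContDiff ℝ ∞ f) {x : E}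
    (hx : x ∈ flowDomain f) (v : E) :
    fderiv ℝ (flowPath f) x v -
      pathIntegral (pathApply (superpose (fderivMap f hf) (flowPath f x))
        (fderiv ℝ (flowPath f) x v)) = constPath v := by
  obtain ⟨h1, h2⟩ := contDiffAt_flowPath hf hx
  have h3 := (hasFDerivAt_defect f hf (flowPath f x)).comp x
    (h2.differentiableAt (by simp)).hasFDerivAt
  -- The linearised equation is the derivative of this identity.
  have h4 : (defect f ∘ flowPath f) =ᶠ[𝓝 x] constPath := by
    filter_upwards [h1] with y hy using defect_flowPath hy
  have h5 := (h3.congr_of_eventuallyEq h4.symm).unique (constPath (E := E)).hasFDerivAt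
  exact congrArg (fun A : E →L[ℝ] C(unitInterval, E) => A v) h5

end TimeOneFlow
end
end ContactSR

namespace ContactSR
noncomputable section

/-! ### Hadamard's lemma: division by a linear factor with smooth dependence. -/

section Hadamard

universe u

variable {E F : Type u} [NormedAddCommGroup E] [NormedSpace ℝ E] [NormedAddCommGroup F]
  [NormedSpace ℝ F]

/-- The segment from `0` to a point, as a path. -/
def rayPath : E →L[ℝ] C(unitInterval, E) :=
  LinearMap.mkContinuous
    { toFun := fun x => ⟨fun t => (t : ℝ) • x, by fun_prop⟩
      map_add' := fun x y => by ext t; simp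
      map_smul' := fun c x => by ext t; simp [smul_comm c] } 1
    (fun x => by
      rw [one_mul, ContinuousMap.norm_le _ (norm_nonneg _)]
      intro t
      have h0 := t.2.1
      have h1 := t.2.2
      simp only [LinearMap.coe_mk, AddHom.coe_mk, ContinuousMap.coe_mk, norm_smul,
        Real.norm_eq_abs, abs_of_nonneg h0]
      exact mul_le_of_le_one_left (norm_nonneg _) h1)

@[simp] theorem rayPath_apply (x : E) (t : unitInterval) : rayPath x t = (t : ℝ) • x := rfl

/-- The average `∫₀¹ Df(s x) ds` of the derivative of `f` on the segment from `0` to `x`. -/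
def hadamard (f : C(E, F)) (hf : ContDiff ℝ ∞ f) (x : E) : E →L[ℝ] F :=
  pathIntegral (superpose (fderivMap f hf) (rayPath x)) 1

/-- Differentiation under the integral sign is avoided: the integral is a composition of bounded
linear maps with the smooth superposition operator. -/
theorem contDiff_hadamard (f : C(E, F)) (hf : ContDiff ℝ ∞ f) :
    ContDiff ℝ ∞ (hadamard f hf) := by
  have h1 : ContDiff ℝ ∞ (superpose (fderivMap f hf)) :=
    contDiff_superpose _ (hf.fderiv_right (m := ∞) (by simp))
  have h2 : ContDiff ℝ ∞ fun x => superpose (fderivMap f hf) (rayPath x) :=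
    h1.comp (rayPath (E := E)).contDiff
  have h3 : ContDiff ℝ ∞ fun x =>
      pathIntegral (superpose (fderivMap f hf) (rayPath x)) :=
    (pathIntegral (E := E →L[ℝ] F)).contDiff.comp h2
  exact (ContinuousMap.evalCLM ℝ (1 : unitInterval)).contDiff.comp h3

theorem hadamard_zero [CompleteSpace F] (f : C(E, F)) (hf : ContDiff ℝ ∞ f) :
    hadamard f hf 0 = fderiv ℝ f 0 := by
  rw [hadamard, pathIntegral_apply]
  have h : ∀ s, extendPath (superpose (fderivMap f hf) (rayPath (0 : E))) s = fderiv ℝ f 0 := by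
    intro s
    simp [extendPath, fderivMap]
  rw [intervalIntegral.integral_congr fun s _ => h s]
  simp

theorem hadamard_apply_self [CompleteSpace F] (f : C(E, F)) (hf : ContDiff ℝ ∞ f) (x : E) :
    hadamard f hf x x = f x - f 0 := by
  have h1 : ∀ t : ℝ, HasDerivAt (fun s : ℝ => f (s • x)) (fderiv ℝ f (t • x) x) t := fun t => by
    have h2 : HasDerivAt (fun s : ℝ => s • x) x t := by
      simpa using (hasDerivAt_id t).smul_const x
    exact ((hf.differentiable (by simp) _).hasFDerivAt.comp_hasDerivAt t h2)
  have hc : Continuous fun t : ℝ => fderiv ℝ f (t • x) x :=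
    ((hf.continuous_fderiv (by simp)).comp (by fun_prop)).clm_apply continuous_const
  have h3 := intervalIntegral.integral_eq_sub_of_hasDerivAt (a := 0) (b := 1)
    (fun t _ => h1 t) (hc.intervalIntegrable _ _)
  rw [hadamard, pathIntegral_apply]
  rw [ContinuousLinearMap.intervalIntegral_apply
    ((continuous_extendPath _).intervalIntegrable _ _)]
  simp only [one_smul, zero_smul] at h3
  rw [← h3]
  refine intervalIntegral.integral_congr fun t ht => ?_
  simp only [Icc.coe_one, uIcc_of_le (zero_le_one' ℝ)] at ht
  rw [extendPath_of_mem _ ht]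
  rfl

end Hadamard

/-! ### The Hamiltonian field of a frame with parameter, and conservation of the symplectic form. -/

section HamiltonianField

universe u

variable {κ : Type} [Fintype κ] {V : Type u} [NormedAddCommGroup V] [NormedSpace ℝ V]

/-- A frame parameter, a position and a momentum. -/
abbrev PhaseSpace (V : Type u) [NormedAddCommGroup V] [NormedSpace ℝ V] : Type u :=
  ℝ × V × (V →L[ℝ] ℝ)

/-- The derivative in the position of a vector field depending on a parameter. -/
def posDeriv (Y : ℝ × V → V) (p : ℝ × V) : V →L[ℝ] V :=
  (fderiv ℝ Y p).comp (ContinuousLinearMap.inr ℝ ℝ V)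

/-- The Hamiltonian vector field of `½ ∑ ξ(Y_k)²`; the parameter is constant. -/
def hamField (Y : κ → ℝ × V → V) (z : PhaseSpace V) : PhaseSpace V :=
  (0, ∑ k, z.2.2 (Y k (z.1, z.2.1)) • Y k (z.1, z.2.1),
    -∑ k, z.2.2 (Y k (z.1, z.2.1)) • z.2.2.comp (posDeriv (Y k) (z.1, z.2.1)))

theorem contDiff_posDeriv {Y : ℝ × V → V} (hY : ContDiff ℝ ∞ Y) :
    ContDiff ℝ ∞ (posDeriv Y) :=
  (hY.fderiv_right (m := ∞) (by simp)).clm_comp contDiff_const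

theorem contDiff_hamField {Y : κ → ℝ × V → V} (hY : ∀ k, ContDiff ℝ ∞ (Y k)) :
    ContDiff ℝ ∞ (hamField Y) := by
  have hp : ContDiff ℝ ∞ fun z : PhaseSpace V => (z.1, z.2.1) := by fun_prop
  have h1 : ∀ k, ContDiff ℝ ∞ fun z : PhaseSpace V => Y k (z.1, z.2.1) := fun k => (hY k).comp hp
  have h2 : ∀ k, ContDiff ℝ ∞ fun z : PhaseSpace V => posDeriv (Y k) (z.1, z.2.1) :=
    fun k => (contDiff_posDeriv (hY k)).comp hp
  have h3 : ContDiff ℝ ∞ fun z : PhaseSpace V => z.2.2 := by fun_prop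
  refine contDiff_const.prodMk ((ContDiff.sum fun k _ => ?_).prodMk (ContDiff.sum fun k _ => ?_).neg)
  · exact (h3.clm_apply (h1 k)).smul (h1 k)
  · exact (h3.clm_apply (h1 k)).smul (h3.clm_comp (h2 k))

/-- The canonical symplectic form (the parameter does not enter). -/
def symplectic (e e' : PhaseSpace V) : ℝ := e'.2.2 e.2.1 - e.2.2 e'.2.1

/-- Differentiation along a line on which the frame parameter is frozen; the explicit form is what
exhibits the cancellations in `symplectic_fderiv_hamField`. -/
theorem hasDerivAt_hamField {Y : κ → ℝ × V → V} (hY : ∀ k, ContDiff ℝ ∞ (Y k))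
    (z : PhaseSpace V) (v : V) (α : V →L[ℝ] ℝ) :
    fderiv ℝ (hamField Y) z (0, v, α) =
      (0, ∑ k, ((z.2.2 (Y k (z.1, z.2.1))) • posDeriv (Y k) (z.1, z.2.1) v +
          (z.2.2 (posDeriv (Y k) (z.1, z.2.1) v) + α (Y k (z.1, z.2.1))) • Y k (z.1, z.2.1)),
        -∑ k, ((z.2.2 (Y k (z.1, z.2.1))) •
            (z.2.2.comp ((fderiv ℝ (fderiv ℝ (Y k)) (z.1, z.2.1) (0, v)).comp
              (ContinuousLinearMap.inr ℝ ℝ V)) + α.comp (posDeriv (Y k) (z.1, z.2.1))) +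
          (z.2.2 (posDeriv (Y k) (z.1, z.2.1) v) + α (Y k (z.1, z.2.1))) •
            z.2.2.comp (posDeriv (Y k) (z.1, z.2.1)))) := by
  obtain ⟨ε, y, ξ⟩ := z
  have hl : HasDerivAt (fun r : ℝ => ((ε, y + r • v, ξ + r • α) : PhaseSpace V)) (0, v, α) 0 := by
    refine (hasDerivAt_const _ _).prodMk (HasDerivAt.prodMk ?_ ?_)
    · simpa using ((hasDerivAt_id (0 : ℝ)).smul_const v).const_add y
    · simpa using ((hasDerivAt_id (0 : ℝ)).smul_const α).const_add ξ
  have hl2 : HasDerivAt (fun r : ℝ => ((ε, y + r • v) : ℝ × V)) (0, v) 0 := by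
    refine (hasDerivAt_const _ _).prodMk ?_
    simpa using ((hasDerivAt_id (0 : ℝ)).smul_const v).const_add y
  have hξ : HasDerivAt (fun r : ℝ => ξ + r • α) α 0 := by
    simpa using ((hasDerivAt_id (0 : ℝ)).smul_const α).const_add ξ
  have h0 : ((ε, y + (0 : ℝ) • v, ξ + (0 : ℝ) • α) : PhaseSpace V) = (ε, y, ξ) := by simp
  have h02 : ((ε, y + (0 : ℝ) • v) : ℝ × V) = (ε, y) := by simp
  have hd : HasFDerivAt (hamField Y) (fderiv ℝ (hamField Y) (ε, y, ξ))
      ((ε, y + (0 : ℝ) • v, ξ + (0 : ℝ) • α) : PhaseSpace V) := by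
    rw [h0]
    exact ((contDiff_hamField hY).differentiable (by simp) _).hasFDerivAt
  have h1 := hd.comp_hasDerivAt (0 : ℝ) hl
  refine h1.unique ?_
  have hYd : ∀ k, HasDerivAt (fun r : ℝ => Y k (ε, y + r • v)) (posDeriv (Y k) (ε, y) v) 0 := by
    intro k
    have : HasFDerivAt (Y k) (fderiv ℝ (Y k) (ε, y)) ((ε, y + (0 : ℝ) • v) : ℝ × V) := by
      rw [h02]; exact ((hY k).differentiable (by simp) _).hasFDerivAt
    exact this.comp_hasDerivAt (0 : ℝ) hl2
  have hDd : ∀ k, HasDerivAt (fun r : ℝ => posDeriv (Y k) (ε, y + r • v))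
      ((fderiv ℝ (fderiv ℝ (Y k)) (ε, y) (0, v)).comp (ContinuousLinearMap.inr ℝ ℝ V)) 0 := by
    intro k
    have h3 : HasFDerivAt (fderiv ℝ (Y k)) (fderiv ℝ (fderiv ℝ (Y k)) (ε, y))
        ((ε, y + (0 : ℝ) • v) : ℝ × V) := by
      rw [h02]
      exact ((((hY k).fderiv_right (m := ∞) (by simp))).differentiable (by simp) _).hasFDerivAt
    have h4 := h3.comp_hasDerivAt (0 : ℝ) hl2
    have h5 := h4.clm_comp (hasDerivAt_const (0 : ℝ) (ContinuousLinearMap.inr ℝ ℝ V))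
    simp only [ContinuousLinearMap.comp_zero, add_zero] at h5
    exact h5
  have hs : ∀ k, HasDerivAt (fun r : ℝ => (ξ + r • α) (Y k (ε, y + r • v)))
      (ξ (posDeriv (Y k) (ε, y) v) + α (Y k (ε, y))) 0 := by
    intro k
    have := hξ.clm_apply (hYd k)
    refine this.congr_deriv ?_
    simp [add_comm]
  refine (hasDerivAt_const _ _).prodMk (HasDerivAt.prodMk ?_ ?_)
  · convert HasDerivAt.fun_sum (u := Finset.univ) fun k _ => (hs k).fun_smul (hYd k) using 1
    simp
  · convert (HasDerivAt.fun_sum (u := Finset.univ)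
      fun k _ => (hs k).fun_smul (hξ.clm_comp (hDd k))).fun_neg using 1
    simp [add_comm]

/-- The linearised Hamiltonian field is infinitesimally symplectic. The terms with second
derivatives of the frame cancel by symmetry of the Hessian, the others algebraically. -/
theorem symplectic_fderiv_hamField {Y : κ → ℝ × V → V} (hY : ∀ k, ContDiff ℝ ∞ (Y k))
    (z e e' : PhaseSpace V) (he : e.1 = 0) (he' : e'.1 = 0) :
    symplectic (fderiv ℝ (hamField Y) z e) e' + symplectic e (fderiv ℝ (hamField Y) z e') = 0 := by
  obtain ⟨a, v, α⟩ := e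
  obtain ⟨a', v', α'⟩ := e'
  obtain rfl : a = 0 := he
  obtain rfl : a' = 0 := he'
  rw [hasDerivAt_hamField hY, hasDerivAt_hamField hY]
  have hsymm : ∀ k, fderiv ℝ (fderiv ℝ (Y k)) (z.1, z.2.1) (0, v) (0, v') =
      fderiv ℝ (fderiv ℝ (Y k)) (z.1, z.2.1) (0, v') (0, v) := fun k =>
    ((hY k).contDiffAt.isSymmSndFDerivAt (by
      rw [minSmoothness_of_isRCLikeNormedField]; exact WithTop.coe_le_coe.2 le_top)).eq _ _
  simp only [symplectic, map_sum, map_add, map_smul, neg_apply,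
    sum_apply, add_apply, smul_apply,
    ContinuousLinearMap.comp_apply, smul_eq_mul, ContinuousLinearMap.inr_apply, hsymm]
  rw [sub_neg_eq_add, ← Finset.sum_add_distrib, neg_sub_left, ← sub_eq_add_neg,
    ← Finset.sum_add_distrib, ← Finset.sum_sub_distrib]
  refine Finset.sum_eq_zero fun k _ => ?_
  ring

variable [FiniteDimensional ℝ V]

/-- `hamField` as a continuous map. -/
def hamMap (Y : κ → ℝ × V → V) (hY : ∀ k, ContDiff ℝ ∞ (Y k)) :
    C(PhaseSpace V, PhaseSpace V) :=
  ⟨hamField Y, (contDiff_hamField hY).continuous⟩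

/-- Variations of the flow with fixed parameter preserve the symplectic form. -/
theorem symplectic_fderiv_flowPath {Y : κ → ℝ × V → V} (hY : ∀ k, ContDiff ℝ ∞ (Y k))
    {x : PhaseSpace V} (hx : x ∈ flowDomain (hamMap Y hY)) (e e' : PhaseSpace V)
    (he : e.1 = 0) (he' : e'.1 = 0) :
    symplectic (fderiv ℝ (flowPath (hamMap Y hY)) x e 1)
      (fderiv ℝ (flowPath (hamMap Y hY)) x e' 1) = symplectic e e' := by
  have hf : ContDiff ℝ ∞ (hamMap Y hY) := contDiff_hamField hY
  have key : ∀ e : PhaseSpace V, e.1 = 0 →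
      (∀ t ∈ Icc (0 : ℝ) 1, HasDerivWithinAt
        (extendPath (fderiv ℝ (flowPath (hamMap Y hY)) x e))
        (fderiv ℝ (hamField Y) (extendPath (flowPath (hamMap Y hY) x) t)
          (extendPath (fderiv ℝ (flowPath (hamMap Y hY)) x e) t)) (Icc 0 1) t) ∧
      extendPath (fderiv ℝ (flowPath (hamMap Y hY)) x e) 0 = e ∧
      ∀ t ∈ Icc (0 : ℝ) 1, (extendPath (fderiv ℝ (flowPath (hamMap Y hY)) x e) t).1 = 0 := by
    intro e he
    have h1 := fderiv_flowPath hf hx e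
    have h2 : ∀ t ∈ Icc (0 : ℝ) 1, HasDerivWithinAt
        (extendPath (fderiv ℝ (flowPath (hamMap Y hY)) x e))
        (fderiv ℝ (hamField Y) (extendPath (flowPath (hamMap Y hY) x) t)
          (extendPath (fderiv ℝ (flowPath (hamMap Y hY)) x e) t)) (Icc 0 1) t :=
      fun t ht => hasDerivWithinAt_of_eq_integral h1 ht
    have h3 : extendPath (fderiv ℝ (flowPath (hamMap Y hY)) x e) 0 = e := by
      have := congrArg (fun v : C(unitInterval, PhaseSpace V) => v 0) h1
      rw [extendPath_of_mem _ (left_mem_Icc.2 zero_le_one)]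
      simpa [pathIntegral_apply] using this
    refine ⟨h2, h3, fun t ht => ?_⟩
    -- The parameter does not move along the flow, so a variation that does not change it initially
    -- never does. The infinitesimal identity is known only for such variations.
    have h4 : ∀ z w : PhaseSpace V, (fderiv ℝ (hamField Y) z w).1 = 0 := by
      intro z w
      have h5 : HasFDerivAt (fun z => (hamField Y z).1)
          ((ContinuousLinearMap.fst ℝ ℝ _).comp (fderiv ℝ (hamField Y) z)) z :=
        (ContinuousLinearMap.fst ℝ ℝ (V × (V →L[ℝ] ℝ))).hasFDerivAt.comp z
          ((contDiff_hamField hY).differentiable (by simp) z).hasFDerivAt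
      have h6 : HasFDerivAt (fun z : PhaseSpace V => (hamField Y z).1) 0 z :=
        hasFDerivAt_const (𝕜 := ℝ) (E := PhaseSpace V) (0 : ℝ) z
      exact congrArg (fun A : PhaseSpace V →L[ℝ] ℝ => A w) (h5.unique h6)
    have h7 : ∀ s ∈ Icc (0 : ℝ) 1, HasDerivWithinAt
        (fun s => (extendPath (fderiv ℝ (flowPath (hamMap Y hY)) x e) s).1) 0 (Icc 0 1) s := by
      intro s hs
      have := (ContinuousLinearMap.fst ℝ ℝ (V × (V →L[ℝ] ℝ))).hasFDerivAt.comp_hasDerivWithinAt s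
        (h2 s hs)
      simpa only [ContinuousLinearMap.coe_fst', h4] using! this
    have h8 := constant_of_has_deriv_right_zero
      (f := fun s => (extendPath (fderiv ℝ (flowPath (hamMap Y hY)) x e) s).1) (a := 0) (b := 1)
      (continuous_fst.comp (continuous_extendPath _)).continuousOn
      (fun s hs => (h7 s ⟨hs.1, hs.2.le⟩).mono_of_mem_nhdsWithin (Icc_mem_nhdsGE_of_mem hs)) t ht
    rw [h8, h3, he]
  obtain ⟨d1, i1, z1⟩ := key e he
  obtain ⟨d2, i2, z2⟩ := key e' he'
  set w1 := fderiv ℝ (flowPath (hamMap Y hY)) x e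
  set w2 := fderiv ℝ (flowPath (hamMap Y hY)) x e'
  have hd : ∀ s ∈ Icc (0 : ℝ) 1, HasDerivWithinAt
      (fun s => symplectic (extendPath w1 s) (extendPath w2 s)) 0 (Icc 0 1) s := by
    intro s hs
    have p1 : HasDerivWithinAt (fun s => (extendPath w1 s).2.1) _ (Icc 0 1) s :=
      ((ContinuousLinearMap.fst ℝ V (V →L[ℝ] ℝ)).comp
        (ContinuousLinearMap.snd ℝ ℝ (V × (V →L[ℝ] ℝ)))).hasFDerivAt.comp_hasDerivWithinAt s
          (d1 s hs)
    have m1 : HasDerivWithinAt (fun s => (extendPath w1 s).2.2) _ (Icc 0 1) s :=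
      ((ContinuousLinearMap.snd ℝ V (V →L[ℝ] ℝ)).comp
        (ContinuousLinearMap.snd ℝ ℝ (V × (V →L[ℝ] ℝ)))).hasFDerivAt.comp_hasDerivWithinAt s
          (d1 s hs)
    have p2 : HasDerivWithinAt (fun s => (extendPath w2 s).2.1) _ (Icc 0 1) s :=
      ((ContinuousLinearMap.fst ℝ V (V →L[ℝ] ℝ)).comp
        (ContinuousLinearMap.snd ℝ ℝ (V × (V →L[ℝ] ℝ)))).hasFDerivAt.comp_hasDerivWithinAt s
          (d2 s hs)
    have m2 : HasDerivWithinAt (fun s => (extendPath w2 s).2.2) _ (Icc 0 1) s :=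
      ((ContinuousLinearMap.snd ℝ V (V →L[ℝ] ℝ)).comp
        (ContinuousLinearMap.snd ℝ ℝ (V × (V →L[ℝ] ℝ)))).hasFDerivAt.comp_hasDerivWithinAt s
          (d2 s hs)
    have := (m2.clm_apply p1).sub (m1.clm_apply p2)
    refine this.congr_deriv ?_
    have h9 := symplectic_fderiv_hamField hY (extendPath (flowPath (hamMap Y hY) x) s)
      (extendPath w1 s) (extendPath w2 s) (z1 s hs) (z2 s hs)
    simp only [symplectic] at h9
    simp only [ContinuousLinearMap.comp_apply, ContinuousLinearMap.coe_fst',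
      ContinuousLinearMap.coe_snd']
    linarith
  have hc : ContinuousOn (fun s => symplectic (extendPath w1 s) (extendPath w2 s)) (Icc 0 1) :=
    fun s hs => (hd s hs).continuousWithinAt
  have h10 := constant_of_has_deriv_right_zero hc
    (fun s hs => (hd s ⟨hs.1, hs.2.le⟩).mono_of_mem_nhdsWithin (Icc_mem_nhdsGE_of_mem hs)) 1
    (right_mem_Icc.2 zero_le_one)
  rw [i1, i2, extendPath_of_mem w1 (right_mem_Icc.2 zero_le_one),
    extendPath_of_mem w2 (right_mem_Icc.2 zero_le_one)] at h10
  exact h10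

end HamiltonianField
end
end ContactSR

namespace ContactSR
noncomputable section

/-! ### Explicit extremals of the nilpotent frame. -/

section NilpotentFlow

variable {n : ℕ}

/-- The point `(x, z)`. -/
def coordMk (x : HIdx n → ℝ) (z : ℝ) : Coord n := WithLp.toLp 2 fun o => o.elim z x

@[simp] theorem coordMk_some (x : HIdx n → ℝ) (z : ℝ) (k : HIdx n) :
    coordMk x z (some k) = x k := rfl

@[simp] theorem coordMk_none (x : HIdx n → ℝ) (z : ℝ) : coordMk x z none = z := rfl

theorem Coord.ext {y y' : Coord n} (h : ∀ k, y (some k) = y' (some k)) (h0 : y none = y' none) :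
    y = y' := by
  ext o
  rcases o with _ | k
  · exact h0
  · exact h k

@[simp] theorem Coord.sum_apply {ι : Type*} (s : Finset ι) (f : ι → Coord n) (o : Option (HIdx n)) :
    (∑ i ∈ s, f i) o = ∑ i ∈ s, f i o := by
  exact map_sum (EuclideanSpace.proj (𝕜 := ℝ) o : Coord n →L[ℝ] ℝ) f s

theorem hasDerivWithinAt_coord {f : ℝ → Coord n} {f' : Coord n} {s : Set ℝ} {t : ℝ}
    (h : ∀ k, HasDerivWithinAt (fun t => f t (some k)) (f' (some k)) s t)
    (h0 : HasDerivWithinAt (fun t => f t none) (f' none) s t) : HasDerivWithinAt f f' s t := by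
  rw [hasDerivWithinAt_iff_hasFDerivWithinAt, hasFDerivWithinAt_euclidean]
  rintro (_ | k)
  · exact h0.hasFDerivWithinAt.congr_fderiv (by ext; simp)
  · exact (h k).hasFDerivWithinAt.congr_fderiv (by ext; simp)

theorem hasDerivAt_linForm {p : ℝ → HIdx n → ℝ} {p' : HIdx n → ℝ} {w : ℝ → ℝ} {w' : ℝ}
    {s : Set ℝ} {t : ℝ} (hp : ∀ k, HasDerivWithinAt (fun t => p t k) (p' k) s t)
    (hw : HasDerivWithinAt w w' s t) :
    HasDerivWithinAt (fun t => linForm (p t) (w t)) (linForm p' w') s t :=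
  (HasDerivWithinAt.fun_sum fun k _ => (hp k).smul_const (EuclideanSpace.proj (𝕜 := ℝ) (some k) : Coord n →L[ℝ] ℝ)).add (hw.smul_const (EuclideanSpace.proj (𝕜 := ℝ) none : Coord n →L[ℝ] ℝ))

theorem linForm_single (p : HIdx n → ℝ) (w : ℝ) (o : Option (HIdx n)) :
    linForm p w (EuclideanSpace.single o 1) = o.elim w p := by
  rw [linForm_apply]
  rcases o with _ | k <;> simp

theorem ext_linForm {ξ ξ' : Coord n →L[ℝ] ℝ}
    (h : ∀ o, ξ (EuclideanSpace.single o 1) = ξ' (EuclideanSpace.single o 1)) : ξ = ξ' := by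
  ext v
  have hv : v = ∑ o, v o • EuclideanSpace.single o (1 : ℝ) := by
    ext o
    rcases o with _ | k <;> simp
  rw [hv, map_sum, map_sum]
  simp only [map_smul, h]

/-- A smooth one-parameter family of frames which for the parameter `0` is the nilpotent frame
`∂_{x_{2i-1}} + (b_i / 2) x_{2i} ∂_z`, `∂_{x_{2i}} - (b_i / 2) x_{2i-1} ∂_z`. -/
structure IsNilpotentDeformation (b : Fin n → ℝ) (Y : HIdx n → ℝ × Coord n → Coord n) :
    Prop where
  smooth : ∀ k, ContDiff ℝ ∞ (Y k)
  odd : ∀ i y, Y (i, 0) (0, y) = EuclideanSpace.single (some (i, 0)) 1 +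
    (b i / 2 * y (some (i, 1))) • EuclideanSpace.single none 1
  even : ∀ i y, Y (i, 1) (0, y) = EuclideanSpace.single (some (i, 1)) 1 +
    (-(b i / 2) * y (some (i, 0))) • EuclideanSpace.single none 1

theorem posDeriv_of_affine {Y : ℝ × Coord n → Coord n} (hY : ContDiff ℝ ∞ Y) {a e : Coord n}
    {c : ℝ} {o : Option (HIdx n)} (h : ∀ y, Y (0, y) = a + (c * y o) • e) (y v : Coord n) :
    posDeriv Y (0, y) v = (c * v o) • e := by
  have h1 : HasFDerivAt (fun y : Coord n => Y (0, y)) (posDeriv Y (0, y)) y := by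
    have h2 : HasFDerivAt (fun y : Coord n => ((0, y) : ℝ × Coord n))
        (ContinuousLinearMap.inr ℝ ℝ (Coord n)) y := by
      exact (ContinuousLinearMap.inr ℝ ℝ (Coord n)).hasFDerivAt (x := y)
    exact (hY.differentiable (by simp) (0, y)).hasFDerivAt.comp y h2
  have h3 : HasFDerivAt (fun y : Coord n => a + (c * y o) • e)
      (((c • EuclideanSpace.proj (𝕜 := ℝ) o) : Coord n →L[ℝ] ℝ).smulRight e) y := by
    have := (((c • EuclideanSpace.proj (𝕜 := ℝ) o) : Coord n →L[ℝ] ℝ).smulRight e).hasFDerivAt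
      (x := y)
    exact this.const_add a
  have h4 : (fun y : Coord n => Y (0, y)) = fun y : Coord n => a + (c * y o) • e := funext h
  rw [h4] at h1
  rw [h1.unique h3]
  simp

/-- The integral of `cos (θ s)` for `s ∈ [0, t]`. -/
def cosInt (θ t : ℝ) : ℝ := t * Real.sinc (θ * t)

/-- The integral of `sin (θ s)` for `s ∈ [0, t]`. -/
def sinInt (θ t : ℝ) : ℝ := (1 - Real.cos (θ * t)) / θ

theorem hasDerivAt_cosInt (θ t : ℝ) : HasDerivAt (cosInt θ) (Real.cos (θ * t)) t := by
  rcases eq_or_ne θ 0 with rfl | hθ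
  · have : cosInt 0 = id := by funext s; simp [cosInt]
    rw [this]; simpa using hasDerivAt_id t
  · have : cosInt θ = fun s => Real.sin (θ * s) / θ := by
      funext s
      rcases eq_or_ne s 0 with rfl | hs
      · simp [cosInt]
      · rw [cosInt, Real.sinc_of_ne_zero (mul_ne_zero hθ hs)]; field_simp
    rw [this]
    have h := ((hasDerivAt_id t).const_mul θ).sin.div_const θ
    refine h.congr_deriv ?_
    simp; field_simp

theorem hasDerivAt_sinInt (θ t : ℝ) : HasDerivAt (sinInt θ) (Real.sin (θ * t)) t := by
  rcases eq_or_ne θ 0 with rfl | hθ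
  -- Division by zero returns 0, which is the correct value of the integral of sin 0.
  · have : sinInt 0 = fun _ => 0 := by funext s; simp [sinInt]
    rw [this]; simpa using hasDerivAt_const t (0 : ℝ)
  · have h := (((hasDerivAt_id t).const_mul θ).cos.const_sub 1).div_const θ
    refine h.congr_deriv ?_
    simp; field_simp

/-- For θ = 0 both sides are 0 by the convention on division, which agrees with the zero area swept
along a straight line through the origin. -/
theorem hasDerivAt_areaInt (θ t : ℝ) :
    HasDerivAt (fun t => (t - cosInt θ t) / θ) (sinInt θ t) t :=
  (((hasDerivAt_id t).sub (hasDerivAt_cosInt θ t)).div_const θ)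

/-- The velocities of the nilpotent extremals. -/
def nilVel (b : Fin n → ℝ) (h : HIdx n → ℝ) (w t : ℝ) (k : HIdx n) : ℝ :=
  if k.2 = 0 then Real.cos (b k.1 * w * t) * h (k.1, 0) + Real.sin (b k.1 * w * t) * h (k.1, 1)
  else Real.cos (b k.1 * w * t) * h (k.1, 1) - Real.sin (b k.1 * w * t) * h (k.1, 0)

/-- The horizontal position of the nilpotent extremals. -/
def nilHor (b : Fin n → ℝ) (h : HIdx n → ℝ) (w t : ℝ) (k : HIdx n) : ℝ :=
  if k.2 = 0 then cosInt (b k.1 * w) t * h (k.1, 0) + sinInt (b k.1 * w) t * h (k.1, 1)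
  else cosInt (b k.1 * w) t * h (k.1, 1) - sinInt (b k.1 * w) t * h (k.1, 0)

/-- The vertical position of the nilpotent extremals. -/
def nilVert (b : Fin n → ℝ) (h : HIdx n → ℝ) (w t : ℝ) : ℝ :=
  ∑ i, b i / 2 * (h (i, 0) ^ 2 + h (i, 1) ^ 2) * ((t - cosInt (b i * w) t) / (b i * w))

/-- The horizontal momentum of the nilpotent extremals. -/
def nilMom (b : Fin n → ℝ) (h : HIdx n → ℝ) (w t : ℝ) (k : HIdx n) : ℝ :=
  if k.2 = 0 then nilVel b h w t k - b k.1 * w / 2 * nilHor b h w t (k.1, 1)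
  else nilVel b h w t k + b k.1 * w / 2 * nilHor b h w t (k.1, 0)

theorem sum_hIdx (f : HIdx n → ℝ) : ∑ k, f k = ∑ i, (f (i, 0) + f (i, 1)) := by
  rw [Fintype.sum_prod_type]
  simp

theorem hasDerivAt_nilHor (b : Fin n → ℝ) (h : HIdx n → ℝ) (w t : ℝ) (k : HIdx n) :
    HasDerivAt (fun t => nilHor b h w t k) (nilVel b h w t k) t := by
  unfold nilHor nilVel
  split_ifs
  · exact ((hasDerivAt_cosInt _ _).mul_const _).add ((hasDerivAt_sinInt _ _).mul_const _)
  · exact ((hasDerivAt_cosInt _ _).mul_const _).sub ((hasDerivAt_sinInt _ _).mul_const _)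

theorem hasDerivAt_nilVel (b : Fin n → ℝ) (h : HIdx n → ℝ) (w t : ℝ) (i : Fin n) :
    HasDerivAt (fun t => nilVel b h w t (i, 0)) (b i * w * nilVel b h w t (i, 1)) t ∧
    HasDerivAt (fun t => nilVel b h w t (i, 1)) (-(b i * w * nilVel b h w t (i, 0))) t := by
  have hl : HasDerivAt (fun t : ℝ => b i * w * t) (b i * w) t := by
    simpa using (hasDerivAt_id t).const_mul (b i * w)
  simp only [nilVel, if_true, one_ne_zero, if_false]
  constructor
  · refine ((hl.cos.mul_const _).add (hl.sin.mul_const _)).congr_deriv ?_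
    ring
  · refine ((hl.cos.mul_const _).sub (hl.sin.mul_const _)).congr_deriv ?_
    ring

/-- The rate of the area swept in one plane. Velocity and position are both images of h by multiples
of rotations, so their cross product is |h|² times sin · `cosInt` − cos · `sinInt`, and this factor
simplifies to `sinInt`. -/
theorem vel_cross_hor (b : Fin n → ℝ) (h : HIdx n → ℝ) (w t : ℝ) (i : Fin n) :
    nilVel b h w t (i, 0) * nilHor b h w t (i, 1) - nilVel b h w t (i, 1) * nilHor b h w t (i, 0) =
      (h (i, 0) ^ 2 + h (i, 1) ^ 2) * sinInt (b i * w) t := by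
  simp only [nilVel, nilHor, if_true, one_ne_zero, if_false]
  have hsc : Real.sin (b i * w * t) * cosInt (b i * w) t -
      Real.cos (b i * w * t) * sinInt (b i * w) t = sinInt (b i * w) t := by
    rcases eq_or_ne (b i * w) 0 with h0 | h0
    · simp [h0, sinInt]
    · have h1 : cosInt (b i * w) t = Real.sin (b i * w * t) / (b i * w) := by
        rcases eq_or_ne t 0 with rfl | ht
        · simp [cosInt]
        · rw [cosInt, Real.sinc_of_ne_zero (mul_ne_zero h0 ht)]; field_simp
      rw [h1, sinInt]
      have := Real.sin_sq_add_cos_sq (b i * w * t)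
      generalize b i * w = θ at *
      field_simp
      linear_combination this
  linear_combination (h (i, 0) ^ 2 + h (i, 1) ^ 2) * hsc

theorem hasDerivAt_nilVert (b : Fin n → ℝ) (h : HIdx n → ℝ) (w t : ℝ) :
    HasDerivAt (fun t => nilVert b h w t)
      (∑ i, b i / 2 * (nilVel b h w t (i, 0) * nilHor b h w t (i, 1) -
        nilVel b h w t (i, 1) * nilHor b h w t (i, 0))) t := by
  unfold nilVert
  refine HasDerivAt.fun_sum fun i _ => ?_
  refine ((hasDerivAt_areaInt (b i * w) t).const_mul _).congr_deriv ?_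
  rw [vel_cross_hor]; ring

/-- The nilpotent extremals. -/
def nilCurve (b : Fin n → ℝ) (h : HIdx n → ℝ) (w t : ℝ) : PhaseSpace (Coord n) :=
  (0, coordMk (nilHor b h w t) (nilVert b h w t), linForm (nilMom b h w t) w)

theorem nilCurve_zero (b : Fin n → ℝ) (h : HIdx n → ℝ) (w : ℝ) :
    nilCurve b h w 0 = (0, 0, linForm h w) := by
  have h1 : nilHor b h w 0 = 0 := by
    funext k; simp [nilHor, cosInt, sinInt]
  have h2 : nilVert b h w 0 = 0 := by simp [nilVert, cosInt]
  have h3 : nilMom b h w 0 = h := by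
    funext ⟨i, a⟩
    fin_cases a <;> simp [nilMom, h1, nilVel]
  rw [nilCurve, h1, h2, h3]
  have h4 : coordMk (0 : HIdx n → ℝ) 0 = 0 := Coord.ext (fun _ => rfl) rfl
  rw [h4]

variable {b : Fin n → ℝ} {Y : HIdx n → ℝ × Coord n → Coord n}

/-- `nilMom` is the velocity corrected by the vertical part of the frame, precisely so that the
momentum evaluated on the frame returns the velocity. -/
theorem IsNilpotentDeformation.momentum (hY : IsNilpotentDeformation b Y) (h : HIdx n → ℝ)
    (w t : ℝ) (k : HIdx n) :
    linForm (nilMom b h w t) w (Y k (0, coordMk (nilHor b h w t) (nilVert b h w t))) =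
      nilVel b h w t k := by
  obtain ⟨i, a⟩ := k
  fin_cases a
  · simp only [Fin.zero_eta, hY.odd, map_add, map_smul, linForm_single, Option.elim]
    simp [nilMom]; ring
  · simp only [Fin.mk_one, hY.even, map_add, map_smul, linForm_single, Option.elim]
    simp [nilMom]; ring

/-- The vertical momentum w is constant, the velocity of pair i rotates with angular speed b_i w,
and the height is the b-weighted sum of the swept areas. -/
theorem hasDerivAt_nilCurve (hY : IsNilpotentDeformation b Y) (h : HIdx n → ℝ) (w t : ℝ)
    (s : Set ℝ) :
    HasDerivWithinAt (nilCurve b h w) (hamField Y (nilCurve b h w t)) s t := by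
  have hx := fun k => hasDerivAt_nilHor b h w t k
  have hu := fun i => hasDerivAt_nilVel b h w t i
  refine (hasDerivWithinAt_const _ _ _).prodMk (HasDerivWithinAt.prodMk ?_ ?_)
  · simp only [nilCurve, hY.momentum]
    refine hasDerivWithinAt_coord (fun k => ?_) ?_
    · refine (hx k).hasDerivWithinAt.congr_deriv ?_
      obtain ⟨i, a⟩ := k
      rw [Coord.sum_apply, sum_hIdx]
      simp only [hY.odd, hY.even]
      fin_cases a <;> simp
    · refine (hasDerivAt_nilVert b h w t).hasDerivWithinAt.congr_deriv ?_
      rw [Coord.sum_apply, sum_hIdx]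
      refine Finset.sum_congr rfl fun i _ => ?_
      simp only [hY.odd, hY.even]
      simp
      ring
  · have h1 : -∑ k, linForm (nilMom b h w t) w (Y k ((nilCurve b h w t).1, (nilCurve b h w t).2.1)) •
        (linForm (nilMom b h w t) w).comp
          (posDeriv (Y k) ((nilCurve b h w t).1, (nilCurve b h w t).2.1)) =
        linForm (fun k => if k.2 = 0 then b k.1 * w / 2 * nilVel b h w t (k.1, 1)
          else -(b k.1 * w / 2 * nilVel b h w t (k.1, 0))) 0 := by
      simp only [nilCurve, hY.momentum]
      refine ext_linForm fun o => ?_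
      simp only [neg_apply, sum_apply, smul_apply, ContinuousLinearMap.comp_apply]
      rw [sum_hIdx]
      simp only [posDeriv_of_affine (hY.smooth _) (hY.odd _),
        posDeriv_of_affine (hY.smooth _) (hY.even _), map_smul, linForm_single, Option.elim,
        smul_eq_mul]
      rcases o with _ | ⟨i, a⟩
      · simp
      · fin_cases a <;> simp <;> ring
    refine (hasDerivAt_linForm (fun k => ?_) (hasDerivWithinAt_const _ _ _)).congr_deriv h1.symm
    obtain ⟨i, a⟩ := k
    fin_cases a
    · simp only [nilMom, Fin.zero_eta, if_true]
      refine ((hu i).1.sub ((hx (i, 1)).const_mul _)).hasDerivWithinAt.congr_deriv ?_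
      ring
    · simp only [nilMom, Fin.mk_one, one_ne_zero, if_false]
      refine ((hu i).2.add ((hx (i, 0)).const_mul _)).hasDerivWithinAt.congr_deriv ?_
      ring

/-- The nilpotent extremals, as paths. -/
def nilPath (hY : IsNilpotentDeformation b Y) (h : HIdx n → ℝ) (w : ℝ) :
    C(unitInterval, PhaseSpace (Coord n)) :=
  ⟨fun t => nilCurve b h w t, by
    have : Continuous (nilCurve b h w) := continuous_iff_continuousAt.2 fun t =>
      (hasDerivWithinAt_univ.1 (hasDerivAt_nilCurve hY h w t univ)).continuousAt
    exact this.comp continuous_subtype_val⟩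

theorem defect_nilPath (hY : IsNilpotentDeformation b Y) (h : HIdx n → ℝ) (w : ℝ) :
    defect (hamMap Y hY.smooth) (nilPath hY h w) = constPath (0, 0, linForm h w) := by
  have h1 : ∀ t ∈ Icc (0 : ℝ) 1, extendPath (nilPath hY h w) t = nilCurve b h w t := fun t ht => by
    rw [extendPath_of_mem _ ht]; rfl
  have h2 := sub_integral_eq_const (u := nilPath hY h w)
    (w := superpose (hamMap Y hY.smooth) (nilPath hY h w)) fun t ht => by
      rw [extendPath_superpose, h1 t ht]
      exact (hasDerivAt_nilCurve hY h w t (Icc 0 1)).congr h1 (h1 t ht)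
  rw [defect, h2]
  congr 1
  change nilCurve b h w ((0 : unitInterval) : ℝ) = _
  rw [Icc.coe_zero, nilCurve_zero]

/-- Nilpotent extremals exist for all times. Since the domain of the flow is open, this is what
guarantees existence up to time one for small parameters. -/
theorem mem_flowDomain_nil (hY : IsNilpotentDeformation b Y) (h : HIdx n → ℝ) (w : ℝ) :
    ((0, 0, linForm h w) : PhaseSpace (Coord n)) ∈ flowDomain (hamMap Y hY.smooth) :=
  ⟨_, defect_nilPath hY h w⟩

theorem flowPath_nil (hY : IsNilpotentDeformation b Y) (h : HIdx n → ℝ) (w : ℝ)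
    (t : unitInterval) :
    flowPath (hamMap Y hY.smooth) (0, 0, linForm h w) t = nilCurve b h w t := by
  rw [flowPath_eq (contDiff_hamField hY.smooth) (defect_nilPath hY h w)]
  rfl

end NilpotentFlow
end
end ContactSR

namespace ContactSR
noncomputable section

/-! ### The functions sinc, (1 − cos θ)/θ, (1 − sinc θ)/θ and a positivity statement on [0, 2π). -/

section TrigIntegrals

/-- A criterion for the removable singularity at 0, where the quotient rule fails and Taylor bounds
on sin and cos are used instead. -/
theorem hasDerivAt_zero_of_abs_le {f : ℝ → ℝ} {a : ℝ}
    (h : ∀ x, |x| ≤ 1 → |f x - f 0 - a * x| ≤ x ^ 2) : HasDerivAt f a 0 := by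
  rw [hasDerivAt_iff_isLittleO_nhds_zero]
  have h1 : (fun x : ℝ => f (0 + x) - f 0 - x • a) =O[𝓝 0] fun x : ℝ => x ^ 2 := by
    refine Asymptotics.IsBigO.of_bound 1 ?_
    filter_upwards [Metric.closedBall_mem_nhds (0 : ℝ) one_pos] with x hx
    rw [mem_closedBall_zero_iff, Real.norm_eq_abs] at hx
    have := h x hx
    simp only [zero_add, smul_eq_mul, one_mul, Real.norm_eq_abs]
    rw [abs_of_nonneg (sq_nonneg x), mul_comm x a]
    exact this
  refine h1.trans_isLittleO ?_
  simpa using (Asymptotics.isLittleO_pow_id (𝕜 := ℝ) (n := 2) (by norm_num))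

/-- `(1 - cos θ) / θ`. -/
def cosc (θ : ℝ) : ℝ := (1 - Real.cos θ) / θ

/-- `(1 - sinc θ) / θ`. -/
def areac (θ : ℝ) : ℝ := (1 - Real.sinc θ) / θ

/-- Derivative of `sinc`. -/
def sincDeriv (θ : ℝ) : ℝ := if θ = 0 then 0 else (θ * Real.cos θ - Real.sin θ) / θ ^ 2

/-- Derivative of `cosc`. -/
def coscDeriv (θ : ℝ) : ℝ :=
  if θ = 0 then 1 / 2 else (θ * Real.sin θ - (1 - Real.cos θ)) / θ ^ 2

/-- Derivative of `areac`. -/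
def areacDeriv (θ : ℝ) : ℝ :=
  if θ = 0 then 1 / 6 else ((1 - Real.cos θ) * θ - 2 * (θ - Real.sin θ)) / θ ^ 3

theorem abs_pow_le_sq {x : ℝ} (hx : |x| ≤ 1) {m : ℕ} (hm : 2 ≤ m) : |x| ^ m ≤ x ^ 2 := by
  rw [← sq_abs x]
  exact pow_le_pow_of_le_one (abs_nonneg x) hx hm

theorem hasDerivAt_sinc (θ : ℝ) : HasDerivAt Real.sinc (sincDeriv θ) θ := by
  rcases eq_or_ne θ 0 with rfl | hθ
  · refine hasDerivAt_zero_of_abs_le fun x hx => ?_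
    rcases eq_or_ne x 0 with rfl | h0
    · simp
    · have h1 := Real.sin_bound hx
      have h2 : Real.sinc x - Real.sinc 0 - sincDeriv 0 * x =
          (Real.sin x - (x - x ^ 3 / 6)) / x - x ^ 2 / 6 := by
        rw [Real.sinc_of_ne_zero h0, Real.sinc_zero, sincDeriv, if_pos rfl]
        field_simp; ring
      have h3 : |(Real.sin x - (x - x ^ 3 / 6)) / x| ≤ |x| ^ 4 / 100 := by
        rw [abs_div, div_le_iff₀ (abs_pos.2 h0)]
        linarith [show |x| ^ 5 / 100 = |x| ^ 4 / 100 * |x| by ring]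
      rw [h2]
      have h4 := abs_pow_le_sq hx (m := 4) (by norm_num)
      refine (abs_sub _ _).trans ?_
      rw [abs_of_nonneg (by positivity : 0 ≤ x ^ 2 / 6)]
      nlinarith [sq_nonneg x]
  · rw [sincDeriv, if_neg hθ]
    have h := (Real.hasDerivAt_sin θ).div (hasDerivAt_id θ) hθ
    refine (h.congr_of_eventuallyEq ?_).congr_deriv ?_
    · filter_upwards [isOpen_ne.mem_nhds hθ] with x hx
      rw [Real.sinc_of_ne_zero hx]; rfl
    · simp; ring

theorem hasDerivAt_cosc (θ : ℝ) : HasDerivAt cosc (coscDeriv θ) θ := by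
  rcases eq_or_ne θ 0 with rfl | hθ
  · refine hasDerivAt_zero_of_abs_le fun x hx => ?_
    rcases eq_or_ne x 0 with rfl | h0
    · simp
    · have h1 := Real.cos_bound hx
      have h2 : cosc x - cosc 0 - coscDeriv 0 * x = -((Real.cos x - (1 - x ^ 2 / 2)) / x) := by
        rw [cosc, cosc, coscDeriv, if_pos rfl]
        field_simp; simp; ring
      rw [h2, abs_neg, abs_div, div_le_iff₀ (abs_pos.2 h0)]
      refine h1.trans ?_
      have h4 := abs_pow_le_sq hx (m := 3) (by norm_num)
      have : |x| ^ 4 = |x| ^ 3 * |x| := by ring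
      rw [this]
      nlinarith [abs_nonneg x, pow_nonneg (abs_nonneg x) 3]
  · rw [coscDeriv, if_neg hθ]
    have h := ((Real.hasDerivAt_cos θ).const_sub 1).div (hasDerivAt_id θ) hθ
    refine h.congr_deriv ?_
    simp; ring

theorem hasDerivAt_areac (θ : ℝ) : HasDerivAt areac (areacDeriv θ) θ := by
  rcases eq_or_ne θ 0 with rfl | hθ
  · refine hasDerivAt_zero_of_abs_le fun x hx => ?_
    rcases eq_or_ne x 0 with rfl | h0
    · simp
    · have h1 := Real.sin_bound hx
      have h2 : areac x - areac 0 - areacDeriv 0 * x = -((Real.sin x - (x - x ^ 3 / 6)) / x ^ 2) := by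
        rw [areac, areac, areacDeriv, if_pos rfl, Real.sinc_of_ne_zero h0]
        field_simp; ring_nf
      rw [h2, abs_neg, abs_div, div_le_iff₀ (abs_pos.2 (pow_ne_zero 2 h0))]
      refine h1.trans ?_
      have h4 := abs_pow_le_sq hx (m := 3) (by norm_num)
      have : |x| ^ 5 = |x| ^ 3 * x ^ 2 := by rw [← sq_abs x]; ring
      rw [this, abs_of_nonneg (sq_nonneg x)]
      nlinarith [sq_nonneg x, pow_nonneg (abs_nonneg x) 3]
  · rw [areacDeriv, if_neg hθ]
    have h := ((hasDerivAt_sinc θ).const_sub 1).div (hasDerivAt_id θ) hθ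
    refine h.congr_deriv ?_
    rw [sincDeriv, if_neg hθ, Real.sinc_of_ne_zero hθ]
    simp; field_simp; ring

/-- `sin x - x cos x > 0` on `(0, π)`. -/
theorem mul_cos_lt_sin {x : ℝ} (h0 : 0 < x) (h1 : x < Real.pi) : x * Real.cos x < Real.sin x := by
  rcases lt_or_ge x (Real.pi / 2) with h | h
  · have hc := Real.cos_pos_of_mem_Ioo ⟨by linarith, h⟩
    have := Real.lt_tan h0 h
    rwa [Real.tan_eq_sin_div_cos, lt_div_iff₀ hc] at this
  · have hc := Real.cos_nonpos_of_pi_div_two_le_of_le h (by linarith)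
    have hs := Real.sin_pos_of_pos_of_lt_pi h0 h1
    nlinarith

/-- The squared chord of an arc of length 1 and angle θ. It is also the determinant of the end point
block of one pair, hence the relevance of its first positive zero 2π. -/
theorem sinc_sq_add_cosc_sq {θ : ℝ} (h0 : θ ≠ 0) :
    Real.sinc θ ^ 2 + cosc θ ^ 2 = 4 * Real.sin (θ / 2) ^ 2 / θ ^ 2 := by
  have h1 : Real.sin (θ / 2) ^ 2 = (1 - Real.cos θ) / 2 := by
    rw [Real.sin_sq_eq_half_sub]; ring_nf
  rw [Real.sinc_of_ne_zero h0, cosc, h1]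
  have := Real.sin_sq_add_cos_sq θ
  field_simp
  linear_combination 2 * this

/-- The left side is the numerator of the derivative of the ratio `areac` / (squared chord). In
terms of x = θ/2 its sign on (0, 2π) is that of sin x − x cos x. -/
theorem reduced_area_deriv {θ : ℝ} (h0 : θ ≠ 0) :
    areacDeriv θ * (Real.sinc θ ^ 2 + cosc θ ^ 2) -
      2 * areac θ * (Real.sinc θ * sincDeriv θ + cosc θ * coscDeriv θ) =
    8 * Real.sin (θ / 2) * (Real.sin (θ / 2) - θ / 2 * Real.cos (θ / 2)) / θ ^ 4 := by
  have h1 : Real.cos θ = 1 - 2 * Real.sin (θ / 2) ^ 2 := by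
    rw [Real.sin_sq_eq_half_sub]; ring_nf
  have h2 : Real.sin θ = 2 * Real.sin (θ / 2) * Real.cos (θ / 2) := by
    rw [← Real.sin_two_mul]; ring_nf
  rw [areacDeriv, sincDeriv, coscDeriv, if_neg h0, if_neg h0, if_neg h0, areac, cosc,
    Real.sinc_of_ne_zero h0, h1, h2]
  have h3 := Real.sin_sq_add_cos_sq (θ / 2)
  generalize Real.sin (θ / 2) = s at *
  have h4 : Real.cos (θ / 2) ^ 2 = 1 - s ^ 2 := by linear_combination h3
  generalize Real.cos (θ / 2) = c at *
  field_simp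
  ring_nf
  simp only [h4]
  ring

theorem sinc_sq_add_cosc_sq_pos {θ : ℝ} (h0 : 0 ≤ θ) (h1 : θ < 2 * Real.pi) :
    0 < Real.sinc θ ^ 2 + cosc θ ^ 2 := by
  rcases h0.eq_or_lt with rfl | h
  · simp [cosc]
  · rw [sinc_sq_add_cosc_sq h.ne']
    have := Real.sin_pos_of_pos_of_lt_pi (half_pos h) (by linarith)
    positivity

/-- The angle 0 is included because rescaled times start at 0; there the expression is evaluated
directly and equals 1/6. -/
theorem reduced_area_deriv_pos {θ : ℝ} (h0 : 0 ≤ θ) (h1 : θ < 2 * Real.pi) :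
    0 < areacDeriv θ * (Real.sinc θ ^ 2 + cosc θ ^ 2) -
      2 * areac θ * (Real.sinc θ * sincDeriv θ + cosc θ * coscDeriv θ) := by
  rcases h0.eq_or_lt with rfl | h
  · simp [cosc, areac, areacDeriv]
  · rw [reduced_area_deriv h.ne']
    have hs := Real.sin_pos_of_pos_of_lt_pi (half_pos h) (by linarith)
    have hc := mul_cos_lt_sin (half_pos h) (by linarith)
    have : 0 < Real.sin (θ / 2) - θ / 2 * Real.cos (θ / 2) := by linarith
    positivity

end TrigIntegrals

/-! ### The end point map in the parameter and the initial covector, and its nilpotent differential.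
-/

section EndMap

variable {n : ℕ}

/-- The covector with given components. -/
def covOf : Coord n →L[ℝ] (Coord n →L[ℝ] ℝ) :=
  ∑ o, (EuclideanSpace.proj (𝕜 := ℝ) o : Coord n →L[ℝ] ℝ).smulRight
    (EuclideanSpace.proj (𝕜 := ℝ) o : Coord n →L[ℝ] ℝ)

theorem covOf_apply (q v : Coord n) : covOf q v = ∑ o, q o * v o := by
  simp only [covOf, sum_apply]
  rfl

theorem covOf_eq (q : Coord n) : covOf q = linForm (fun k => q (some k)) (q none) := by
  ext v
  rw [covOf_apply, linForm_apply, Fintype.sum_option, add_comm]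

@[simp] theorem covOf_coordMk (h : HIdx n → ℝ) (w : ℝ) : covOf (coordMk h w) = linForm h w :=
  covOf_eq _

theorem covOf_single (q : Coord n) (o : Option (HIdx n)) :
    covOf q (EuclideanSpace.single o 1) = q o := by
  rw [covOf_eq, linForm_single]
  cases o <;> rfl

/-- The components of a covector. -/
def covComp (ξ : Coord n →L[ℝ] ℝ) : Coord n := WithLp.toLp 2 fun o => ξ (EuclideanSpace.single o 1)

theorem covOf_covComp (ξ : Coord n →L[ℝ] ℝ) : covOf (covComp ξ) = ξ :=
  ext_linForm fun o => by rw [covOf_single]; rfl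

/-- The initial condition with parameter `ε` at the origin with covector components `q`. -/
def initPt : ℝ × Coord n →L[ℝ] PhaseSpace (Coord n) :=
  (ContinuousLinearMap.fst ℝ ℝ (Coord n)).prod
    ((0 : ℝ × Coord n →L[ℝ] Coord n).prod (covOf.comp (ContinuousLinearMap.snd ℝ ℝ (Coord n))))

theorem initPt_apply (ε : ℝ) (q : Coord n) :
    initPt (ε, q) = ((ε, 0, covOf q) : PhaseSpace (Coord n)) := rfl

variable {b : Fin n → ℝ} {Y : HIdx n → ℝ × Coord n → Coord n}

/-- The parameters and covectors for which the flow is defined up to time `1`. -/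
def endDomain (hY : IsNilpotentDeformation b Y) : Set (ℝ × Coord n) :=
  {P | initPt P ∈ flowDomain (hamMap Y hY.smooth)}

/-- The position at time `1`. -/
def endPos (hY : IsNilpotentDeformation b Y) (P : ℝ × Coord n) : Coord n :=
  (flowPath (hamMap Y hY.smooth) (initPt P) 1).2.1

/-- The momentum at time `1`. -/
def endMom (hY : IsNilpotentDeformation b Y) (P : ℝ × Coord n) : Coord n →L[ℝ] ℝ :=
  (flowPath (hamMap Y hY.smooth) (initPt P) 1).2.2

theorem isOpen_endDomain (hY : IsNilpotentDeformation b Y) : IsOpen (endDomain hY) :=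
  (isOpen_flowDomain (contDiff_hamField hY.smooth)).preimage initPt.continuous

theorem zero_mem_endDomain (hY : IsNilpotentDeformation b Y) (q : Coord n) :
    ((0, q) : ℝ × Coord n) ∈ endDomain hY := by
  have := mem_flowDomain_nil hY (fun k => q (some k)) (q none)
  rwa [← covOf_eq] at this

theorem contDiffAt_flowPath_initPt (hY : IsNilpotentDeformation b Y) {P : ℝ × Coord n}
    (hP : P ∈ endDomain hY) :
    ContDiffAt ℝ ∞ (fun P => flowPath (hamMap Y hY.smooth) (initPt P)) P :=
  (contDiffAt_flowPath (contDiff_hamField hY.smooth) hP).2.comp P initPt.contDiff.contDiffAt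

/-- The position at time `1` of a path. -/
def evalPos : C(unitInterval, PhaseSpace (Coord n)) →L[ℝ] Coord n :=
  (ContinuousLinearMap.fst ℝ (Coord n) (Coord n →L[ℝ] ℝ)).comp
    ((ContinuousLinearMap.snd ℝ ℝ (Coord n × (Coord n →L[ℝ] ℝ))).comp
      (ContinuousMap.evalCLM ℝ (1 : unitInterval)))

/-- The momentum at time `1` of a path. -/
def evalMom : C(unitInterval, PhaseSpace (Coord n)) →L[ℝ] (Coord n →L[ℝ] ℝ) :=
  (ContinuousLinearMap.snd ℝ (Coord n) (Coord n →L[ℝ] ℝ)).comp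
    ((ContinuousLinearMap.snd ℝ ℝ (Coord n × (Coord n →L[ℝ] ℝ))).comp
      (ContinuousMap.evalCLM ℝ (1 : unitInterval)))

theorem contDiffAt_endPos (hY : IsNilpotentDeformation b Y) {P : ℝ × Coord n}
    (hP : P ∈ endDomain hY) : ContDiffAt ℝ ∞ (endPos hY) P := by
  have h : ContDiff ℝ ∞ (evalPos (n := n)) := ContinuousLinearMap.contDiff _
  exact h.contDiffAt.comp P (contDiffAt_flowPath_initPt hY hP)

theorem contDiffAt_endMom (hY : IsNilpotentDeformation b Y) {P : ℝ × Coord n}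
    (hP : P ∈ endDomain hY) : ContDiffAt ℝ ∞ (endMom hY) P := by
  have h : ContDiff ℝ ∞ (evalMom (n := n)) := ContinuousLinearMap.contDiff _
  exact h.contDiffAt.comp P (contDiffAt_flowPath_initPt hY hP)

/-- The end point map restricted to the fibre of covectors is Lagrangian. -/
theorem endMom_fderiv_symm (hY : IsNilpotentDeformation b Y) {P : ℝ × Coord n}
    (hP : P ∈ endDomain hY) (v v' : Coord n) :
    fderiv ℝ (endMom hY) P (0, v) (fderiv ℝ (endPos hY) P (0, v')) =
      fderiv ℝ (endMom hY) P (0, v') (fderiv ℝ (endPos hY) P (0, v)) := by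
  have hd := ((contDiffAt_flowPath (contDiff_hamField hY.smooth) hP).2.differentiableAt
    (by simp)).hasFDerivAt.comp P initPt.hasFDerivAt
  have h1 := ((evalPos (n := n)).hasFDerivAt.comp P hd).fderiv
  have h2 := ((evalMom (n := n)).hasFDerivAt.comp P hd).fderiv
  change fderiv ℝ (endPos hY) P = _ at h1
  change fderiv ℝ (endMom hY) P = _ at h2
  -- All the initial covectors lie over the same point, so the symplectic form of the two initial
  -- variations is zero.
  have h3 := symplectic_fderiv_flowPath hY.smooth hP (initPt (0, v)) (initPt (0, v')) rfl rfl
  rw [h1, h2]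
  simp only [symplectic, initPt_apply, map_zero, sub_self] at h3
  exact (sub_eq_zero.1 h3).symm

theorem endPos_nil (hY : IsNilpotentDeformation b Y) (q : Coord n) :
    endPos hY (0, q) = coordMk (nilHor b (fun k => q (some k)) (q none) 1)
      (nilVert b (fun k => q (some k)) (q none) 1) := by
  rw [endPos, initPt_apply, covOf_eq, flowPath_nil hY]
  rfl

theorem endMom_nil (hY : IsNilpotentDeformation b Y) (q : Coord n) :
    endMom hY (0, q) = linForm (nilMom b (fun k => q (some k)) (q none) 1) (q none) := by
  rw [endMom, initPt_apply, covOf_eq, flowPath_nil hY]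
  rfl

theorem cosInt_one (θ : ℝ) : cosInt θ 1 = Real.sinc θ := by simp [cosInt]
theorem sinInt_one (θ : ℝ) : sinInt θ 1 = cosc θ := by simp [sinInt, cosc]

theorem hasDerivAt_line (P v : ℝ × Coord n) :
    HasDerivAt (fun r : ℝ => P + r • v) v 0 := by
  simpa using ((hasDerivAt_id (0 : ℝ)).smul_const v).const_add P

/-- The differential of the nilpotent end point map in the direction of the covectors. -/
theorem fderiv_endPos_nil (hY : IsNilpotentDeformation b Y) (q v : Coord n) :
    fderiv ℝ (endPos hY) (0, q) (0, v) = coordMk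
      (fun k => if k.2 = 0 then
          Real.sinc (b k.1 * q none) * v (some (k.1, 0)) +
            cosc (b k.1 * q none) * v (some (k.1, 1)) +
            b k.1 * v none * (sincDeriv (b k.1 * q none) * q (some (k.1, 0)) +
              coscDeriv (b k.1 * q none) * q (some (k.1, 1)))
        else
          Real.sinc (b k.1 * q none) * v (some (k.1, 1)) -
            cosc (b k.1 * q none) * v (some (k.1, 0)) +
            b k.1 * v none * (sincDeriv (b k.1 * q none) * q (some (k.1, 1)) -
              coscDeriv (b k.1 * q none) * q (some (k.1, 0))))
      (∑ i, b i / 2 * (2 * areac (b i * q none) *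
          (q (some (i, 0)) * v (some (i, 0)) + q (some (i, 1)) * v (some (i, 1))) +
        (q (some (i, 0)) ^ 2 + q (some (i, 1)) ^ 2) * (b i * areacDeriv (b i * q none) * v none))) := by
  have h0 : ((0, q) : ℝ × Coord n) + (0 : ℝ) • ((0, v) : ℝ × Coord n) = (0, q) := by simp
  have hd : HasFDerivAt (endPos hY) (fderiv ℝ (endPos hY) (0, q))
      (((0, q) : ℝ × Coord n) + (0 : ℝ) • ((0, v) : ℝ × Coord n)) := by
    rw [h0]
    exact ((contDiffAt_endPos hY (zero_mem_endDomain hY q)).differentiableAt (by simp)).hasFDerivAt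
  have h1 := hd.comp_hasDerivAt (0 : ℝ) (hasDerivAt_line (0, q) (0, v))
  refine h1.unique ?_
  have h2 : (endPos hY ∘ fun r : ℝ => ((0, q) : ℝ × Coord n) + r • ((0, v) : ℝ × Coord n)) =
      fun r : ℝ => endPos hY (0, q + r • v) := by
    funext r; simp
  rw [h2]
  simp only [endPos_nil]
  have hq : ∀ o, HasDerivAt (fun r : ℝ => (q + r • v) o) (v o) 0 := fun o => by
    simpa using ((hasDerivAt_id (0 : ℝ)).mul_const (v o)).const_add (q o)
  have hθ : ∀ i, HasDerivAt (fun r : ℝ => b i * (q + r • v) none) (b i * v none) 0 := fun i =>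
    (hq none).const_mul (b i)
  have hz : ∀ o, (q + (0 : ℝ) • v) o = q o := fun o => by simp
  have hc : ∀ {f : ℝ → ℝ} {f' : ℝ → ℝ}, (∀ θ, HasDerivAt f (f' θ) θ) → ∀ i,
      HasDerivAt (fun r : ℝ => f (b i * (q + r • v) none)) (f' (b i * q none) * (b i * v none)) 0 := by
    intro f f' hf i
    have := (hf (b i * (q + (0 : ℝ) • v) none)).comp (0 : ℝ) (hθ i)
    rwa [hz] at this
  have hS := hc hasDerivAt_sinc
  have hC := hc hasDerivAt_cosc
  have hA := hc hasDerivAt_areac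
  rw [← hasDerivWithinAt_univ]
  refine hasDerivWithinAt_coord (fun k => ?_) ?_
  · rw [hasDerivWithinAt_univ]
    obtain ⟨i, a⟩ := k
    simp only [coordMk_some, nilHor, cosInt_one, sinInt_one]
    fin_cases a
    · simp only [Fin.zero_eta, if_true]
      refine (((hS i).mul (hq (some (i, 0)))).add ((hC i).mul (hq (some (i, 1))))).congr_deriv ?_
      simp only [hz]; ring
    · simp only [Fin.mk_one, one_ne_zero, if_false]
      refine (((hS i).mul (hq (some (i, 1)))).sub ((hC i).mul (hq (some (i, 0))))).congr_deriv ?_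
      simp only [hz]; ring
  · rw [hasDerivWithinAt_univ]
    simp only [coordMk_none, nilVert, cosInt_one]
    refine HasDerivAt.fun_sum fun i _ => ?_
    have := ((((hq (some (i, 0))).pow 2).add ((hq (some (i, 1))).pow 2)).const_mul (b i / 2)).mul
      (hA i)
    refine this.congr_deriv ?_
    simp only [hz, Pi.add_apply, Pi.pow_apply]
    push_cast
    ring

theorem nilMom_one (b : Fin n → ℝ) (h : HIdx n → ℝ) (w : ℝ) (i : Fin n) :
    nilMom b h w 1 (i, 0) = Real.cos (b i * w) * h (i, 0) + Real.sin (b i * w) * h (i, 1) -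
      b i * w / 2 * (Real.sinc (b i * w) * h (i, 1) - cosc (b i * w) * h (i, 0)) ∧
    nilMom b h w 1 (i, 1) = Real.cos (b i * w) * h (i, 1) - Real.sin (b i * w) * h (i, 0) +
      b i * w / 2 * (Real.sinc (b i * w) * h (i, 0) + cosc (b i * w) * h (i, 1)) := by
  simp [nilMom, nilVel, nilHor, cosInt_one, sinInt_one]

/-- The factor r vanishes at 0, so only the value of the bracket at angle 2π matters, whatever θ'
is; there sin, sinc and `cosc` vanish and the bracket is c. -/
theorem hasDerivAt_momentum_at_period {θ : ℝ → ℝ} {θ' : ℝ} (hθ : HasDerivAt θ θ' 0)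
    (h0 : θ 0 = 2 * Real.pi) (c d : ℝ) :
    HasDerivAt (fun r : ℝ => r * (Real.cos (θ r) * c + Real.sin (θ r) * d -
      θ r / 2 * (Real.sinc (θ r) * d - cosc (θ r) * c))) c 0 := by
  have hp : (2 * Real.pi) ≠ 0 := by positivity
  have hS := (hasDerivAt_sinc _).comp (0 : ℝ) hθ
  have hC := (hasDerivAt_cosc _).comp (0 : ℝ) hθ
  have := (hasDerivAt_id (0 : ℝ)).mul (((hθ.cos.mul_const c).add (hθ.sin.mul_const d)).sub
    ((hθ.div_const 2).mul ((hS.mul_const d).sub (hC.mul_const c))))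
  refine this.congr_deriv ?_
  simp [h0, cosc, Real.sinc_of_ne_zero hp]

theorem hasDerivAt_endMom_nil (hY : IsNilpotentDeformation b Y) (q v : Coord n)
    (o : Option (HIdx n)) :
    HasDerivAt (fun r : ℝ => linForm (nilMom b (fun k => (q + r • v) (some k)) ((q + r • v) none) 1)
      ((q + r • v) none) (EuclideanSpace.single o (1 : ℝ)))
      (fderiv ℝ (endMom hY) (0, q) (0, v) (EuclideanSpace.single o 1)) 0 := by
  have h0 : ((0, q) : ℝ × Coord n) + (0 : ℝ) • ((0, v) : ℝ × Coord n) = (0, q) := by simp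
  have hd : HasFDerivAt (endMom hY) (fderiv ℝ (endMom hY) (0, q))
      (((0, q) : ℝ × Coord n) + (0 : ℝ) • ((0, v) : ℝ × Coord n)) := by
    rw [h0]
    exact ((contDiffAt_endMom hY (zero_mem_endDomain hY q)).differentiableAt (by simp)).hasFDerivAt
  have h1 : HasDerivAt (fun r : ℝ => endMom hY (0, q + r • v))
      (fderiv ℝ (endMom hY) (0, q) (0, v)) 0 := by
    refine (hd.comp_hasDerivAt (0 : ℝ) (hasDerivAt_line (0, q) (0, v))).congr_of_eventuallyEq
      (Eventually.of_forall fun r => ?_)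
    have : ((0, q) : ℝ × Coord n) + r • ((0, v) : ℝ × Coord n) = (0, q + r • v) := by simp
    rw [Function.comp_apply, this]
  have h2 : (fun r : ℝ => endMom hY (0, q + r • v)) = fun r : ℝ =>
      linForm (nilMom b (fun k => (q + r • v) (some k)) ((q + r • v) none) 1) ((q + r • v) none) :=
    funext fun r => endMom_nil hY _
  rw [h2] at h1
  have h3 := h1.clm_apply (hasDerivAt_const (0 : ℝ) (EuclideanSpace.single o (1 : ℝ)))
  rwa [map_zero, add_zero] at h3

/-- When the first pair of components vanishes and `b_i w = 2π`, the derivative of that pair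
of momenta is the identity. -/
theorem fderiv_endMom_nil (hY : IsNilpotentDeformation b Y) (q v : Coord n) (i : Fin n)
    (hq0 : ∀ a, q (some (i, a)) = 0) (hw : b i * q none = 2 * Real.pi) (a : Fin 2) :
    fderiv ℝ (endMom hY) (0, q) (0, v) (EuclideanSpace.single (some (i, a)) 1) =
      v (some (i, a)) := by
  have h1 := hasDerivAt_endMom_nil hY q v (some (i, a))
  refine h1.unique ?_
  have h2 : ∀ r : ℝ, linForm (nilMom b (fun k => (q + r • v) (some k)) ((q + r • v) none) 1)
      ((q + r • v) none) (EuclideanSpace.single (some (i, a)) (1 : ℝ)) =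
      nilMom b (fun k => (q + r • v) (some k)) ((q + r • v) none) 1 (i, a) := by
    intro r
    rw [linForm_single]
    rfl
  have h3 : ∀ (r : ℝ) a, (q + r • v) (some (i, a)) = r * v (some (i, a)) := by
    intro r a
    simp [hq0]
  have hθ : HasDerivAt (fun r : ℝ => b i * (q + r • v) none) (b i * v none) 0 := by
    simpa using (((hasDerivAt_id (0 : ℝ)).mul_const (v none)).const_add (q none)).const_mul (b i)
  have hz : b i * (q + (0 : ℝ) • v) none = 2 * Real.pi := by simpa using hw
  obtain rfl | rfl : a = 0 ∨ a = 1 := by omega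
  · refine (hasDerivAt_momentum_at_period hθ hz (v (some (i, 0)))
      (v (some (i, 1)))).congr_of_eventuallyEq (Eventually.of_forall fun r => ?_)
    refine (h2 r).trans ?_
    simp only [(nilMom_one _ _ _ _).1, h3]
    ring
  -- The second component is the first one after a quarter turn, (c, d) = (v₁, −v₀).
  · refine (hasDerivAt_momentum_at_period hθ hz (v (some (i, 1)))
      (-v (some (i, 0)))).congr_of_eventuallyEq (Eventually.of_forall fun r => ?_)
    refine (h2 r).trans ?_
    simp only [(nilMom_one _ _ _ _).2, h3]
    ring

end EndMap
end
end ContactSR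

namespace ContactSR
noncomputable section

/-! ### The Jacobian of the end point map, and its invertibility before the nilpotent conjugate
time. -/

section Jacobian

variable {n : ℕ} {b : Fin n → ℝ} {Y : HIdx n → ℝ × Coord n → Coord n}

/-- The Jacobian matrix of the end point map in the covector. -/
def jac (hY : IsNilpotentDeformation b Y) (P : ℝ × Coord n) :
    Matrix (Option (HIdx n)) (Option (HIdx n)) ℝ :=
  Matrix.of fun o o' => fderiv ℝ (endPos hY) P (0, EuclideanSpace.single o' 1) o

/-- The Jacobian matrix of the final momentum in the covector. -/
def momJac (hY : IsNilpotentDeformation b Y) (P : ℝ × Coord n) :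
    Matrix (Option (HIdx n)) (Option (HIdx n)) ℝ :=
  Matrix.of fun o o' =>
    fderiv ℝ (endMom hY) P (0, EuclideanSpace.single o' 1) (EuclideanSpace.single o 1)

theorem coord_eq_sum (v : Coord n) : v = ∑ o, v o • EuclideanSpace.single o (1 : ℝ) := by
  ext o
  rcases o with _ | k <;> simp

theorem jac_mulVec (hY : IsNilpotentDeformation b Y) (P : ℝ × Coord n) (v : Coord n)
    (o : Option (HIdx n)) :
    (jac hY P).mulVec v o = fderiv ℝ (endPos hY) P (0, v) o := by
  have h1 : ((0, v) : ℝ × Coord n) =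
      ∑ o, v o • ((0, EuclideanSpace.single o 1) : ℝ × Coord n) := by
    rw [Prod.ext_iff]
    refine ⟨by simp [Prod.fst_sum], ?_⟩
    rw [Prod.snd_sum]
    exact coord_eq_sum v
  rw [h1, map_sum, Coord.sum_apply]
  simp only [map_smul, PiLp.smul_apply, smul_eq_mul]
  exact Finset.sum_congr rfl fun o' _ => mul_comm _ _

/-- The matrix form of the Lagrangian property `endMom_fderiv_symm`. -/
theorem momJac_transpose_mul_jac_symm (hY : IsNilpotentDeformation b Y) {P : ℝ × Coord n}
    (hP : P ∈ endDomain hY) :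
    ((momJac hY P).transpose * jac hY P).IsSymm := by
  have key : ∀ o o', ((momJac hY P).transpose * jac hY P) o o' =
      fderiv ℝ (endMom hY) P (0, EuclideanSpace.single o 1)
        (fderiv ℝ (endPos hY) P (0, EuclideanSpace.single o' 1)) := by
    intro o o'
    conv_rhs => rw [coord_eq_sum (fderiv ℝ (endPos hY) P (0, EuclideanSpace.single o' 1)), map_sum]
    rw [Matrix.mul_apply]
    refine Finset.sum_congr rfl fun k _ => ?_
    rw [map_smul, smul_eq_mul, mul_comm]
    rfl
  ext o o'
  rw [Matrix.transpose_apply, key, key, endMom_fderiv_symm hY hP]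

theorem contDiffAt_jac (hY : IsNilpotentDeformation b Y) {P : ℝ × Coord n}
    (hP : P ∈ endDomain hY) (o o' : Option (HIdx n)) :
    ContDiffAt ℝ ∞ (fun P => jac hY P o o') P := by
  have h1 : ContDiffAt ℝ ∞ (fderiv ℝ (endPos hY)) P :=
    (contDiffAt_endPos hY hP).fderiv_right (m := ∞) (by simp)
  have h2 : ContDiffAt ℝ ∞ (fun P => fderiv ℝ (endPos hY) P (0, EuclideanSpace.single o' 1)) P :=
    h1.clm_apply contDiffAt_const
  exact (contDiffAt_euclidean.1 h2 o)

theorem continuousAt_jac (hY : IsNilpotentDeformation b Y) {P : ℝ × Coord n}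
    (hP : P ∈ endDomain hY) : ContinuousAt (jac hY) P :=
  tendsto_pi_nhds.2 fun o => tendsto_pi_nhds.2 fun o' => (contDiffAt_jac hY hP o o').continuousAt

theorem continuousAt_momJac (hY : IsNilpotentDeformation b Y) {P : ℝ × Coord n}
    (hP : P ∈ endDomain hY) : ContinuousAt (momJac hY) P := by
  have h1 : ContinuousAt (fderiv ℝ (endMom hY)) P :=
    ((contDiffAt_endMom hY hP).fderiv_right (m := ∞) (by simp)).continuousAt
  exact tendsto_pi_nhds.2 fun o => tendsto_pi_nhds.2 fun o' =>
    (h1.clm_apply continuousAt_const).clm_apply continuousAt_const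

/-- The contribution of one pair to the vertical derivative, once the horizontal derivative of the
pair vanishes. -/
theorem pair_contribution {β S C S' C' A A' h0 h1 v0 v1 vw : ℝ}
    (e0 : S * v0 + C * v1 + β * vw * (S' * h0 + C' * h1) = 0)
    (e1 : S * v1 - C * v0 + β * vw * (S' * h1 - C' * h0) = 0) (hp : S ^ 2 + C ^ 2 ≠ 0) :
    β / 2 * (2 * A * (h0 * v0 + h1 * v1) + (h0 ^ 2 + h1 ^ 2) * (β * A' * vw)) =
      (h0 ^ 2 + h1 ^ 2) * (β ^ 2 / 2 *
        ((A' * (S ^ 2 + C ^ 2) - 2 * A * (S * S' + C * C')) / (S ^ 2 + C ^ 2))) * vw := by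
  field_simp
  -- Up to the factor 2βA, the multipliers come from solving the two equations for (v₀, v₁) by the
  -- adjugate of the block and pairing the result with (h₀, h₁).
  linear_combination (2 * β * A * (h0 * S + h1 * C)) * e0 + (2 * β * A * (h1 * S - h0 * C)) * e1

theorem pair_eq_zero {S C v0 v1 : ℝ} (e0 : S * v0 + C * v1 = 0) (e1 : S * v1 - C * v0 = 0)
    (hp : S ^ 2 + C ^ 2 ≠ 0) : v0 = 0 ∧ v1 = 0 := by
  constructor
  · refine (mul_eq_zero.1 (?_ : (S ^ 2 + C ^ 2) * v0 = 0)).resolve_left hp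
    linear_combination S * e0 - C * e1
  · refine (mul_eq_zero.1 (?_ : (S ^ 2 + C ^ 2) * v1 = 0)).resolve_left hp
    linear_combination C * e0 + S * e1

/-- The weight of the pair of rotation angle `θ`. -/
def pairWeight (θ : ℝ) : ℝ :=
  (areacDeriv θ * (Real.sinc θ ^ 2 + cosc θ ^ 2) -
    2 * areac θ * (Real.sinc θ * sincDeriv θ + cosc θ * coscDeriv θ)) /
    (Real.sinc θ ^ 2 + cosc θ ^ 2)

theorem pairWeight_pos {θ : ℝ} (h0 : 0 ≤ θ) (h1 : θ < 2 * Real.pi) : 0 < pairWeight θ :=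
  div_pos (reduced_area_deriv_pos h0 h1) (sinc_sq_add_cosc_sq_pos h0 h1)

/-- The half-angle form in which the weights are recognised in the constant K. -/
theorem pairWeight_eq {θ : ℝ} (h0 : 0 < θ) (h1 : θ < 2 * Real.pi) :
    pairWeight θ = 2 / θ ^ 2 * (1 - θ / 2 * Real.cot (θ / 2)) := by
  have hs := Real.sin_pos_of_pos_of_lt_pi (half_pos h0) (by linarith)
  rw [pairWeight, reduced_area_deriv h0.ne', sinc_sq_add_cosc_sq h0.ne', Real.cot_eq_cos_div_sin]
  field_simp
  ring

/-- If the horizontal derivative in the direction `v` vanishes on the pairs in `s`, and `v` and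
the covector are zero on the other pairs, the vertical derivative is a multiple of `v none`. -/
theorem vertical_fderiv (hY : IsNilpotentDeformation b Y) (q v : Coord n) (s : Finset (Fin n))
    (hθ : ∀ i ∈ s, 0 ≤ b i * q none ∧ b i * q none < 2 * Real.pi)
    (hz : ∀ i ∈ s, ∀ a, fderiv ℝ (endPos hY) (0, q) (0, v) (some (i, a)) = 0)
    (hn : ∀ i ∉ s, ∀ a, q (some (i, a)) = 0) :
    fderiv ℝ (endPos hY) (0, q) (0, v) none =
      (∑ i ∈ s, (q (some (i, 0)) ^ 2 + q (some (i, 1)) ^ 2) *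
        (b i ^ 2 / 2 * pairWeight (b i * q none))) * v none := by
  rw [fderiv_endPos_nil] at hz ⊢
  rw [coordMk_none, Finset.sum_mul]
  symm
  refine Finset.sum_subset_zero_on_sdiff (Finset.subset_univ s) (fun i hi => ?_) fun i hi => ?_
  · have hi' := (Finset.mem_sdiff.1 hi).2
    simp [hn i hi']
  · have e0 := hz i hi 0
    have e1 := hz i hi 1
    simp only [coordMk_some, if_true, one_ne_zero, if_false] at e0 e1
    exact (pair_contribution e0 e1
      (sinc_sq_add_cosc_sq_pos (hθ i hi).1 (hθ i hi).2).ne').symm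

theorem pair_zero_of_fderiv (hY : IsNilpotentDeformation b Y) (q v : Coord n) (i : Fin n)
    (hθ : 0 ≤ b i * q none ∧ b i * q none < 2 * Real.pi)
    (hz : ∀ a, fderiv ℝ (endPos hY) (0, q) (0, v) (some (i, a)) = 0) (hv : v none = 0) (a : Fin 2) :
    v (some (i, a)) = 0 := by
  rw [fderiv_endPos_nil] at hz
  have e0 := hz 0
  have e1 := hz 1
  simp only [coordMk_some, if_true, one_ne_zero, if_false, hv, mul_zero, zero_mul, add_zero] at e0 e1
  have := pair_eq_zero e0 e1 (sinc_sq_add_cosc_sq_pos hθ.1 hθ.2).ne'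
  obtain rfl | rfl : a = 0 ∨ a = 1 := by omega
  exacts [this.1, this.2]

theorem continuous_coordMk {X : Type*} [TopologicalSpace X] {f : X → HIdx n → ℝ} {g : X → ℝ}
    (hf : ∀ k, Continuous fun x => f x k) (hg : Continuous g) :
    Continuous fun x => coordMk (f x) (g x) := by
  refine (PiLp.continuous_toLp 2 _).comp (continuous_pi fun o => ?_)
  rcases o with _ | k
  · exact hg
  · exact hf k

theorem isOpen_jac_det_ne_zero (hY : IsNilpotentDeformation b Y) :
    IsOpen {P | P ∈ endDomain hY ∧ (jac hY P).det ≠ 0} := by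
  rw [isOpen_iff_mem_nhds]
  rintro P ⟨hP, hd⟩
  have h1 : ContinuousAt (fun P => (jac hY P).det) P :=
    (continuous_id.matrix_det).continuousAt.comp (continuousAt_jac hY hP)
  exact Filter.inter_mem ((isOpen_endDomain hY).mem_nhds hP) (h1.eventually_ne hd)

variable [NeZero n]

/-- The covector components `(s h_1, s h_2, h_3, …, h_{2n}, τ)` and the parameter `s² τ`. -/
def scaledPt (h : HIdx n → ℝ) (x : ℝ × ℝ) : ℝ × Coord n :=
  (x.1 ^ 2 * x.2, coordMk (fun k => if k.1 = 0 then x.1 * h k else h k) x.2)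

theorem continuous_scaledPt (h : HIdx n → ℝ) : Continuous (scaledPt h) := by
  refine Continuous.prodMk (by fun_prop) (continuous_coordMk (fun k => ?_) continuous_snd)
  split_ifs <;> fun_prop

theorem scaledPt_zero_mem (hY : IsNilpotentDeformation b Y) (h : HIdx n → ℝ) (τ : ℝ) :
    scaledPt h (0, τ) ∈ endDomain hY := by
  have : scaledPt h (0, τ) = (0, (scaledPt h (0, τ)).2) := by simp [scaledPt]
  rw [this]
  exact zero_mem_endDomain hY _

/-- Tube lemma for the scaled covectors. -/
theorem eventually_forall_scaledPt (h : HIdx n → ℝ) {U : Set (ℝ × Coord n)} (hU : IsOpen U)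
    {T T' : ℝ} (hT : ∀ τ ∈ Icc T T', scaledPt h (0, τ) ∈ U) :
    ∀ᶠ s in 𝓝 (0 : ℝ), ∀ τ ∈ Icc T T', scaledPt h (s, τ) ∈ U := by
  refine isCompact_Icc.eventually_forall_of_forall_eventually fun τ hτ => ?_
  have := (continuous_scaledPt h).continuousAt.eventually (hU.mem_nhds (hT τ hτ))
  exact this

/-- The Jacobian of the nilpotent problem is nonsingular before the first conjugate time. -/
theorem jac_nil_det_ne_zero (hY : IsNilpotentDeformation b Y) (hb_pos : ∀ i, 0 < b i)
    (hb : StrictAnti b) {h : HIdx n → ℝ} (hne : ∃ k : HIdx n, k.1 ≠ 0 ∧ h k ≠ 0) {τ : ℝ}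
    (h0 : 0 ≤ τ) (h1 : τ < 2 * Real.pi / b 0) :
    (jac hY (scaledPt h (0, τ))).det ≠ 0 := by
  intro hdet
  obtain ⟨v', hv', hM⟩ := Matrix.exists_mulVec_eq_zero_iff.2 hdet
  set v : Coord n := WithLp.toLp 2 v' with hv
  have hz : ∀ o, fderiv ℝ (endPos hY) (scaledPt h (0, τ)) (0, v) o = 0 := fun o => by
    rw [← jac_mulVec]; exact congrFun hM o
  set q := (scaledPt h (0, τ)).2 with hq
  have hP : scaledPt h (0, τ) = (0, q) := by simp [scaledPt, hq]
  rw [hP] at hz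
  have hqn : q none = τ := rfl
  have hθ : ∀ i, 0 ≤ b i * q none ∧ b i * q none < 2 * Real.pi := fun i => by
    rw [hqn]
    refine ⟨mul_nonneg (hb_pos i).le h0, ?_⟩
    rw [lt_div_iff₀ (hb_pos 0)] at h1
    have : b i ≤ b 0 := hb.antitone (Fin.zero_le i)
    nlinarith
  -- On a kernel vector the horizontal equations determine what each pair contributes to the
  -- vertical one, which becomes (positive sum) · `v none` = 0. Then `v none` = 0, and the
  -- invertible pair blocks kill the rest of `v`.
  have hvert := vertical_fderiv hY q v Finset.univ (fun i _ => hθ i) (fun i _ a => hz _)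
    (fun i hi => absurd (Finset.mem_univ i) hi)
  rw [hz none] at hvert
  have hpos : 0 < ∑ i, (q (some (i, 0)) ^ 2 + q (some (i, 1)) ^ 2) *
      (b i ^ 2 / 2 * pairWeight (b i * q none)) := by
    have hw : ∀ i, 0 < b i ^ 2 / 2 * pairWeight (b i * q none) := fun i =>
      mul_pos (by have := hb_pos i; positivity) (pairWeight_pos (hθ i).1 (hθ i).2)
    -- At s = 0 the first pair of the covector is zero, so strict positivity has to come from
    -- another pair.
    obtain ⟨⟨i, a⟩, hi, hk⟩ := hne
    refine Finset.sum_pos' (fun i _ => mul_nonneg (by positivity) (hw i).le)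
      ⟨i, Finset.mem_univ i, mul_pos ?_ (hw i)⟩
    have hqa : ∀ a, q (some (i, a)) = h (i, a) := fun a => by
      simp only [hq, scaledPt, coordMk_some]
      rw [if_neg hi]
    rw [hqa, hqa]
    obtain rfl | rfl : a = 0 ∨ a = 1 := by omega
    · have := pow_pos (abs_pos.2 hk) 2
      rw [sq_abs] at this
      positivity
    · have := pow_pos (abs_pos.2 hk) 2
      rw [sq_abs] at this
      positivity
  have hvn : v none = 0 := (mul_eq_zero.1 hvert.symm).resolve_left hpos.ne'
  apply hv'
  funext o
  rcases o with _ | ⟨i, a⟩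
  · exact hvn
  · exact pair_zero_of_fderiv hY q v i (hθ i) (fun a => hz _) hvn a

/-- Compactness of [0, T]. The left end τ = 0 can be included because the dilation by ε = s²τ has
removed the degeneration of the exponential map at time 0. -/
theorem eventually_jac_det_ne_zero (hY : IsNilpotentDeformation b Y) (hb_pos : ∀ i, 0 < b i)
    (hb : StrictAnti b) {h : HIdx n → ℝ} (hne : ∃ k : HIdx n, k.1 ≠ 0 ∧ h k ≠ 0) {T : ℝ}
    (hT : T < 2 * Real.pi / b 0) :
    ∀ᶠ s in 𝓝 (0 : ℝ), ∀ τ ∈ Icc 0 T, (jac hY (scaledPt h (s, τ))).det ≠ 0 :=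
  (eventually_forall_scaledPt h (isOpen_jac_det_ne_zero hY) fun τ hτ =>
    ⟨scaledPt_zero_mem hY h τ,
      jac_nil_det_ne_zero hY hb_pos hb hne hτ.1 (hτ.2.trans_lt hT)⟩).mono
    fun _ h τ hτ => (h τ hτ).2

end Jacobian
end
end ContactSR

namespace ContactSR
noncomputable section

/-! ### Schur complements, and limits of difference quotients along the scaled covectors. -/

section Schur

theorem continuousAt_matrix_inv {m : Type*} [Fintype m] [DecidableEq m] {A : Matrix m m ℝ}
    (hA : A.det ≠ 0) : ContinuousAt (fun A : Matrix m m ℝ => A⁻¹) A := by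
  have h1 : (fun A : Matrix m m ℝ => A⁻¹) = fun A => (A.det)⁻¹ • A.adjugate := by
    funext A
    rw [Matrix.inv_def, Ring.inverse_eq_inv']
  rw [h1]
  exact (ContinuousAt.inv₀ (continuous_id.matrix_det).continuousAt hA).smul
    (continuous_id.matrix_adjugate).continuousAt

variable {n : ℕ} [NeZero n]

/-- The indices different from those of the first pair. -/
abbrev RestIdx (n : ℕ) [NeZero n] : Type := {o : Option (HIdx n) // ∀ a, o ≠ some (0, a)}

/-- The index of `z`. -/
def restNone : RestIdx n := ⟨none, fun _ h => by cases h⟩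

/-- The index of `x_k`, for `k` not in the first pair. -/
def restSome (i : Fin n) (hi : i ≠ 0) (a : Fin 2) : RestIdx n :=
  ⟨some (i, a), fun _ h => hi (by simpa using congrArg (Option.map Prod.fst) h)⟩

theorem RestIdx.cases {p : RestIdx n → Prop} (h0 : p restNone)
    (h : ∀ i hi a, p (restSome i hi a)) (o : RestIdx n) : p o := by
  obtain ⟨_ | ⟨i, a⟩, ho⟩ := o
  · exact h0
  · exact h i (fun hi => ho a (by rw [hi])) a

/-- The splitting of the indices into the first pair and the rest. -/
def blockEquiv (n : ℕ) [NeZero n] : Fin 2 ⊕ RestIdx n ≃ Option (HIdx n) :=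
  Equiv.ofBijective (Sum.elim (fun a => some (0, a)) Subtype.val) (by
    constructor
    · rintro (a | ⟨o, ho⟩) (c | ⟨o', ho'⟩) h
      · simpa using h
      · exact absurd h.symm (ho' a)
      · exact absurd h (ho c)
      · exact congrArg Sum.inr (Subtype.ext h)
    · intro o
      by_cases h : ∀ a, o ≠ some (0, a)
      · exact ⟨Sum.inr ⟨o, h⟩, rfl⟩
      · push Not at h
        obtain ⟨a, ha⟩ := h
        exact ⟨Sum.inl a, ha.symm⟩)

/-- A square matrix with the indices split. -/
def splitMat (M : Matrix (Option (HIdx n)) (Option (HIdx n)) ℝ) :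
    Matrix (Fin 2 ⊕ RestIdx n) (Fin 2 ⊕ RestIdx n) ℝ :=
  M.submatrix (blockEquiv n) (blockEquiv n)

theorem det_splitMat (M : Matrix (Option (HIdx n)) (Option (HIdx n)) ℝ) :
    (splitMat M).det = M.det := Matrix.det_submatrix_equiv_self _ _

/-- The Schur complement of the lower right block. -/
def schurComp {m k : Type*} [Fintype k] [DecidableEq k] (M : Matrix (m ⊕ k) (m ⊕ k) ℝ) :
    Matrix m m ℝ :=
  M.toBlocks₁₁ - M.toBlocks₁₂ * M.toBlocks₂₂⁻¹ * M.toBlocks₂₁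

theorem det_eq_mul_schurComp {m k : Type*} [Fintype m] [DecidableEq m] [Fintype k] [DecidableEq k]
    (M : Matrix (m ⊕ k) (m ⊕ k) ℝ) (h : M.toBlocks₂₂.det ≠ 0) :
    M.det = M.toBlocks₂₂.det * (schurComp M).det := by
  have hu : IsUnit M.toBlocks₂₂.det := isUnit_iff_ne_zero.2 h
  have : Invertible M.toBlocks₂₂ := Matrix.invertibleOfIsUnitDet _ hu
  conv_lhs => rw [← Matrix.fromBlocks_toBlocks M]
  rw [Matrix.det_fromBlocks₂₂, schurComp, Matrix.invOf_eq_nonsing_inv]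

/-- The map induced by `W` on the kernel of the lower rows of `M`. -/
def schurMom {m k : Type*} [Fintype k] [DecidableEq k] (W M : Matrix (m ⊕ k) (m ⊕ k) ℝ) :
    Matrix m m ℝ :=
  W.toBlocks₁₁ - W.toBlocks₁₂ * M.toBlocks₂₂⁻¹ * M.toBlocks₂₁

/-- Restriction of the symmetric form WᵀM to the vectors killed by the lower rows of M. They are the
columns of V = (1, −X), on which M acts as (`schurComp`, 0) and the upper rows of W act as
`schurMom`; the zero makes the lower rows of W irrelevant. -/
theorem schurMom_transpose_mul_schurComp {m k : Type*} [Fintype m] [DecidableEq m] [Fintype k]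
    [DecidableEq k] (W M : Matrix (m ⊕ k) (m ⊕ k) ℝ) (h : M.toBlocks₂₂.det ≠ 0)
    (hs : (W.transpose * M).IsSymm) : ((schurMom W M).transpose * schurComp M).IsSymm := by
  have hu : IsUnit M.toBlocks₂₂.det := isUnit_iff_ne_zero.2 h
  set X := M.toBlocks₂₂⁻¹ * M.toBlocks₂₁ with hX
  have hDX : M.toBlocks₂₂ * X = M.toBlocks₂₁ := by
    rw [hX, ← Matrix.mul_assoc, Matrix.mul_nonsing_inv _ hu, Matrix.one_mul]
  set V : Matrix (m ⊕ k) (m ⊕ k) ℝ := Matrix.fromBlocks 1 0 (-X) 0 with hV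
  have hMV : M * V = Matrix.fromBlocks (schurComp M) 0 0 0 := by
    conv_lhs => rw [← Matrix.fromBlocks_toBlocks M]
    rw [hV, Matrix.fromBlocks_multiply]
    simp only [Matrix.mul_one, Matrix.mul_zero, Matrix.mul_neg, hDX, add_zero, add_neg_cancel]
    rw [schurComp, hX, Matrix.mul_assoc, sub_eq_add_neg]
  have hWV : W * V = Matrix.fromBlocks (schurMom W M) 0
      (W.toBlocks₂₁ - W.toBlocks₂₂ * X) 0 := by
    conv_lhs => rw [← Matrix.fromBlocks_toBlocks W]
    rw [hV, Matrix.fromBlocks_multiply]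
    simp only [Matrix.mul_one, Matrix.mul_zero, Matrix.mul_neg, add_zero]
    rw [schurMom, Matrix.mul_assoc, ← hX, sub_eq_add_neg, sub_eq_add_neg]
  have h1 : ((W * V).transpose * (M * V)).IsSymm := by
    have h2 : (W * V).transpose * (M * V) = V.transpose * (W.transpose * M) * V := by
      rw [Matrix.transpose_mul]; simp only [Matrix.mul_assoc]
    rw [h2]
    generalize W.transpose * M = Z at hs
    rw [Matrix.IsSymm, Matrix.transpose_mul, Matrix.transpose_mul, Matrix.transpose_transpose,
      hs.eq, Matrix.mul_assoc]
  rw [hMV, hWV, Matrix.fromBlocks_transpose, Matrix.fromBlocks_multiply] at h1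
  simp only [Matrix.mul_zero, add_zero] at h1
  have h3 := (Matrix.isSymm_fromBlocks_iff.1 h1).1
  exact h3

variable {b : Fin n → ℝ} {Y : HIdx n → ℝ × Coord n → Coord n}

/-- The base covector `(0, 0, h_3, …, h_{2n}, τ)`. -/
theorem scaledPt_zero (h : HIdx n → ℝ) (τ : ℝ) :
    scaledPt h (0, τ) = (0, coordMk (fun k => if k.1 = 0 then 0 else h k) τ) := by
  simp [scaledPt]

/-- The direction `(h_1, h_2, 0, …, 0)`. -/
def firstPair (h : HIdx n → ℝ) : Coord n := coordMk (fun k => if k.1 = 0 then h k else 0) 0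

theorem scaledPt_eq (h : HIdx n → ℝ) (s τ : ℝ) :
    scaledPt h (s, τ) = scaledPt h (0, τ) + (s ^ 2 * τ) • ((1, 0) : ℝ × Coord n) +
      s • ((0, firstPair h) : ℝ × Coord n) := by
  rw [scaledPt_zero, Prod.ext_iff]
  refine ⟨by simp [scaledPt], Coord.ext (fun k => ?_) ?_⟩
  · simp only [scaledPt, firstPair, Prod.snd_add, Prod.smul_snd, PiLp.add_apply, PiLp.smul_apply,
      coordMk_some, smul_eq_mul]
    split_ifs <;> simp
  · simp [scaledPt, firstPair]

/-- The filter of the times close to `α` and of the small positive `s`. -/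
abbrev nearFilter (α : ℝ) : Filter (ℝ × ℝ) := 𝓝[>] (0 : ℝ) ×ˢ 𝓝 α

theorem tendsto_scaledPt (h : HIdx n → ℝ) (α : ℝ) :
    Tendsto (scaledPt h) (nearFilter α) (𝓝 (scaledPt h (0, α))) := by
  have h1 : nearFilter α ≤ 𝓝 ((0 : ℝ), α) := by
    rw [nhds_prod_eq]
    exact Filter.prod_mono_left _ nhdsWithin_le_nhds
  exact ((continuous_scaledPt h).tendsto _).mono_left h1

theorem tendsto_fst_near (α : ℝ) : Tendsto Prod.fst (nearFilter α) (𝓝[>] (0 : ℝ)) := tendsto_fst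

theorem eventually_pos_near (α : ℝ) : ∀ᶠ x in nearFilter α, 0 < x.1 :=
  (tendsto_fst_near α).eventually self_mem_nhdsWithin

/-- Expansion in the parameter. -/
theorem tendsto_param_quotient (h : HIdx n → ℝ) (α : ℝ) {m : ℝ × Coord n → ℝ}
    (hm : ContDiffAt ℝ ∞ m (scaledPt h (0, α))) :
    Tendsto (fun x : ℝ × ℝ => (m (scaledPt h x) - m (0, (scaledPt h x).2)) / x.1 ^ 2)
      (nearFilter α) (𝓝 (α * fderiv ℝ m (scaledPt h (0, α)) (1, 0))) := by
  -- Strict differentiability is needed because both points of the difference move with (s, τ).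
  have hs := (hm.hasStrictFDerivAt (by simp)).isLittleO
  have ht := tendsto_scaledPt h α
  have ht2 : Tendsto (fun x => ((0, (scaledPt h x).2) : ℝ × Coord n)) (nearFilter α)
      (𝓝 (scaledPt h (0, α))) := by
    have h1 : scaledPt h (0, α) = (0, (scaledPt h (0, α)).2) := by rw [scaledPt_zero]
    rw [h1]
    exact tendsto_const_nhds.prodMk_nhds ((continuous_snd.tendsto _).comp ht)
  have h2 := hs.comp_tendsto (ht.prodMk_nhds ht2)
  have hdiff : ∀ x : ℝ × ℝ, scaledPt h x - (0, (scaledPt h x).2) =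
      (x.1 ^ 2 * x.2) • ((1, 0) : ℝ × Coord n) := by
    intro x
    rw [Prod.ext_iff]
    constructor <;> simp [scaledPt]
  have hτ : Tendsto (fun x : ℝ × ℝ => x.2) (nearFilter α) (𝓝 α) := tendsto_snd
  have h3 : (fun x : ℝ × ℝ => m (scaledPt h x) - m (0, (scaledPt h x).2) -
      x.1 ^ 2 * x.2 * fderiv ℝ m (scaledPt h (0, α)) (1, 0)) =o[nearFilter α]
      fun x : ℝ × ℝ => x.1 ^ 2 := by
    have h4 : (fun x : ℝ × ℝ => (x.1 ^ 2 * x.2) • ((1, 0) : ℝ × Coord n)) =O[nearFilter α]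
        fun x : ℝ × ℝ => x.1 ^ 2 := by
      have h5 : (fun x : ℝ × ℝ => x.2 • ((1, 0) : ℝ × Coord n)) =O[nearFilter α]
          fun _ => (1 : ℝ) := (hτ.smul_const _).isBigO_one ℝ
      have h6 := (Asymptotics.isBigO_refl (fun x : ℝ × ℝ => x.1 ^ 2) (nearFilter α)).smul h5
      simpa [smul_smul] using h6
    refine (h2.congr (fun x => ?_) (fun x => ?_)).trans_isBigO h4
    · simp only [Function.comp_apply, hdiff, map_smul, smul_eq_mul]
    · simp only [Function.comp_apply, hdiff]
  have h7 := h3.tendsto_div_nhds_zero.add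
    (hτ.mul_const (fderiv ℝ m (scaledPt h (0, α)) (1, 0)))
  rw [zero_add] at h7
  refine h7.congr' ?_
  filter_upwards [eventually_pos_near α] with x hx
  field_simp
  ring

/-- Expansion in `s` of a function which vanishes for `s = 0`. -/
theorem tendsto_scale_quotient (h : HIdx n → ℝ) (α : ℝ) {m : ℝ × Coord n → ℝ}
    (hm : ContDiffAt ℝ ∞ m (scaledPt h (0, α))) (hz : ∀ τ, m (scaledPt h (0, τ)) = 0) :
    Tendsto (fun x : ℝ × ℝ => m (scaledPt h x) / x.1)
      (nearFilter α) (𝓝 (fderiv ℝ m (scaledPt h (0, α)) (0, firstPair h))) := by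
  have hs := (hm.hasStrictFDerivAt (by simp)).isLittleO
  have ht := tendsto_scaledPt h α
  have hτ : Tendsto (fun x : ℝ × ℝ => x.2) (nearFilter α) (𝓝 α) := tendsto_snd
  have hs0 : Tendsto (fun x : ℝ × ℝ => x.1) (nearFilter α) (𝓝 0) :=
    tendsto_nhds_of_tendsto_nhdsWithin (tendsto_fst_near α)
  have ht2 : Tendsto (fun x : ℝ × ℝ => scaledPt h (0, x.2)) (nearFilter α)
      (𝓝 (scaledPt h (0, α))) := by
    have hc : Continuous fun τ : ℝ => scaledPt h (0, τ) :=
      (continuous_scaledPt h).comp (by fun_prop)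
    exact (hc.tendsto α).comp hτ
  have h2 := hs.comp_tendsto (ht.prodMk_nhds ht2)
  -- After division by s the parameter, which moves like s²τ, contributes only sτ and disappears in
  -- the limit.
  set d : ℝ × ℝ → ℝ × Coord n := fun x => (x.1 * x.2) • (1, 0) + (0, firstPair h) with hd
  have hdiff : ∀ x : ℝ × ℝ, scaledPt h x - scaledPt h (0, x.2) = x.1 • d x := by
    rintro ⟨s, τ⟩
    rw [scaledPt_eq]
    simp only [hd, smul_add, smul_smul]
    rw [add_assoc, add_sub_cancel_left]
    congr 2
    ring
  have hdt : Tendsto d (nearFilter α) (𝓝 (0, firstPair h)) := by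
    have h8 := ((hs0.mul hτ).smul_const ((1, 0) : ℝ × Coord n)).add_const (0, firstPair h)
    simp only [zero_mul, zero_smul, zero_add] at h8
    exact h8
  have h3 : (fun x : ℝ × ℝ => m (scaledPt h x) -
      x.1 * fderiv ℝ m (scaledPt h (0, α)) (d x)) =o[nearFilter α]
      fun x : ℝ × ℝ => x.1 := by
    have h4 : (fun x : ℝ × ℝ => x.1 • d x) =O[nearFilter α] fun x : ℝ × ℝ => x.1 := by
      have h6 := (Asymptotics.isBigO_refl (fun x : ℝ × ℝ => x.1) (nearFilter α)).smul
        (hdt.isBigO_one ℝ)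
      simpa using h6
    refine (h2.congr (fun x => ?_) (fun x => ?_)).trans_isBigO h4
    · simp only [Function.comp_apply, hdiff, map_smul, smul_eq_mul, hz, sub_zero]
    · simp only [Function.comp_apply, hdiff]
  have h7 := h3.tendsto_div_nhds_zero.add
    (((fderiv ℝ m (scaledPt h (0, α))).continuous.tendsto _).comp hdt)
  rw [zero_add] at h7
  refine h7.congr' ?_
  filter_upwards [eventually_pos_near α] with x hx
  simp only [Function.comp_apply]
  field_simp
  ring

end Schur

/-! ### Entries of the nilpotent Jacobian and first-order behaviour of the off-diagonal blocks. -/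

section Entries

set_option linter.unusedSectionVars false

variable {n : ℕ} [NeZero n] {b : Fin n → ℝ} {Y : HIdx n → ℝ × Coord n → Coord n}

theorem jac_nil_first (hY : IsNilpotentDeformation b Y) (q : Coord n) (a c : Fin 2) :
    jac hY (0, q) (some (0, a)) (some (0, c)) =
      !![Real.sinc (b 0 * q none), cosc (b 0 * q none);
        -cosc (b 0 * q none), Real.sinc (b 0 * q none)] a c := by
  rw [jac, Matrix.of_apply, fderiv_endPos_nil, coordMk_some]
  obtain rfl | rfl : a = 0 ∨ a = 1 := by omega
  all_goals obtain rfl | rfl : c = 0 ∨ c = 1 := by omega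
  all_goals simp

theorem jac_nil_hor_ne (hY : IsNilpotentDeformation b Y) (q : Coord n) {i j : Fin n} (hij : i ≠ j)
    (a c : Fin 2) : jac hY (0, q) (some (i, a)) (some (j, c)) = 0 := by
  rw [jac, Matrix.of_apply, fderiv_endPos_nil, coordMk_some]
  simp [hij]

theorem jac_nil_hor_none (hY : IsNilpotentDeformation b Y) (q : Coord n) (i : Fin n)
    (a : Fin 2) : jac hY (0, q) (some (i, a)) none =
      b i * (sincDeriv (b i * q none) * q (some (i, a)) +
        coscDeriv (b i * q none) * (if a = 0 then q (some (i, 1)) else -q (some (i, 0)))) := by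
  rw [jac, Matrix.of_apply, fderiv_endPos_nil, coordMk_some]
  obtain rfl | rfl : a = 0 ∨ a = 1 := by omega
  · simp
  · simp [sub_eq_add_neg]

theorem jac_nil_none_hor (hY : IsNilpotentDeformation b Y) (q : Coord n) (i : Fin n)
    (a : Fin 2) : jac hY (0, q) none (some (i, a)) =
      b i * areac (b i * q none) * q (some (i, a)) := by
  rw [jac, Matrix.of_apply, fderiv_endPos_nil, coordMk_none, Finset.sum_eq_single i]
  · obtain rfl | rfl : a = 0 ∨ a = 1 := by omega
    · simp; ring
    · simp; ring
  · intro j _ hj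
    simp [hj]
  · simp

theorem sincDeriv_two_pi : sincDeriv (2 * Real.pi) = (2 * Real.pi)⁻¹ := by
  have : 2 * Real.pi ≠ 0 := by positivity
  rw [sincDeriv, if_neg this, Real.cos_two_pi, Real.sin_two_pi]
  field_simp
  ring

theorem coscDeriv_two_pi : coscDeriv (2 * Real.pi) = 0 := by
  have : 2 * Real.pi ≠ 0 := by positivity
  rw [coscDeriv, if_neg this, Real.cos_two_pi, Real.sin_two_pi]
  simp

theorem areac_two_pi : areac (2 * Real.pi) = (2 * Real.pi)⁻¹ := by
  have : 2 * Real.pi ≠ 0 := by positivity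
  rw [areac, Real.sinc_of_ne_zero this, Real.sin_two_pi]
  simp

/-- The derivative of a function known on the nilpotent problem. -/
theorem fderiv_eq_of_nil {m : ℝ × Coord n → ℝ} {q d : Coord n}
    (hm : ContDiffAt ℝ ∞ m (0, q)) {f : ℝ → ℝ} {f' : ℝ} (hf : HasDerivAt f f' 0)
    (h : ∀ r, m (0, q + r • d) = f r) : fderiv ℝ m (0, q) (0, d) = f' := by
  have h0 : ((0, q) : ℝ × Coord n) + (0 : ℝ) • ((0, d) : ℝ × Coord n) = (0, q) := by simp
  have hd : HasFDerivAt m (fderiv ℝ m (0, q))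
      (((0, q) : ℝ × Coord n) + (0 : ℝ) • ((0, d) : ℝ × Coord n)) := by
    rw [h0]
    exact (hm.differentiableAt (by simp)).hasFDerivAt
  refine (hd.comp_hasDerivAt (0 : ℝ) (hasDerivAt_line (0, q) (0, d))).unique
    (hf.congr_of_eventuallyEq (Eventually.of_forall fun r => ?_))
  have : ((0, q) : ℝ × Coord n) + r • ((0, d) : ℝ × Coord n) = (0, q + r • d) := by simp
  rw [Function.comp_apply, this, h]

variable (hY : IsNilpotentDeformation b Y) (h : HIdx n → ℝ)

theorem contDiffAt_jac_scaledPt (α : ℝ) (o o' : Option (HIdx n)) :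
    ContDiffAt ℝ ∞ (fun P => jac hY P o o') (scaledPt h (0, α)) :=
  contDiffAt_jac hY (scaledPt_zero_mem hY h α) o o'

theorem tendsto_jac_near (α : ℝ) : Tendsto (fun x => splitMat (jac hY (scaledPt h x)))
    (nearFilter α) (𝓝 (splitMat (jac hY (scaledPt h (0, α))))) := by
  have h1 : Continuous (splitMat (n := n)) := continuous_id.matrix_submatrix _ _
  exact (h1.tendsto _).comp ((continuousAt_jac hY (scaledPt_zero_mem hY h α)).tendsto.comp
    (tendsto_scaledPt h α))

/-- At s = 0 the block is zero, because different pairs do not interact and the first pair of the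
covector vanishes. To first order in s only the z column responds; at angle 2π the derivative of
sinc is 1/(2π) and that of `cosc` is 0, which leaves b₁ h/(2π). -/
theorem tendsto_upper_block (hb_pos : ∀ i, 0 < b i) :
    Tendsto (fun x : ℝ × ℝ => x.1⁻¹ • (splitMat (jac hY (scaledPt h x))).toBlocks₁₂)
      (nearFilter (2 * Real.pi / b 0))
      (𝓝 (Matrix.of fun a o => if o = restNone then h (0, a) / (2 * Real.pi / b 0) else 0)) := by
  have hb0 := hb_pos 0
  refine tendsto_pi_nhds.2 fun a => tendsto_pi_nhds.2 fun o => ?_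
  have hc := contDiffAt_jac_scaledPt hY h (2 * Real.pi / b 0) (some (0, a)) o.1
  have key : (∀ τ, jac hY (scaledPt h (0, τ)) (some (0, a)) o.1 = 0) ∧
      fderiv ℝ (fun P => jac hY P (some (0, a)) o.1) (scaledPt h (0, 2 * Real.pi / b 0))
        (0, firstPair h) = if o = restNone then h (0, a) / (2 * Real.pi / b 0) else 0 := by
    simp only [scaledPt_zero] at hc ⊢
    induction o using RestIdx.cases with
    | h0 =>
      refine ⟨fun τ => ?_, ?_⟩
      · simp only [restNone]
        rw [jac_nil_hor_none]
        simp
      · rw [if_pos rfl]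
        simp only [restNone] at hc ⊢
        have hlin : HasDerivAt (fun r : ℝ => r * (h (0, a) / (2 * Real.pi / b 0)))
            (h (0, a) / (2 * Real.pi / b 0)) 0 := by
          simpa using (hasDerivAt_id (0 : ℝ)).mul_const (h (0, a) / (2 * Real.pi / b 0))
        refine fderiv_eq_of_nil hc hlin fun r => ?_
        rw [jac_nil_hor_none]
        have hw : b 0 * (coordMk (fun k => if k.1 = 0 then 0 else h k) (2 * Real.pi / b 0) +
            r • firstPair h) none = 2 * Real.pi := by
          simp [firstPair]; field_simp
        rw [hw, sincDeriv_two_pi, coscDeriv_two_pi]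
        simp [firstPair]
        field_simp
    | h i hi c =>
      refine ⟨fun τ => jac_nil_hor_ne hY _ (Ne.symm hi) _ _, ?_⟩
      rw [if_neg (fun h => by simpa [restSome, restNone] using congrArg Subtype.val h)]
      exact fderiv_eq_of_nil hc (hasDerivAt_const (0 : ℝ) (0 : ℝ)) fun r =>
        jac_nil_hor_ne hY _ (Ne.symm hi) _ _
  have h2 := tendsto_scale_quotient h _ hc key.1
  rw [key.2] at h2
  refine h2.congr fun x => ?_
  rw [div_eq_inv_mul]
  rfl

/-- Here the z row responds through `areac`, whose value 1/(2π) at angle 2π makes the limit the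
transpose of that of the upper block. -/
theorem tendsto_lower_block (hb_pos : ∀ i, 0 < b i) :
    Tendsto (fun x : ℝ × ℝ => x.1⁻¹ • (splitMat (jac hY (scaledPt h x))).toBlocks₂₁)
      (nearFilter (2 * Real.pi / b 0))
      (𝓝 (Matrix.of fun o a => if o = restNone then h (0, a) / (2 * Real.pi / b 0) else 0)) := by
  have hb0 := hb_pos 0
  refine tendsto_pi_nhds.2 fun o => tendsto_pi_nhds.2 fun a => ?_
  have hc := contDiffAt_jac_scaledPt hY h (2 * Real.pi / b 0) o.1 (some (0, a))
  have key : (∀ τ, jac hY (scaledPt h (0, τ)) o.1 (some (0, a)) = 0) ∧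
      fderiv ℝ (fun P => jac hY P o.1 (some (0, a))) (scaledPt h (0, 2 * Real.pi / b 0))
        (0, firstPair h) = if o = restNone then h (0, a) / (2 * Real.pi / b 0) else 0 := by
    simp only [scaledPt_zero] at hc ⊢
    induction o using RestIdx.cases with
    | h0 =>
      refine ⟨fun τ => ?_, ?_⟩
      · simp only [restNone]
        rw [jac_nil_none_hor]
        simp
      · rw [if_pos rfl]
        simp only [restNone] at hc ⊢
        have hlin : HasDerivAt (fun r : ℝ => r * (h (0, a) / (2 * Real.pi / b 0)))
            (h (0, a) / (2 * Real.pi / b 0)) 0 := by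
          simpa using (hasDerivAt_id (0 : ℝ)).mul_const (h (0, a) / (2 * Real.pi / b 0))
        refine fderiv_eq_of_nil hc hlin fun r => ?_
        rw [jac_nil_none_hor]
        have hw : b 0 * (coordMk (fun k => if k.1 = 0 then 0 else h k) (2 * Real.pi / b 0) +
            r • firstPair h) none = 2 * Real.pi := by
          simp [firstPair]; field_simp
        rw [hw, areac_two_pi]
        simp [firstPair]
        field_simp
    | h i hi c =>
      refine ⟨fun τ => jac_nil_hor_ne hY _ hi _ _, ?_⟩
      rw [if_neg (fun h => by simpa [restSome, restNone] using congrArg Subtype.val h)]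
      exact fderiv_eq_of_nil hc (hasDerivAt_const (0 : ℝ) (0 : ℝ)) fun r =>
        jac_nil_hor_ne hY _ hi _ _
  have h2 := tendsto_scale_quotient h _ hc key.1
  rw [key.2] at h2
  refine h2.congr fun x => ?_
  rw [div_eq_inv_mul]
  rfl

end Entries
end
end ContactSR

namespace ContactSR
noncomputable section

/-! ### Expansion of the Schur complement at the critical time. -/

section Expansion

variable {n : ℕ} [NeZero n] {b : Fin n → ℝ} {Y : HIdx n → ℝ × Coord n → Coord n}
  (hY : IsNilpotentDeformation b Y) (h : HIdx n → ℝ)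

theorem pair_term_eq (hb_pos : ∀ i, 0 < b i) (hb : StrictAnti b) {i : Fin n} (hi : i ≠ 0) :
    b i ^ 2 / 2 * pairWeight (b i * (2 * Real.pi / b 0)) =
      (1 - b i / b 0 * Real.pi * Real.cot (b i * Real.pi / b 0)) / (2 * Real.pi / b 0) ^ 2 := by
  have h0 := hb_pos 0
  have h1 := hb_pos i
  have hlt : b i < b 0 := hb (Fin.pos_iff_ne_zero.2 hi)
  have hpos : 0 < b i * (2 * Real.pi / b 0) := by positivity
  have hlt2 : b i * (2 * Real.pi / b 0) < 2 * Real.pi := by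
    rw [← mul_div_assoc, div_lt_iff₀ h0]
    nlinarith [Real.pi_pos]
  rw [pairWeight_eq hpos hlt2]
  have h2 : b i * (2 * Real.pi / b 0) / 2 = b i * Real.pi / b 0 := by ring
  rw [h2]
  field_simp

/-- This identifies K/α² with the reduced vertical derivative at τ = α. The cotangents of K are
those of the half-angles b_i α/2 = b_i π/b₁. -/
theorem constK_eq (hb_pos : ∀ i, 0 < b i) (hb : StrictAnti b) :
    ∑ i ∈ Finset.univ.filter (fun i : Fin n => i ≠ 0), (h (i, 0) ^ 2 + h (i, 1) ^ 2) *
      (b i ^ 2 / 2 * pairWeight (b i * (2 * Real.pi / b 0))) =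
      constK b h / (2 * Real.pi / b 0) ^ 2 := by
  rw [constK, Finset.sum_div]
  refine Finset.sum_congr rfl fun i hi => ?_
  rw [pair_term_eq hb_pos hb (Finset.mem_filter.1 hi).2]
  ring

theorem angle_mem (hb_pos : ∀ i, 0 < b i) (hb : StrictAnti b) {i : Fin n} (hi : i ≠ 0) :
    0 ≤ b i * (2 * Real.pi / b 0) ∧ b i * (2 * Real.pi / b 0) < 2 * Real.pi := by
  have h0 := hb_pos 0
  have h1 := hb_pos i
  have hlt : b i < b 0 := hb (Fin.pos_iff_ne_zero.2 hi)
  refine ⟨by positivity, ?_⟩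
  rw [← mul_div_assoc, div_lt_iff₀ h0]
  nlinarith [Real.pi_pos]

theorem constK_pos (hb_pos : ∀ i, 0 < b i) (hb : StrictAnti b)
    (hne : ∃ k : HIdx n, k.1 ≠ 0 ∧ h k ≠ 0) : 0 < constK b h := by
  have h0 := hb_pos 0
  have hα : 0 < (2 * Real.pi / b 0) ^ 2 := by positivity
  have hw : ∀ i : Fin n, i ≠ 0 → 0 < b i ^ 2 / 2 * pairWeight (b i * (2 * Real.pi / b 0)) :=
    fun i hi => mul_pos (by have := hb_pos i; positivity)
      (pairWeight_pos (angle_mem hb_pos hb hi).1 (angle_mem hb_pos hb hi).2)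
  have : 0 < constK b h / (2 * Real.pi / b 0) ^ 2 := by
    rw [← constK_eq h hb_pos hb]
    obtain ⟨⟨i, a⟩, hi, hk⟩ := hne
    refine Finset.sum_pos' (fun i hi => mul_nonneg (by positivity)
      (hw i (Finset.mem_filter.1 hi).2).le)
      ⟨i, Finset.mem_filter.2 ⟨Finset.mem_univ i, hi⟩, mul_pos ?_ (hw i hi)⟩
    have h2 := pow_pos (abs_pos.2 hk) 2
    rw [sq_abs] at h2
    obtain rfl | rfl : a = 0 ∨ a = 1 := by omega
    all_goals positivity
  exact (div_pos_iff_of_pos_right hα).1 this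

/-- Extension by zero of a vector indexed by the indices outside the first pair. -/
def extendRest (x : RestIdx n → ℝ) : Coord n :=
  WithLp.toLp 2 fun o => Sum.elim 0 x ((blockEquiv n).symm o)

theorem extendRest_rest (x : RestIdx n → ℝ) (o : RestIdx n) : extendRest x o.1 = x o := by
  have : (blockEquiv n).symm o.1 = Sum.inr o := (Equiv.symm_apply_eq _).2 rfl
  simp only [extendRest]
  rw [this]
  rfl

theorem extendRest_first (x : RestIdx n → ℝ) (a : Fin 2) : extendRest x (some (0, a)) = 0 := by
  have : (blockEquiv n).symm (some (0, a)) = Sum.inl a := (Equiv.symm_apply_eq _).2 rfl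
  simp only [extendRest]
  rw [this]
  rfl

theorem splitMat_lower_mulVec (P : ℝ × Coord n) (x : RestIdx n → ℝ) (o : RestIdx n) :
    (splitMat (jac hY P)).toBlocks₂₂.mulVec x o =
      fderiv ℝ (endPos hY) P (0, extendRest x) o.1 := by
  rw [← jac_mulVec]
  simp only [Matrix.mulVec, dotProduct]
  rw [← (blockEquiv n).sum_comp, Fintype.sum_sum_type]
  have h1 : ∀ a : Fin 2, (extendRest x).ofLp (blockEquiv n (Sum.inl a)) = 0 :=
    fun a => extendRest_first x a
  have h2 : ∀ o' : RestIdx n, (extendRest x).ofLp (blockEquiv n (Sum.inr o')) = x o' :=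
    fun o' => extendRest_rest x o'
  simp only [h1, h2, mul_zero, Finset.sum_const_zero, zero_add]
  rfl

/-- The vertical derivative of the nilpotent problem at the first conjugate time. -/
theorem vertical_fderiv_at_period (hb_pos : ∀ i, 0 < b i) (hb : StrictAnti b) (v : Coord n)
    (hz : ∀ i : Fin n, i ≠ 0 → ∀ a, fderiv ℝ (endPos hY) (scaledPt h (0, 2 * Real.pi / b 0))
      (0, v) (some (i, a)) = 0) :
    fderiv ℝ (endPos hY) (scaledPt h (0, 2 * Real.pi / b 0)) (0, v) none =
      constK b h / (2 * Real.pi / b 0) ^ 2 * v none ∧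
    (v none = 0 → ∀ i : Fin n, i ≠ 0 → ∀ a, v (some (i, a)) = 0) := by
  rw [scaledPt_zero] at hz ⊢
  constructor
  · rw [vertical_fderiv hY _ v (Finset.univ.filter (fun i : Fin n => i ≠ 0))
      (fun i hi => angle_mem hb_pos hb (Finset.mem_filter.1 hi).2)
      (fun i hi a => hz i (Finset.mem_filter.1 hi).2 a) ?_, ← constK_eq h hb_pos hb]
    · congr 1
      refine Finset.sum_congr rfl fun i hi => ?_
      simp only [coordMk_some, coordMk_none, if_neg (Finset.mem_filter.1 hi).2]
    · intro i hi a
      have : i = 0 := by simpa using hi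
      simp [this]
  · intro hv i hi a
    exact pair_zero_of_fderiv hY _ v i (angle_mem hb_pos hb hi) (hz i hi) hv a

/-- The kernel argument of `jac_nil_det_ne_zero` still works at τ = α without the first pair, as the
other angles are below 2π by strict monotonicity of b. -/
theorem lower_block_det_ne_zero (hb_pos : ∀ i, 0 < b i) (hb : StrictAnti b)
    (hne : ∃ k : HIdx n, k.1 ≠ 0 ∧ h k ≠ 0) :
    (splitMat (jac hY (scaledPt h (0, 2 * Real.pi / b 0)))).toBlocks₂₂.det ≠ 0 := by
  intro hdet
  have hb0 := hb_pos 0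
  obtain ⟨x, hx, hM⟩ := Matrix.exists_mulVec_eq_zero_iff.2 hdet
  have hz : ∀ o : RestIdx n, fderiv ℝ (endPos hY) (scaledPt h (0, 2 * Real.pi / b 0))
      (0, extendRest x) o.1 = 0 := fun o => by
    rw [← splitMat_lower_mulVec, hM]; rfl
  obtain ⟨h1, h2⟩ := vertical_fderiv_at_period hY h hb_pos hb (extendRest x)
    fun i hi a => hz (restSome i hi a)
  rw [show fderiv ℝ (endPos hY) (scaledPt h (0, 2 * Real.pi / b 0)) (0, extendRest x) none = 0 from
    hz restNone] at h1
  have hK := constK_pos h hb_pos hb hne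
  have h3 : (extendRest x) none = 0 :=
    (mul_eq_zero.1 h1.symm).resolve_left (by positivity)
  apply hx
  funext o
  rw [← extendRest_rest x o]
  induction o using RestIdx.cases with
  | h0 => exact h3
  | h i hi a => exact h2 h3 i hi a

/-- The zz entry of the inverse is the reciprocal of the reduced vertical derivative K/α². No other
entry is needed, since the rescaled off-diagonal blocks are supported on the index z in the limit.
-/
theorem lower_block_inv_none (hb_pos : ∀ i, 0 < b i) (hb : StrictAnti b)
    (hne : ∃ k : HIdx n, k.1 ≠ 0 ∧ h k ≠ 0) :
    (splitMat (jac hY (scaledPt h (0, 2 * Real.pi / b 0)))).toBlocks₂₂⁻¹ restNone restNone =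
      (2 * Real.pi / b 0) ^ 2 / constK b h := by
  have hb0 := hb_pos 0
  have hK := constK_pos h hb_pos hb hne
  set D := (splitMat (jac hY (scaledPt h (0, 2 * Real.pi / b 0)))).toBlocks₂₂ with hD
  have hu : IsUnit D.det := isUnit_iff_ne_zero.2 (lower_block_det_ne_zero hY h hb_pos hb hne)
  set x : RestIdx n → ℝ := D⁻¹.mulVec (Pi.single restNone 1) with hx
  have hDx : D.mulVec x = Pi.single restNone 1 := by
    rw [hx, Matrix.mulVec_mulVec, Matrix.mul_nonsing_inv _ hu, Matrix.one_mulVec]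
  have hz : ∀ o : RestIdx n, fderiv ℝ (endPos hY) (scaledPt h (0, 2 * Real.pi / b 0))
      (0, extendRest x) o.1 = (Pi.single restNone 1 : RestIdx n → ℝ) o := fun o => by
    rw [← splitMat_lower_mulVec, ← hD, hDx]
  obtain ⟨h1, -⟩ := vertical_fderiv_at_period hY h hb_pos hb (extendRest x) fun i hi a => by
    rw [show (some (i, a) : Option (HIdx n)) = (restSome i hi a).1 from rfl, hz]
    refine Pi.single_eq_of_ne (fun h => ?_) _
    simpa [restSome, restNone] using congrArg Subtype.val h
  rw [show fderiv ℝ (endPos hY) (scaledPt h (0, 2 * Real.pi / b 0)) (0, extendRest x) none =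
    (Pi.single restNone 1 : RestIdx n → ℝ) restNone from hz restNone, Pi.single_eq_same] at h1
  have h2 : extendRest x none = D⁻¹ restNone restNone := by
    rw [show extendRest x none = x restNone from extendRest_rest x restNone, hx]
    simp
  rw [h2] at h1
  field_simp at h1 ⊢
  linarith

/-- The rotation block of the nilpotent problem for the first pair. -/
def rotBlock (b0 τ : ℝ) : Matrix (Fin 2) (Fin 2) ℝ :=
  !![Real.sinc (b0 * τ), cosc (b0 * τ); -cosc (b0 * τ), Real.sinc (b0 * τ)]

/-- The block vanishes at α and α times its derivative there is the identity, so dividing its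
entries by τ − α gives continuous functions at α. -/
theorem exists_rotBlock_factor {b0 : ℝ} (hb0 : 0 < b0) :
    ∃ Ψ : ℝ → Matrix (Fin 2) (Fin 2) ℝ, Tendsto Ψ (𝓝 (2 * Real.pi / b0)) (𝓝 1) ∧
      ∀ τ, (2 * Real.pi / b0) • rotBlock b0 τ = (τ - 2 * Real.pi / b0) • Ψ τ := by
  set α := 2 * Real.pi / b0 with hα
  have hp : (2 * Real.pi) ≠ 0 := by positivity
  have hw : b0 * α = 2 * Real.pi := by rw [hα]; field_simp
  have hα0 : α ≠ 0 := by positivity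
  have hl : HasDerivAt (fun τ : ℝ => b0 * τ) b0 α := by
    simpa using (hasDerivAt_id α).const_mul b0
  have hS : HasDerivAt (fun τ => α * Real.sinc (b0 * τ)) 1 α := by
    have h1 := ((hasDerivAt_sinc (b0 * α)).comp α hl).const_mul α
    rw [hw, sincDeriv_two_pi] at h1
    refine h1.congr_deriv ?_
    rw [← hw]; field_simp
  have hC : HasDerivAt (fun τ => α * cosc (b0 * τ)) 0 α := by
    have h1 := ((hasDerivAt_cosc (b0 * α)).comp α hl).const_mul α
    rw [hw, coscDeriv_two_pi] at h1
    simpa using h1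
  have hS0 : α * Real.sinc (b0 * α) = 0 := by rw [hw, Real.sinc_of_ne_zero hp]; simp
  have hC0 : α * cosc (b0 * α) = 0 := by rw [hw, cosc]; simp
  set f := dslope (fun τ => α * Real.sinc (b0 * τ)) α with hf
  set g := dslope (fun τ => α * cosc (b0 * τ)) α with hg
  have hf1 : ∀ τ, α * Real.sinc (b0 * τ) = (τ - α) * f τ := fun τ => by
    have := sub_smul_dslope (fun τ => α * Real.sinc (b0 * τ)) α τ
    simp only [hS0, sub_zero, smul_eq_mul] at this
    exact this.symm
  have hg1 : ∀ τ, α * cosc (b0 * τ) = (τ - α) * g τ := fun τ => by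
    have := sub_smul_dslope (fun τ => α * cosc (b0 * τ)) α τ
    simp only [hC0, sub_zero, smul_eq_mul] at this
    exact this.symm
  have hft : Tendsto f (𝓝 α) (𝓝 1) := by
    have := (continuousAt_dslope_same.2 hS.differentiableAt).tendsto
    rwa [dslope_same, hS.deriv] at this
  have hgt : Tendsto g (𝓝 α) (𝓝 0) := by
    have := (continuousAt_dslope_same.2 hC.differentiableAt).tendsto
    rwa [dslope_same, hC.deriv] at this
  refine ⟨fun τ => !![f τ, g τ; -g τ, f τ], ?_, fun τ => ?_⟩
  · refine tendsto_pi_nhds.2 fun a => tendsto_pi_nhds.2 fun c => ?_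
    obtain rfl | rfl : a = 0 ∨ a = 1 := by omega
    all_goals obtain rfl | rfl : c = 0 ∨ c = 1 := by omega
    · simpa using hft
    · simpa using hgt
    · simpa using hgt.neg
    · simpa using hft
  · ext a c
    obtain rfl | rfl : a = 0 ∨ a = 1 := by omega
    all_goals obtain rfl | rfl : c = 0 ∨ c = 1 := by omega
    all_goals simp [rotBlock, hf1, hg1]

/-- The first-order coefficients `γ` of the first pair. -/
def gammaMat (i j : Fin 2) : ℝ :=
  (2 * Real.pi / b 0) ^ 2 *
    fderiv ℝ (fun P => jac hY P (some (0, i)) (some (0, j))) (scaledPt h (0, 2 * Real.pi / b 0))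
      (1, 0)

/-- The matrix `γ - (2π / (b_1 K)) h hᵀ` of the first pair. -/
def limitMat : Matrix (Fin 2) (Fin 2) ℝ := Matrix.of fun i j =>
  gammaMat hY h i j - 2 * Real.pi / b 0 / constK b h * (h (0, i) * h (0, j))

/-- The upper left block is the rotation block plus s² times a convergent matrix, and the correction
B D⁻¹ C is s² times (s⁻¹B) D⁻¹ (s⁻¹C). The limits of Ψ and T are joint in (s, τ), not just at fixed
multiples of s², and this is what allows roots to be excluded on a fixed neighbourhood of α. -/
theorem schur_expansion (hb_pos : ∀ i, 0 < b i) (hb : StrictAnti b)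
    (hne : ∃ k : HIdx n, k.1 ≠ 0 ∧ h k ≠ 0) :
    ∃ Ψ T : ℝ × ℝ → Matrix (Fin 2) (Fin 2) ℝ,
      Tendsto Ψ (nearFilter (2 * Real.pi / b 0)) (𝓝 1) ∧
      Tendsto T (nearFilter (2 * Real.pi / b 0)) (𝓝 (limitMat hY h)) ∧
      ∀ x : ℝ × ℝ, 0 < x.1 →
        (2 * Real.pi / b 0) • schurComp (splitMat (jac hY (scaledPt h x))) =
          (x.2 - 2 * Real.pi / b 0) • Ψ x + x.1 ^ 2 • T x := by
  have hb0 := hb_pos 0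
  have hK := constK_pos h hb_pos hb hne
  set α := 2 * Real.pi / b 0 with hα
  have hα0 : 0 < α := by positivity
  obtain ⟨Ψ, hΨ, hΨe⟩ := exists_rotBlock_factor hb0
  rw [← hα] at hΨ hΨe
  set M := fun x : ℝ × ℝ => splitMat (jac hY (scaledPt h x)) with hM
  set A2 : ℝ × ℝ → Matrix (Fin 2) (Fin 2) ℝ := fun x =>
    (x.1 ^ 2)⁻¹ • ((M x).toBlocks₁₁ - rotBlock (b 0) x.2) with hA2
  have hA2t : Tendsto A2 (nearFilter α) (𝓝 (Matrix.of fun i j => α *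
      fderiv ℝ (fun P => jac hY P (some (0, i)) (some (0, j))) (scaledPt h (0, α)) (1, 0))) := by
    refine tendsto_pi_nhds.2 fun a => tendsto_pi_nhds.2 fun c => ?_
    refine (tendsto_param_quotient h α (contDiffAt_jac_scaledPt hY h α (some (0, a))
      (some (0, c)))).congr fun x => ?_
    rw [jac_nil_first, div_eq_inv_mul]
    rfl
  have hDt : Tendsto (fun x => (M x).toBlocks₂₂⁻¹) (nearFilter α)
      (𝓝 (M (0, α)).toBlocks₂₂⁻¹) := by
    have h1 : Continuous fun Z : Matrix (Fin 2 ⊕ RestIdx n) (Fin 2 ⊕ RestIdx n) ℝ =>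
        Z.toBlocks₂₂ := continuous_id.matrix_submatrix _ _
    exact (continuousAt_matrix_inv (lower_block_det_ne_zero hY h hb_pos hb hne)).tendsto.comp
      ((h1.tendsto _).comp (tendsto_jac_near hY h α))
  have hB := tendsto_upper_block hY h hb_pos
  have hC := tendsto_lower_block hY h hb_pos
  rw [← hα] at hB hC
  have hprod : Continuous fun Z : Matrix (Fin 2) (RestIdx n) ℝ × Matrix (RestIdx n) (RestIdx n) ℝ ×
      Matrix (RestIdx n) (Fin 2) ℝ => Z.1 * Z.2.1 * Z.2.2 :=
    ((continuous_fst.matrix_mul (continuous_fst.comp continuous_snd)).matrix_mul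
      (continuous_snd.comp continuous_snd))
  have hBDC := (hprod.tendsto _).comp (hB.prodMk_nhds (hDt.prodMk_nhds hC))
  refine ⟨fun x => Ψ x.2, fun x => α • (A2 x - (x.1⁻¹ • (M x).toBlocks₁₂) * (M x).toBlocks₂₂⁻¹ *
    (x.1⁻¹ • (M x).toBlocks₂₁)), hΨ.comp tendsto_snd, ?_, fun x hx => ?_⟩
  · have h1 := (hA2t.sub hBDC).const_smul α
    refine h1.trans_eq ?_
    congr 1
    ext a c
    -- Only the zz entry of the inverse survives the two sums.
    have hsum : ((Matrix.of fun a o => if o = restNone then h (0, a) / α else 0 :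
          Matrix (Fin 2) (RestIdx n) ℝ) * (M (0, α)).toBlocks₂₂⁻¹ *
        (Matrix.of fun o a => if o = restNone then h (0, a) / α else 0 :
          Matrix (RestIdx n) (Fin 2) ℝ)) a c =
        h (0, a) / α * (M (0, α)).toBlocks₂₂⁻¹ restNone restNone * (h (0, c) / α) := by
      simp [Matrix.mul_apply]
    rw [lower_block_inv_none hY h hb_pos hb hne, ← hα] at hsum
    simp only [Matrix.smul_apply, Matrix.sub_apply, limitMat, gammaMat, Matrix.of_apply, smul_eq_mul]
    rw [hsum, ← hα]
    field_simp
  · have hx0 : x.1 ≠ 0 := hx.ne'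
    rw [schurComp]
    have h2 : (M x).toBlocks₁₁ = rotBlock (b 0) x.2 + x.1 ^ 2 • A2 x := by
      rw [hA2]
      simp only
      rw [smul_smul, mul_inv_cancel₀ (pow_ne_zero 2 hx0), one_smul]
      abel
    change α • ((M x).toBlocks₁₁ - (M x).toBlocks₁₂ * (M x).toBlocks₂₂⁻¹ * (M x).toBlocks₂₁) = _
    rw [h2, add_sub_assoc, smul_add, hΨe]
    congr 1
    rw [smul_comm (x.1 ^ 2) α, smul_sub (x.1 ^ 2)]
    congr 2
    simp only [Matrix.smul_mul, Matrix.mul_smul, smul_smul]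
    rw [show x.1 ^ 2 * (x.1⁻¹ * x.1⁻¹) = 1 by field_simp, one_smul]

/-- The correction term disappears because the lower left block of the Jacobian vanishes at s = 0,
and at a full period the momentum block of the first pair is the identity. -/
theorem schurMom_tendsto (hb_pos : ∀ i, 0 < b i) (hb : StrictAnti b)
    (hne : ∃ k : HIdx n, k.1 ≠ 0 ∧ h k ≠ 0) :
    Tendsto (fun x => schurMom (splitMat (momJac hY (scaledPt h x)))
      (splitMat (jac hY (scaledPt h x)))) (nearFilter (2 * Real.pi / b 0)) (𝓝 1) := by
  have hb0 := hb_pos 0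
  set α := 2 * Real.pi / b 0 with hα
  have hW : Tendsto (fun x => splitMat (momJac hY (scaledPt h x))) (nearFilter α)
      (𝓝 (splitMat (momJac hY (scaledPt h (0, α))))) := by
    have h1 : Continuous (splitMat (n := n)) := continuous_id.matrix_submatrix _ _
    exact (h1.tendsto _).comp ((continuousAt_momJac hY (scaledPt_zero_mem hY h α)).tendsto.comp
      (tendsto_scaledPt h α))
  have hM := tendsto_jac_near hY h α
  have c11 : Continuous fun Z : Matrix (Fin 2 ⊕ RestIdx n) (Fin 2 ⊕ RestIdx n) ℝ =>
      Z.toBlocks₁₁ := continuous_id.matrix_submatrix _ _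
  have c12 : Continuous fun Z : Matrix (Fin 2 ⊕ RestIdx n) (Fin 2 ⊕ RestIdx n) ℝ =>
      Z.toBlocks₁₂ := continuous_id.matrix_submatrix _ _
  have c21 : Continuous fun Z : Matrix (Fin 2 ⊕ RestIdx n) (Fin 2 ⊕ RestIdx n) ℝ =>
      Z.toBlocks₂₁ := continuous_id.matrix_submatrix _ _
  have c22 : Continuous fun Z : Matrix (Fin 2 ⊕ RestIdx n) (Fin 2 ⊕ RestIdx n) ℝ =>
      Z.toBlocks₂₂ := continuous_id.matrix_submatrix _ _
  have hDt := (continuousAt_matrix_inv (lower_block_det_ne_zero hY h hb_pos hb hne)).tendsto.comp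
      ((c22.tendsto _).comp hM)
  have hprod : Continuous fun Z : Matrix (Fin 2) (RestIdx n) ℝ × Matrix (RestIdx n) (RestIdx n) ℝ ×
      Matrix (RestIdx n) (Fin 2) ℝ => Z.1 * Z.2.1 * Z.2.2 :=
    ((continuous_fst.matrix_mul (continuous_fst.comp continuous_snd)).matrix_mul
      (continuous_snd.comp continuous_snd))
  have hBDC := (hprod.tendsto _).comp (((c12.tendsto _).comp hW).prodMk_nhds
    (hDt.prodMk_nhds ((c21.tendsto _).comp hM)))
  refine (((c11.tendsto _).comp hW).sub hBDC).trans_eq ?_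
  have h21 : (splitMat (jac hY (scaledPt h (0, α)))).toBlocks₂₁ = 0 := by
    ext o a
    change jac hY (scaledPt h (0, α)) o.1 (some (0, a)) = 0
    rw [scaledPt_zero]
    induction o using RestIdx.cases with
    | h0 => simp only [restNone]; rw [jac_nil_none_hor]; simp
    | h i hi c => exact jac_nil_hor_ne hY _ hi _ _
  have h11 : (splitMat (momJac hY (scaledPt h (0, α)))).toBlocks₁₁ = 1 := by
    ext a c
    change fderiv ℝ (endMom hY) (scaledPt h (0, α)) (0, EuclideanSpace.single (some (0, c)) 1)
      (EuclideanSpace.single (some (0, a)) 1) = _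
    rw [scaledPt_zero, fderiv_endMom_nil hY _ _ 0 (fun a => by simp) (by simp [hα]; field_simp)]
    simp [Matrix.one_apply]
  rw [h21, h11, Matrix.mul_zero, sub_zero]

end Expansion
end
end ContactSR

namespace ContactSR
noncomputable section

/-! ### Zeros of the determinant of a 2×2 pencil (τ − α)Ψ + s²T. -/

section Roots

theorem det_pencil (y δ : ℝ) (Ψ T : Matrix (Fin 2) (Fin 2) ℝ) :
    ((y + δ) • Ψ + T).det = Ψ.det * y ^ 2 +
      (Ψ 0 0 * (δ • Ψ + T) 1 1 + Ψ 1 1 * (δ • Ψ + T) 0 0 - Ψ 0 1 * (δ • Ψ + T) 1 0 -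
        Ψ 1 0 * (δ • Ψ + T) 0 1) * y + (δ • Ψ + T).det := by
  simp only [Matrix.det_fin_two, Matrix.add_apply, Matrix.smul_apply, smul_eq_mul]
  ring

/-- The blow-up of time around α + s²δ: in the variable y = (τ − α)/s² − δ the determinant is s⁴
times a quadratic whose coefficients converge. -/
theorem det_scaled_pencil {s τ α δ : ℝ} (hs : 0 < s) (Ψ T : Matrix (Fin 2) (Fin 2) ℝ) :
    ((τ - α) • Ψ + s ^ 2 • T).det = s ^ 4 * ((((τ - α) / s ^ 2 - δ) + δ) • Ψ + T).det := by
  have h : (τ - α) = s ^ 2 * (((τ - α) / s ^ 2 - δ) + δ) := by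
    field_simp; ring
  conv_lhs => rw [h]
  rw [mul_smul, ← smul_add, Matrix.det_smul, Fintype.card_fin]
  ring

variable {α : ℝ} {Ψ T : ℝ × ℝ → Matrix (Fin 2) (Fin 2) ℝ} {N : Matrix (Fin 2) (Fin 2) ℝ}

theorem pencil_coeff_tendsto (hΨ : Tendsto Ψ (nearFilter α) (𝓝 1))
    (hT : Tendsto T (nearFilter α) (𝓝 N)) (δ : ℝ) :
    Tendsto (fun x => (Ψ x).det) (nearFilter α) (𝓝 1) ∧
    Tendsto (fun x => Ψ x 0 0 * (δ • Ψ x + T x) 1 1 + Ψ x 1 1 * (δ • Ψ x + T x) 0 0 -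
      Ψ x 0 1 * (δ • Ψ x + T x) 1 0 - Ψ x 1 0 * (δ • Ψ x + T x) 0 1) (nearFilter α)
      (𝓝 (2 * δ + N.trace)) ∧
    Tendsto (fun x => (δ • Ψ x + T x).det) (nearFilter α) (𝓝 (δ ^ 2 + N.trace * δ + N.det)) := by
  have hdet : Continuous fun A : Matrix (Fin 2) (Fin 2) ℝ => A.det := continuous_id.matrix_det
  have he : ∀ {Φ : ℝ × ℝ → Matrix (Fin 2) (Fin 2) ℝ} {A}, Tendsto Φ (nearFilter α) (𝓝 A) →
      ∀ i j, Tendsto (fun x => Φ x i j) (nearFilter α) (𝓝 (A i j)) := fun hΦ i j =>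
    ((continuous_id.matrix_elem i j).tendsto _).comp hΦ
  have hE : Tendsto (fun x => δ • Ψ x + T x) (nearFilter α) (𝓝 (δ • 1 + N)) :=
    (hΨ.const_smul δ).add hT
  refine ⟨?_, ?_, ?_⟩
  · have := (hdet.tendsto _).comp hΨ
    rwa [Matrix.det_one] at this
  · have := ((((he hΨ 0 0).mul (he hE 1 1)).add ((he hΨ 1 1).mul (he hE 0 0))).sub
      ((he hΨ 0 1).mul (he hE 1 0))).sub ((he hΨ 1 0).mul (he hE 0 1))
    refine this.trans_eq ?_
    simp [Matrix.trace_fin_two]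
    ring_nf
  · have := (hdet.tendsto _).comp hE
    refine this.trans_eq ?_
    simp [Matrix.trace_fin_two, Matrix.det_fin_two]
    ring_nf

/-- No root below the smallest root of the limit polynomial. -/
theorem eventually_det_ne_zero_of_le (hΨ : Tendsto Ψ (nearFilter α) (𝓝 1))
    (hT : Tendsto T (nearFilter α) (𝓝 N)) {δ ε : ℝ} (h0 : δ ^ 2 + N.trace * δ + N.det = 0)
    (h1 : 2 * δ + N.trace ≤ 0) (hε : 0 < ε) :
    ∀ᶠ x in nearFilter α, x.2 ≤ α + x.1 ^ 2 * (δ - ε) →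
      ((x.2 - α) • Ψ x + x.1 ^ 2 • T x).det ≠ 0 := by
  obtain ⟨t1, t2, t3⟩ := pencil_coeff_tendsto hΨ hT δ
  rw [h0] at t3
  filter_upwards [eventually_pos_near α, t1.eventually (lt_mem_nhds (show (1 / 2 : ℝ) < 1 by norm_num)),
    t2.eventually (gt_mem_nhds (show 2 * δ + N.trace < ε / 8 by linarith)),
    t3.eventually (lt_mem_nhds (show -(ε ^ 2 / 8) < 0 by have := pow_pos hε 2; linarith))]
    with x hx e1 e2 e3 hle
  rw [det_scaled_pencil (δ := δ) hx, det_pencil]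
  refine mul_ne_zero (by positivity) (ne_of_gt ?_)
  have hy : (x.2 - α) / x.1 ^ 2 - δ ≤ -ε := by
    rw [sub_le_iff_le_add, div_le_iff₀ (by positivity)]
    linarith
  -- The estimate must hold for all y ≤ −ε: τ ranges over a fixed neighbourhood of α, so y is not
  -- bounded. The coefficient bounds give at least y²/2 + εy/8 − ε²/8, which is positive there.
  generalize (x.2 - α) / x.1 ^ 2 - δ = y at hy
  have f1 : 1 / 2 * y ^ 2 ≤ (Ψ x).det * y ^ 2 := by gcongr
  have f2 := mul_le_mul_of_nonpos_right e2.le (show y ≤ 0 by linarith)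
  nlinarith

/-- No root at all when the limit polynomial has negative discriminant. -/
theorem eventually_det_ne_zero_of_neg (hΨ : Tendsto Ψ (nearFilter α) (𝓝 1))
    (hT : Tendsto T (nearFilter α) (𝓝 N)) (h0 : N.trace ^ 2 < 4 * N.det) :
    ∀ᶠ x in nearFilter α, ((x.2 - α) • Ψ x + x.1 ^ 2 • T x).det ≠ 0 := by
  obtain ⟨t1, t2, t3⟩ := pencil_coeff_tendsto hΨ hT 0
  -- The discriminant of the perturbed quadratic tends to a negative number, so all real y are
  -- excluded at once.
  have t4 := (t2.pow 2).sub ((t1.const_mul 4).mul t3)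
  filter_upwards [eventually_pos_near α, t1.eventually (lt_mem_nhds zero_lt_one),
    t4.eventually (gt_mem_nhds (show (2 * 0 + N.trace) ^ 2 - 4 * 1 * (0 ^ 2 + N.trace * 0 + N.det) < 0
      by linarith))] with x hx e1 e2
  rw [det_scaled_pencil (δ := 0) hx, det_pencil]
  refine mul_ne_zero (by positivity) (ne_of_gt ?_)
  generalize (x.2 - α) / x.1 ^ 2 - 0 = y
  revert e2
  generalize ((0 : ℝ) • Ψ x + T x).det = d
  generalize Ψ x 0 0 * _ + _ - _ - _ = m
  intro e2
  nlinarith [sq_nonneg (2 * (Ψ x).det * y + m)]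

theorem tendsto_window (α c : ℝ) :
    Tendsto (fun s : ℝ => (s, α + s ^ 2 * c)) (𝓝[>] 0) (nearFilter α) := by
  refine tendsto_id.prodMk ?_
  have : Continuous fun s : ℝ => α + s ^ 2 * c := by fun_prop
  exact (by simpa using this.tendsto 0 : Tendsto _ (𝓝 (0 : ℝ)) (𝓝 α)).mono_left nhdsWithin_le_nhds

/-- The windows shrink to α, so they end up in the fixed neighbourhood where the property holds. -/
theorem eventually_window {p : ℝ × ℝ → Prop} (hp : ∀ᶠ x in nearFilter α, p x) (c c' : ℝ) :
    ∀ᶠ s in 𝓝[>] (0 : ℝ), ∀ τ ∈ Icc (α + s ^ 2 * c) (α + s ^ 2 * c'), p (s, τ) := by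
  obtain ⟨pa, ha, pb, hpb, hp⟩ := Filter.eventually_prod_iff.1 hp
  obtain ⟨r, hr, hball⟩ := Metric.eventually_nhds_iff_ball.1 hpb
  have h1 := (tendsto_snd (f := 𝓝[>] (0 : ℝ))).comp (tendsto_window α c)
  have h2 := (tendsto_snd (f := 𝓝[>] (0 : ℝ))).comp (tendsto_window α c')
  filter_upwards [ha, h1.eventually (Metric.ball_mem_nhds α hr),
    h2.eventually (Metric.ball_mem_nhds α hr)] with s hs b1 b2 τ hτ
  refine hp hs (hball τ ?_)
  rw [← Metric.mem_ball, Real.ball_eq_Ioo] at b1 b2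
  rw [Real.ball_eq_Ioo]
  exact ⟨b1.1.trans_le hτ.1, hτ.2.trans_lt b2.2⟩

theorem tendsto_window_pencil (hΨ : Tendsto Ψ (nearFilter α) (𝓝 1))
    (hT : Tendsto T (nearFilter α) (𝓝 N)) {Z : ℝ × ℝ → Matrix (Fin 2) (Fin 2) ℝ}
    (hZ : ∀ x : ℝ × ℝ, 0 < x.1 → Z x = (x.2 - α) • Ψ x + x.1 ^ 2 • T x) (c : ℝ) :
    Tendsto (fun s : ℝ => (s ^ 2)⁻¹ • Z (s, α + s ^ 2 * c)) (𝓝[>] 0) (𝓝 (c • 1 + N)) := by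
  have h1 := ((hΨ.const_smul c).add hT).comp (tendsto_window α c)
  refine h1.congr' ?_
  filter_upwards [self_mem_nhdsWithin] with s hs
  have hs0 : s ≠ 0 := ne_of_gt hs
  rw [hZ (s, α + s ^ 2 * c) hs]
  simp only [Function.comp_apply, add_sub_cancel_left]
  rw [mul_smul, ← smul_add, smul_smul, inv_mul_cancel₀ (pow_ne_zero 2 hs0), one_smul]

variable {Z Q : ℝ × ℝ → Matrix (Fin 2) (Fin 2) ℝ}

/-- A simple root persists. -/
theorem eventually_exists_root_of_simple (hΨ : Tendsto Ψ (nearFilter α) (𝓝 1))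
    (hT : Tendsto T (nearFilter α) (𝓝 N))
    (hZ : ∀ x : ℝ × ℝ, 0 < x.1 → Z x = (x.2 - α) • Ψ x + x.1 ^ 2 • T x)
    (hc : ∀ᶠ x in nearFilter α, ContinuousAt (fun τ => Z (x.1, τ)) x.2)
    {c c' : ℝ} (hcc : c ≤ c') (h0 : 0 < c ^ 2 + N.trace * c + N.det)
    (h1 : c' ^ 2 + N.trace * c' + N.det < 0) :
    ∀ᶠ s in 𝓝[>] (0 : ℝ), ∃ τ ∈ Icc (α + s ^ 2 * c) (α + s ^ 2 * c'), (Z (s, τ)).det = 0 := by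
  have hdet : Continuous fun A : Matrix (Fin 2) (Fin 2) ℝ => A.det := continuous_id.matrix_det
  have hd : ∀ c : ℝ, Tendsto (fun s : ℝ => ((s ^ 2)⁻¹ • Z (s, α + s ^ 2 * c)).det) (𝓝[>] 0)
      (𝓝 (c ^ 2 + N.trace * c + N.det)) := fun c => by
    refine ((hdet.tendsto _).comp (tendsto_window_pencil hΨ hT hZ c)).trans_eq ?_
    simp [Matrix.trace_fin_two, Matrix.det_fin_two]
    ring_nf
  filter_upwards [(hd c).eventually (lt_mem_nhds h0), (hd c').eventually (gt_mem_nhds h1),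
    eventually_window hc c c', self_mem_nhdsWithin] with s e0 e1 hcs hs
  rw [Matrix.det_smul, Fintype.card_fin] at e0 e1
  have hs' : (0 : ℝ) < s := hs
  have hpos : 0 < ((s ^ 2)⁻¹) ^ 2 := by positivity
  have hle : α + s ^ 2 * c ≤ α + s ^ 2 * c' := by gcongr
  have hcont : ContinuousOn (fun τ => (Z (s, τ)).det) (Icc (α + s ^ 2 * c) (α + s ^ 2 * c')) :=
    fun τ hτ => (hdet.continuousAt.comp (hcs τ hτ)).continuousWithinAt
  have hmem : (0 : ℝ) ∈ Icc ((Z (s, α + s ^ 2 * c')).det) ((Z (s, α + s ^ 2 * c)).det) :=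
    ⟨(neg_of_mul_neg_right e1 hpos.le).le, (pos_of_mul_pos_right e0 hpos.le).le⟩
  obtain ⟨τ, hτ, h⟩ := intermediate_value_Icc' hle hcont hmem
  exact ⟨τ, hτ, h⟩

/-- A double root persists, for the pencils which are symmetric up to a factor close to `1`. -/
theorem eventually_exists_root_of_double (hΨ : Tendsto Ψ (nearFilter α) (𝓝 1))
    (hT : Tendsto T (nearFilter α) (𝓝 N))
    (hZ : ∀ x : ℝ × ℝ, 0 < x.1 → Z x = (x.2 - α) • Ψ x + x.1 ^ 2 • T x)
    (hc : ∀ᶠ x in nearFilter α, ContinuousAt (fun τ => Z (x.1, τ)) x.2)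
    (hQ : Tendsto Q (nearFilter α) (𝓝 1))
    (hQc : ∀ᶠ x in nearFilter α, ContinuousAt (fun τ => Q (x.1, τ)) x.2)
    (hsymm : ∀ᶠ x in nearFilter α, ((Q x).transpose * Z x).IsSymm)
    {δ ε : ℝ} (htr : N.trace = -2 * δ) (hdt : N.det = δ ^ 2) (hε : 0 < ε) :
    ∀ᶠ s in 𝓝[>] (0 : ℝ), ∃ τ ∈ Icc (α + s ^ 2 * (δ - ε)) (α + s ^ 2 * (δ + ε)),
      (Z (s, τ)).det = 0 := by
  have hdet : Continuous fun A : Matrix (Fin 2) (Fin 2) ℝ => A.det := continuous_id.matrix_det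
  have htrc : Continuous fun A : Matrix (Fin 2) (Fin 2) ℝ => A.trace := continuous_id.matrix_trace
  have hmul : Continuous fun A : Matrix (Fin 2) (Fin 2) ℝ × Matrix (Fin 2) (Fin 2) ℝ =>
      A.1.transpose * A.2 := (continuous_fst.matrix_transpose).matrix_mul continuous_snd
  set L : ℝ × ℝ → Matrix (Fin 2) (Fin 2) ℝ := fun x => (Q x).transpose * Z x with hL
  have hLt : ∀ c : ℝ, Tendsto (fun s : ℝ => (s ^ 2)⁻¹ • L (s, α + s ^ 2 * c)) (𝓝[>] 0)
      (𝓝 (c • 1 + N)) := fun c => by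
    have h1 := (hmul.tendsto _).comp ((hQ.comp (tendsto_window α c)).prodMk_nhds
      (tendsto_window_pencil hΨ hT hZ c))
    simp only [Matrix.transpose_one, Matrix.one_mul] at h1
    refine h1.congr fun s => ?_
    simp only [Function.comp_apply, hL, Matrix.mul_smul]
  -- The factor Q tends to 1, so the symmetry of the products passes to the limit of Z/s².
  have hN : N.IsSymm := by
    have h1 := hLt 0
    rw [zero_smul, zero_add] at h1
    have h2 : Continuous fun A : Matrix (Fin 2) (Fin 2) ℝ => A.transpose :=
      continuous_id.matrix_transpose
    refine tendsto_nhds_unique ((h2.tendsto _).comp h1) (h1.congr' ?_)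
    filter_upwards [(tendsto_window α 0).eventually hsymm] with s hs
    rw [Function.comp_apply, Matrix.transpose_smul]
    congr 1
    exact hs.symm
  -- A symmetric matrix with a double eigenvalue is scalar.
  have hN1 : N = -δ • (1 : Matrix (Fin 2) (Fin 2) ℝ) := by
    have h01 : N 1 0 = N 0 1 := hN.apply 0 1
    rw [Matrix.trace_fin_two] at htr
    rw [Matrix.det_fin_two, h01] at hdt
    have h2 : (N 0 0 + δ) ^ 2 + N 0 1 ^ 2 = 0 := by
      have : N 1 1 = -2 * δ - N 0 0 := by linarith
      rw [this] at hdt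
      linarith
    have h3 : N 0 0 = -δ := by nlinarith [sq_nonneg (N 0 0 + δ), sq_nonneg (N 0 1)]
    have h4 : N 0 1 = 0 := by nlinarith [sq_nonneg (N 0 0 + δ), sq_nonneg (N 0 1)]
    have h5 : N 1 1 = -δ := by linarith
    ext i j
    obtain rfl | rfl : i = 0 ∨ i = 1 := by omega
    all_goals obtain rfl | rfl : j = 0 ∨ j = 1 := by omega
    all_goals simp [h3, h4, h5, h01]
  have htrace : ∀ c : ℝ, Tendsto (fun s : ℝ => ((s ^ 2)⁻¹ • L (s, α + s ^ 2 * c)).trace) (𝓝[>] 0)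
      (𝓝 (2 * (c - δ))) := fun c => by
    refine ((htrc.tendsto _).comp (hLt c)).trans_eq ?_
    rw [hN1]
    simp
    ring_nf
  have hdett : Tendsto (fun s : ℝ => ((s ^ 2)⁻¹ • L (s, α + s ^ 2 * (δ + ε))).det) (𝓝[>] 0)
      (𝓝 (ε ^ 2)) := by
    refine ((hdet.tendsto _).comp (hLt (δ + ε))).trans_eq ?_
    rw [hN1]
    simp [Matrix.det_fin_two]
    ring_nf
  have hQdet : ∀ᶠ x in nearFilter α, (Q x).det ≠ 0 := by
    have := (hdet.tendsto _).comp hQ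
    rw [Matrix.det_one] at this
    exact this.eventually_ne one_ne_zero
  filter_upwards [(htrace (δ - ε)).eventually (gt_mem_nhds (show 2 * (δ - ε - δ) < 0 by linarith)),
    (htrace (δ + ε)).eventually (lt_mem_nhds (show 0 < 2 * (δ + ε - δ) by linarith)),
    hdett.eventually (lt_mem_nhds (pow_pos hε 2)),
    eventually_window (hc.and (hQc.and (hsymm.and hQdet))) (δ - ε) (δ + ε), self_mem_nhdsWithin]
    with s e0 e1 e2 hw hs
  have hs' : (0 : ℝ) < s := hs
  have hpos : 0 < (s ^ 2)⁻¹ := by positivity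
  rw [Matrix.trace_smul, smul_eq_mul] at e0 e1
  rw [Matrix.det_smul, Fintype.card_fin] at e2
  have hle : α + s ^ 2 * (δ - ε) ≤ α + s ^ 2 * (δ + ε) := by gcongr; linarith
  have hLc : ContinuousOn (fun τ => L (s, τ)) (Icc (α + s ^ 2 * (δ - ε)) (α + s ^ 2 * (δ + ε))) :=
    fun τ hτ => (hmul.continuousAt.comp ((hw τ hτ).2.1.prodMk (hw τ hτ).1)).continuousWithinAt
  -- Unlike the determinant, the trace does change sign across the window, from about −2ε to about
  -- 2ε after division by s².
  obtain ⟨τ₀, hτ₀, h3⟩ := intermediate_value_Icc hle (htrc.comp_continuousOn hLc)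
    (show (0 : ℝ) ∈ Icc _ _ from ⟨(neg_of_mul_neg_right e0 hpos.le).le,
      (pos_of_mul_pos_right e1 hpos.le).le⟩)
  -- A traceless symmetric matrix has determinant −(a² + b²). The determinant is positive at the
  -- right end of the window, so it vanishes in between.
  have hneg : (L (s, τ₀)).det ≤ 0 := by
    have h4 : (L (s, τ₀)) 1 0 = (L (s, τ₀)) 0 1 := ((hw τ₀ hτ₀).2.2.1).apply 0 1
    simp only [Function.comp_apply, Matrix.trace_fin_two] at h3
    rw [Matrix.det_fin_two, h4]
    have : L (s, τ₀) 1 1 = -L (s, τ₀) 0 0 := by linarith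
    rw [this]
    nlinarith [sq_nonneg (L (s, τ₀) 0 0), sq_nonneg (L (s, τ₀) 0 1)]
  have hsub : Icc τ₀ (α + s ^ 2 * (δ + ε)) ⊆ Icc (α + s ^ 2 * (δ - ε)) (α + s ^ 2 * (δ + ε)) :=
    Icc_subset_Icc_left hτ₀.1
  obtain ⟨τ, hτ, h5⟩ := intermediate_value_Icc hτ₀.2 (hdet.comp_continuousOn (hLc.mono hsub))
    (show (0 : ℝ) ∈ Icc _ _ from ⟨hneg, (pos_of_mul_pos_right e2 (by positivity)).le⟩)
  refine ⟨τ, hsub hτ, ?_⟩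
  simp only [Function.comp_apply, hL, Matrix.det_mul, Matrix.det_transpose] at h5
  exact (mul_eq_zero.1 h5).resolve_left (hw τ (hsub hτ)).2.2.2

end Roots

/-! ### First zero of the Jacobian determinant. -/

section ConjugateRoots

variable {n : ℕ} [NeZero n] {b : Fin n → ℝ} {Y : HIdx n → ℝ × Coord n → Coord n}
  (hY : IsNilpotentDeformation b Y) (h : HIdx n → ℝ)

theorem eventually_regular_near (hb_pos : ∀ i, 0 < b i) (hb : StrictAnti b)
    (hne : ∃ k : HIdx n, k.1 ≠ 0 ∧ h k ≠ 0) :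
    ∀ᶠ x in nearFilter (2 * Real.pi / b 0), scaledPt h x ∈ endDomain hY ∧
      (splitMat (jac hY (scaledPt h x))).toBlocks₂₂.det ≠ 0 := by
  have h1 : Continuous fun Z : Matrix (Fin 2 ⊕ RestIdx n) (Fin 2 ⊕ RestIdx n) ℝ =>
      Z.toBlocks₂₂.det := (continuous_id.matrix_submatrix _ _).matrix_det
  exact ((tendsto_scaledPt h _).eventually
    ((isOpen_endDomain hY).mem_nhds (scaledPt_zero_mem hY h _))).and
    (((h1.tendsto _).comp (tendsto_jac_near hY h _)).eventually_ne
      (lower_block_det_ne_zero hY h hb_pos hb hne))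

theorem continuous_toBlocks {m k : Type*} :
    Continuous (Matrix.toBlocks₁₁ : Matrix (m ⊕ k) (m ⊕ k) ℝ → _) ∧
    Continuous (Matrix.toBlocks₁₂ : Matrix (m ⊕ k) (m ⊕ k) ℝ → _) ∧
    Continuous (Matrix.toBlocks₂₁ : Matrix (m ⊕ k) (m ⊕ k) ℝ → _) ∧
    Continuous (Matrix.toBlocks₂₂ : Matrix (m ⊕ k) (m ⊕ k) ℝ → _) :=
  ⟨continuous_id.matrix_submatrix _ _, continuous_id.matrix_submatrix _ _,
    continuous_id.matrix_submatrix _ _, continuous_id.matrix_submatrix _ _⟩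

theorem continuousAt_schurMom {m k : Type*} [Fintype k] [DecidableEq k]
    {F G : ℝ → Matrix (m ⊕ k) (m ⊕ k) ℝ} {t : ℝ} (hF : ContinuousAt F t) (hG : ContinuousAt G t)
    (hd : (G t).toBlocks₂₂.det ≠ 0) : ContinuousAt (fun τ => schurMom (F τ) (G τ)) t := by
  obtain ⟨c11, c12, c21, c22⟩ := continuous_toBlocks (m := m) (k := k)
  have h11 : ContinuousAt (fun τ => (F τ).toBlocks₁₁) t := c11.continuousAt.comp hF
  have h12 : ContinuousAt (fun τ => (F τ).toBlocks₁₂) t := c12.continuousAt.comp hF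
  have h21 : ContinuousAt (fun τ => (G τ).toBlocks₂₁) t := c21.continuousAt.comp hG
  have h22 : ContinuousAt (fun τ => (G τ).toBlocks₂₂) t := c22.continuousAt.comp hG
  have hD : ContinuousAt (fun τ => (G τ).toBlocks₂₂⁻¹) t :=
    ContinuousAt.comp (g := fun A : Matrix k k ℝ => A⁻¹) (f := fun τ => (G τ).toBlocks₂₂)
      (continuousAt_matrix_inv hd) h22
  have hprod : Continuous fun Z : Matrix m k ℝ × Matrix k k ℝ × Matrix k m ℝ =>
      Z.1 * Z.2.1 * Z.2.2 :=
    ((continuous_fst.matrix_mul (continuous_fst.comp continuous_snd)).matrix_mul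
      (continuous_snd.comp continuous_snd))
  have hp : ContinuousAt (fun τ => ((F τ).toBlocks₁₂, (G τ).toBlocks₂₂⁻¹, (G τ).toBlocks₂₁)) t :=
    h12.prodMk (hD.prodMk h21)
  have h3 : ContinuousAt (fun τ => (F τ).toBlocks₁₂ * (G τ).toBlocks₂₂⁻¹ * (G τ).toBlocks₂₁) t :=
    ContinuousAt.comp (f := fun τ => ((F τ).toBlocks₁₂, (G τ).toBlocks₂₂⁻¹, (G τ).toBlocks₂₁))
      hprod.continuousAt hp
  exact h11.sub h3

theorem continuousAt_schur {x : ℝ × ℝ} (hx : scaledPt h x ∈ endDomain hY)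
    (hd : (splitMat (jac hY (scaledPt h x))).toBlocks₂₂.det ≠ 0) :
    ContinuousAt (fun τ => schurComp (splitMat (jac hY (scaledPt h (x.1, τ))))) x.2 ∧
    ContinuousAt (fun τ => schurMom (splitMat (momJac hY (scaledPt h (x.1, τ))))
      (splitMat (jac hY (scaledPt h (x.1, τ))))) x.2 := by
  have hs : Continuous (splitMat (n := n)) := continuous_id.matrix_submatrix _ _
  have hP : ContinuousAt (fun τ => scaledPt h (x.1, τ)) x.2 :=
    ((continuous_scaledPt h).comp (by fun_prop : Continuous fun τ : ℝ => (x.1, τ))).continuousAt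
  have hM : ContinuousAt (fun τ => splitMat (jac hY (scaledPt h (x.1, τ)))) x.2 :=
    hs.continuousAt.comp (ContinuousAt.comp (f := fun τ => scaledPt h (x.1, τ))
      (continuousAt_jac hY hx) hP)
  have hW : ContinuousAt (fun τ => splitMat (momJac hY (scaledPt h (x.1, τ)))) x.2 :=
    hs.continuousAt.comp (ContinuousAt.comp (f := fun τ => scaledPt h (x.1, τ))
      (continuousAt_momJac hY hx) hP)
  exact ⟨continuousAt_schurMom hM hM hd, continuousAt_schurMom hW hM hd⟩

/-- A property which holds near the critical time holds on a uniform interval of times. -/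
theorem exists_uniform_of_eventually_near {p : ℝ × ℝ → Prop} {α : ℝ}
    (hp : ∀ᶠ x in nearFilter α, p x) :
    ∃ r > 0, ∀ᶠ s in 𝓝[>] (0 : ℝ), ∀ τ, |τ - α| < r → p (s, τ) := by
  obtain ⟨pa, ha, pb, hpb, hp⟩ := Filter.eventually_prod_iff.1 hp
  obtain ⟨r, hr, hball⟩ := Metric.eventually_nhds_iff_ball.1 hpb
  refine ⟨r, hr, ha.mono fun s hs τ hτ => hp hs (hball τ ?_)⟩
  rwa [Metric.mem_ball, Real.dist_eq]

/-- The case of nonnegative discriminant: the first root. -/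
theorem first_root_of_nonneg (hb_pos : ∀ i, 0 < b i) (hb : StrictAnti b)
    (hne : ∃ k : HIdx n, k.1 ≠ 0 ∧ h k ≠ 0) {δ δ' : ℝ} (hle : δ ≤ δ')
    (htr : (limitMat hY h).trace = -(δ + δ')) (hdt : (limitMat hY h).det = δ * δ')
    {ε : ℝ} (hε : 0 < ε) :
    ∀ᶠ s in 𝓝[>] (0 : ℝ),
      (∀ τ ∈ Icc 0 (2 * Real.pi / b 0 + s ^ 2 * (δ - ε)), (jac hY (scaledPt h (s, τ))).det ≠ 0) ∧
      ∃ τ ∈ Icc (2 * Real.pi / b 0 + s ^ 2 * (δ - ε)) (2 * Real.pi / b 0 + s ^ 2 * (δ + ε)),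
        (jac hY (scaledPt h (s, τ))).det = 0 := by
  have hb0 := hb_pos 0
  obtain ⟨Ψ, T, hΨ, hT, hZ⟩ := schur_expansion hY h hb_pos hb hne
  have hreg := eventually_regular_near hY h hb_pos hb hne
  have hQ := schurMom_tendsto hY h hb_pos hb hne
  set α := 2 * Real.pi / b 0 with hα
  have hα0 : 0 < α := by positivity
  set N := limitMat hY h with hN
  set Z : ℝ × ℝ → Matrix (Fin 2) (Fin 2) ℝ := fun x =>
    α • schurComp (splitMat (jac hY (scaledPt h x))) with hZd
  have hdet : ∀ x, (splitMat (jac hY (scaledPt h x))).toBlocks₂₂.det ≠ 0 →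
      ((jac hY (scaledPt h x)).det = 0 ↔ (Z x).det = 0) := fun x hx => by
    rw [← det_splitMat, det_eq_mul_schurComp _ hx, hZd]
    simp only [Matrix.det_smul]
    simp [hx, hα0.ne']
  have hZc : ∀ᶠ x in nearFilter α, ContinuousAt (fun τ => Z (x.1, τ)) x.2 :=
    hreg.mono fun x hx => (continuousAt_schur hY h hx.1 hx.2).1.const_smul α
  have hQc : ∀ᶠ x in nearFilter α, ContinuousAt (fun τ =>
      schurMom (splitMat (momJac hY (scaledPt h (x.1, τ))))
        (splitMat (jac hY (scaledPt h (x.1, τ))))) x.2 :=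
    hreg.mono fun x hx => (continuousAt_schur hY h hx.1 hx.2).2
  have hsymm : ∀ᶠ x in nearFilter α, ((schurMom (splitMat (momJac hY (scaledPt h x)))
      (splitMat (jac hY (scaledPt h x)))).transpose * Z x).IsSymm := by
    filter_upwards [hreg] with x hx
    have h1 : ((splitMat (momJac hY (scaledPt h x))).transpose *
        splitMat (jac hY (scaledPt h x))).IsSymm := by
      have h2 := momJac_transpose_mul_jac_symm hY hx.1
      have h3 : (splitMat (momJac hY (scaledPt h x))).transpose *
        splitMat (jac hY (scaledPt h x)) =
          splitMat ((momJac hY (scaledPt h x)).transpose * jac hY (scaledPt h x)) := by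
        simp only [splitMat, Matrix.transpose_submatrix]
        exact Matrix.submatrix_mul_equiv _ _ _ _ _
      rw [h3]
      exact h2.submatrix _
    rw [hZd]
    simp only [Matrix.mul_smul]
    exact (schurMom_transpose_mul_schurComp _ _ hx.2 h1).smul α
  have hroot0 : δ ^ 2 + N.trace * δ + N.det = 0 := by rw [htr, hdt]; ring
  have hbelow := eventually_det_ne_zero_of_le hΨ hT hroot0 (by rw [htr]; linarith) hε
  -- The radius `r` does not depend on s. Times up to α − r/2 are handled by compactness for the
  -- nilpotent problem, and the remaining ones by the pencil.
  obtain ⟨r, hr, hnear⟩ := exists_uniform_of_eventually_near (hbelow.and hreg)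
  have hearly := (eventually_jac_det_ne_zero hY hb_pos hb hne (T := α - r / 2)
    (by rw [← hα]; linarith)).filter_mono (nhdsWithin_le_nhds (s := Ioi (0 : ℝ)))
  have hsmall : ∀ᶠ s in 𝓝[>] (0 : ℝ), α + s ^ 2 * (δ - ε) < α + r :=
    ((tendsto_snd (f := 𝓝[>] (0 : ℝ))).comp (tendsto_window α (δ - ε))).eventually
      (gt_mem_nhds (by linarith))
  have hroot : ∀ᶠ s in 𝓝[>] (0 : ℝ), ∃ τ ∈ Icc (α + s ^ 2 * (δ - ε)) (α + s ^ 2 * (δ + ε)),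
      (Z (s, τ)).det = 0 := by
    rcases hle.eq_or_lt with heq | hlt
    · subst heq
      exact eventually_exists_root_of_double hΨ hT hZ hZc hQ hQc hsymm (by rw [htr]; ring)
        (by rw [hdt]; ring) hε
    -- Staying within half the gap keeps δ + e strictly between the two roots, where the limit
    -- polynomial is negative.
    · set e := min ε ((δ' - δ) / 2) with he
      have he0 : 0 < e := lt_min hε (by linarith)
      have he1 : e ≤ ε := min_le_left _ _
      have he2 : e ≤ (δ' - δ) / 2 := min_le_right _ _
      have h1 := eventually_exists_root_of_simple hΨ hT hZ hZc (c := δ - e) (c' := δ + e)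
        (by linarith) (by rw [htr, hdt]; nlinarith) (by rw [htr, hdt]; nlinarith)
      refine h1.mono fun s ⟨τ, hτ, h2⟩ => ⟨τ, Icc_subset_Icc ?_ ?_ hτ, h2⟩
      · gcongr
      · gcongr
  filter_upwards [hnear, hearly, hsmall, hroot,
    eventually_window hreg (δ - ε) (δ + ε), self_mem_nhdsWithin] with s h1 h2 h3 h4 h5 hs
  constructor
  · intro τ hτ
    rcases le_or_gt τ (α - r / 2) with hc | hc
    · exact h2 τ ⟨hτ.1, hc⟩
    · have h6 := h1 τ (abs_lt.2 ⟨by linarith, by linarith [hτ.2]⟩)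
      rw [ne_eq, hdet _ h6.2.2]
      have h7 : Z (s, τ) = (τ - α) • Ψ (s, τ) + s ^ 2 • T (s, τ) := hZ (s, τ) hs
      rw [h7]
      exact h6.1 hτ.2
  · obtain ⟨τ, hτ, h6⟩ := h4
    exact ⟨τ, hτ, (hdet _ (h5 τ hτ).2).2 h6⟩

/-- The case of negative discriminant: no root up to some time after the critical one. -/
theorem no_root_of_neg (hb_pos : ∀ i, 0 < b i) (hb : StrictAnti b)
    (hne : ∃ k : HIdx n, k.1 ≠ 0 ∧ h k ≠ 0)
    (hD : (limitMat hY h).trace ^ 2 < 4 * (limitMat hY h).det) :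
    ∃ r > 0, ∀ᶠ s in 𝓝[>] (0 : ℝ), ∀ τ ∈ Icc 0 (2 * Real.pi / b 0 + r),
      (jac hY (scaledPt h (s, τ))).det ≠ 0 := by
  have hb0 := hb_pos 0
  obtain ⟨Ψ, T, hΨ, hT, hZ⟩ := schur_expansion hY h hb_pos hb hne
  have hreg := eventually_regular_near hY h hb_pos hb hne
  set α := 2 * Real.pi / b 0 with hα
  have hα0 : 0 < α := by positivity
  obtain ⟨r, hr, hnear⟩ := exists_uniform_of_eventually_near
    ((eventually_det_ne_zero_of_neg hΨ hT hD).and hreg)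
  have hearly := (eventually_jac_det_ne_zero hY hb_pos hb hne (T := α - r / 2)
    (by rw [← hα]; linarith)).filter_mono (nhdsWithin_le_nhds (s := Ioi (0 : ℝ)))
  refine ⟨r / 2, half_pos hr, ?_⟩
  filter_upwards [hnear, hearly, self_mem_nhdsWithin] with s h1 h2 hs τ hτ
  rcases le_or_gt τ (α - r / 2) with hc | hc
  · exact h2 τ ⟨hτ.1, hc⟩
  · have h6 := h1 τ (abs_lt.2 ⟨by linarith, by linarith [hτ.2]⟩)
    rw [← det_splitMat, det_eq_mul_schurComp _ h6.2.2]
    refine mul_ne_zero h6.2.2 fun h0 => h6.1 ?_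
    have h7 := hZ (s, τ) hs
    simp only at h7 ⊢
    rw [← h7, Matrix.det_smul, h0, mul_zero]

end ConjugateRoots
end
end ContactSR

namespace ContactSR
noncomputable section

set_option linter.unusedSectionVars false

/-! ### Changes of charts and vector fields in coordinates. -/

section Charts

variable {n : ℕ} {M : Type*} [TopologicalSpace M] [ChartedSpace (Coord n) M]
  [IsManifold 𝓘(ℝ, Coord n) ∞ M]
  {φ ψ : OpenPartialHomeomorph M (Coord n)}

theorem mdifferentiable_of_mem_maximalAtlas (hψ : ψ ∈ IsManifold.maximalAtlas 𝓘(ℝ, Coord n) ∞ M) :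
    ψ.MDifferentiable 𝓘(ℝ, Coord n) 𝓘(ℝ, Coord n) :=
  ⟨(contMDiffOn_of_mem_maximalAtlas hψ).mdifferentiableOn (by simp),
    (contMDiffOn_symm_of_mem_maximalAtlas hψ).mdifferentiableOn (by simp)⟩

theorem chartSymmDiff_comp_chartDiff (hψ : ψ ∈ IsManifold.maximalAtlas 𝓘(ℝ, Coord n) ∞ M) {q : M}
    (hq : q ∈ ψ.source) :
    (chartSymmDiff ψ (ψ q)).comp (chartDiff ψ q) = ContinuousLinearMap.id ℝ (Coord n) :=
  (mdifferentiable_of_mem_maximalAtlas hψ).symm_comp_deriv hq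

theorem chartDiff_comp_chartSymmDiff (hψ : ψ ∈ IsManifold.maximalAtlas 𝓘(ℝ, Coord n) ∞ M)
    {y : Coord n} (hy : y ∈ ψ.target) :
    (chartDiff ψ (ψ.symm y)).comp (chartSymmDiff ψ y) = ContinuousLinearMap.id ℝ (Coord n) :=
  (mdifferentiable_of_mem_maximalAtlas hψ).comp_symm_deriv hy

theorem chartSymmDiff_inCoord (hψ : ψ ∈ IsManifold.maximalAtlas 𝓘(ℝ, Coord n) ∞ M)
    (X : ∀ q : M, TangentSpace 𝓘(ℝ, Coord n) q) {y : Coord n} (hy : y ∈ ψ.target) :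
    chartSymmDiff ψ y (inCoord ψ X y) = X (ψ.symm y) := by
  have h := chartSymmDiff_comp_chartDiff hψ (ψ.map_target hy)
  rw [ψ.right_inv hy] at h
  exact DFunLike.congr_fun h (X (ψ.symm y))

/-- The derivative of a change of coordinates. -/
theorem hasFDerivAt_transition (hφ : φ ∈ IsManifold.maximalAtlas 𝓘(ℝ, Coord n) ∞ M)
    (hψ : ψ ∈ IsManifold.maximalAtlas 𝓘(ℝ, Coord n) ∞ M) {y : Coord n} (hy : y ∈ φ.target)
    (hy' : φ.symm y ∈ ψ.source) :
    HasFDerivAt (fun y => ψ (φ.symm y)) ((chartDiff ψ (φ.symm y)).comp (chartSymmDiff φ y)) y := by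
  have h1 := ((mdifferentiable_of_mem_maximalAtlas hψ).mdifferentiableAt hy').hasMFDerivAt
  have h2 := ((mdifferentiable_of_mem_maximalAtlas hφ).mdifferentiableAt_symm hy).hasMFDerivAt
  exact (h1.comp y h2).hasFDerivAt

theorem contDiffAt_transition (hφ : φ ∈ IsManifold.maximalAtlas 𝓘(ℝ, Coord n) ∞ M)
    (hψ : ψ ∈ IsManifold.maximalAtlas 𝓘(ℝ, Coord n) ∞ M) {y : Coord n} (hy : y ∈ φ.target)
    (hy' : φ.symm y ∈ ψ.source) : ContDiffAt ℝ ∞ (fun y => ψ (φ.symm y)) y := by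
  have h1 := (contMDiffOn_of_mem_maximalAtlas hψ).contMDiffAt (ψ.open_source.mem_nhds hy')
  have h2 := (contMDiffOn_symm_of_mem_maximalAtlas hφ).contMDiffAt (φ.open_target.mem_nhds hy)
  exact (h1.comp y h2).contDiffAt

/-- A vector field in two charts. -/
theorem inCoord_transition (hφ : φ ∈ IsManifold.maximalAtlas 𝓘(ℝ, Coord n) ∞ M)
    (hψ : ψ ∈ IsManifold.maximalAtlas 𝓘(ℝ, Coord n) ∞ M)
    (X : ∀ q : M, TangentSpace 𝓘(ℝ, Coord n) q) {y : Coord n} (hy : y ∈ φ.target)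
    (hy' : φ.symm y ∈ ψ.source) :
    inCoord ψ X (ψ (φ.symm y)) = fderiv ℝ (fun y => ψ (φ.symm y)) y (inCoord φ X y) := by
  rw [(hasFDerivAt_transition hφ hψ hy hy').fderiv, ContinuousLinearMap.comp_apply,
    chartSymmDiff_inCoord hφ X hy]
  have h : (fun q => chartDiff ψ q (X q)) (ψ.symm (ψ (φ.symm y))) =
      (fun q => chartDiff ψ q (X q)) (φ.symm y) := by rw [ψ.left_inv hy']
  exact h

theorem contDiffAt_inCoord (hψ : ψ ∈ IsManifold.maximalAtlas 𝓘(ℝ, Coord n) ∞ M)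
    {X : ∀ q : M, TangentSpace 𝓘(ℝ, Coord n) q} {U : Set M} (hU : IsOpen U)
    (hX : ContMDiffOn 𝓘(ℝ, Coord n) (𝓘(ℝ, Coord n)).tangent ∞
      (fun q => (⟨q, X q⟩ : TangentBundle 𝓘(ℝ, Coord n) M)) U) {y : Coord n} (hy : y ∈ ψ.target)
    (hy' : ψ.symm y ∈ U) : ContDiffAt ℝ ∞ (inCoord ψ X) y := by
  have h1 := (contMDiffOn_of_mem_maximalAtlas hψ).contMDiffOn_tangentMapWithin (m := ∞) (by simp)
    ψ.open_source.uniqueMDiffOn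
  have h2 := hX.contMDiffAt (hU.mem_nhds hy')
  have h3 := (contMDiffOn_symm_of_mem_maximalAtlas hψ).contMDiffAt (ψ.open_target.mem_nhds hy)
  have h4 := h1.contMDiffAt (x := (⟨ψ.symm y, X (ψ.symm y)⟩ : TangentBundle 𝓘(ℝ, Coord n) M))
    ((ψ.open_source.preimage (FiberBundle.continuous_proj (Coord n)
      (TangentSpace 𝓘(ℝ, Coord n) (M := M)))).mem_nhds (ψ.map_target hy))
  have h5 := (contMDiff_snd_tangentBundle_modelSpace (Coord n) 𝓘(ℝ, Coord n) (n := ∞)).contMDiffAt.comp _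
    (h4.comp y (h2.comp y h3))
  refine h5.contDiffAt.congr_of_eventuallyEq ?_
  filter_upwards [ψ.open_target.mem_nhds hy] with y' hy'
  change chartDiff ψ (ψ.symm y') (X (ψ.symm y')) = (mfderivWithin 𝓘(ℝ, Coord n) 𝓘(ℝ, Coord n) ψ ψ.source
    (ψ.symm y') : Coord n →L[ℝ] Coord n) (X (ψ.symm y'))
  rw [mfderivWithin_of_isOpen ψ.open_source (ψ.map_target hy')]
  rfl

end Charts

/-! ### The sub-Riemannian Hamiltonian as half a sum of squares. -/

section Hamiltonian

variable {n : ℕ} {M : Type*} [TopologicalSpace M] [ChartedSpace (Coord n) M]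
  [IsManifold 𝓘(ℝ, Coord n) ∞ M] {S : HorizontalMetric n M} {U : Set M}
  {X : HIdx n → ∀ q : M, TangentSpace 𝓘(ℝ, Coord n) q}

theorem IsFrame.exists_eq_sum (hX : IsFrame S U X) {q : M} (hq : q ∈ U) (v : S.Δ q) :
    ∃ a : HIdx n → ℝ, v.1 = ∑ k, a k • X k q ∧ S.g q v v = ∑ k, a k ^ 2 := by
  have hv : v.1 ∈ Submodule.span ℝ (range fun k => X k q) := (hX.span q hq).symm ▸ v.2
  obtain ⟨a, ha⟩ := (Submodule.mem_span_range_iff_exists_fun ℝ).1 hv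
  refine ⟨a, ha.symm, ?_⟩
  have hmem : ∀ k, X k q ∈ S.Δ q := fun k => (hX.orthonormal q hq k k).1
  have h1 : v = ∑ k, a k • (⟨X k q, hmem k⟩ : S.Δ q) := by
    apply Subtype.ext
    rw [← ha]
    simp
  have h2 : ∀ k l, S.g q ⟨X k q, hmem k⟩ ⟨X l q, hmem l⟩ = if k = l then 1 else 0 := fun k l =>
    (hX.orthonormal q hq k l).2.2
  rw [h1]
  simp only [map_sum, map_smul, LinearMap.sum_apply, LinearMap.smul_apply, h2, smul_eq_mul,
    mul_ite, mul_one, mul_zero, Finset.sum_ite_eq', Finset.mem_univ, if_true, sq]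

theorem IsFrame.exists_of_coeff (hX : IsFrame S U X) {q : M} (hq : q ∈ U) (a : HIdx n → ℝ) :
    ∃ v : S.Δ q, v.1 = ∑ k, a k • X k q ∧ S.g q v v = ∑ k, a k ^ 2 := by
  have hmem : ∀ k, X k q ∈ S.Δ q := fun k => (hX.orthonormal q hq k k).1
  have h2 : ∀ k l, S.g q ⟨X k q, hmem k⟩ ⟨X l q, hmem l⟩ = if k = l then 1 else 0 := fun k l =>
    (hX.orthonormal q hq k l).2.2
  refine ⟨∑ k, a k • (⟨X k q, hmem k⟩ : S.Δ q), by simp, ?_⟩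
  simp only [map_sum, map_smul, LinearMap.sum_apply, LinearMap.smul_apply, h2, smul_eq_mul,
    mul_ite, mul_one, mul_zero, Finset.sum_ite_eq', Finset.mem_univ, if_true, sq]

theorem pairing_sum (q : M) (p : Coord n →L[ℝ] ℝ) (a : HIdx n → ℝ)
    (v : HIdx n → TangentSpace 𝓘(ℝ, Coord n) q) :
    pairing q p (∑ k, a k • v k) = ∑ k, a k * pairing q p (v k) := by
  have h : ∀ v : HIdx n → Coord n, p (∑ k, a k • v k) = ∑ k, a k * p (v k) := fun v => by
    simp [map_sum]
  exact h v

/-- The Hamiltonian of an orthonormal frame. -/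
theorem IsFrame.hamiltonian_eq (hX : IsFrame S U X) {q : M} (hq : q ∈ U) (p : Coord n →L[ℝ] ℝ) :
    hamiltonian S q p = 1 / 2 * ∑ k, pairing q p (X k q) ^ 2 := by
  rw [hamiltonian]
  congr 1
  set w : HIdx n → ℝ := fun k => pairing q p (X k q) with hw
  -- Cauchy–Schwarz in the orthonormal frame. Equality holds for the horizontal vector whose
  -- coefficients are the pairings themselves.
  have hle : ∀ v : {v : S.Δ q // v ≠ 0}, pairing q p v.1.1 ^ 2 / S.g q v.1 v.1 ≤ ∑ k, w k ^ 2 := by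
    rintro ⟨v, hv⟩
    have hpos := S.pos q v hv
    obtain ⟨a, ha, hg⟩ := hX.exists_eq_sum hq v
    rw [div_le_iff₀ hpos]
    simp only
    rw [ha, hg, pairing_sum, mul_comm]
    exact Finset.sum_mul_sq_le_sq_mul_sq _ _ _
  have h0 : 0 ≤ ∑ k, w k ^ 2 := Finset.sum_nonneg fun k _ => sq_nonneg _
  refine le_antisymm (Real.iSup_le hle h0) ?_
  -- If all the pairings vanish, the maximising vector is zero and is not admissible; nonnegativity
  -- of the supremum suffices.
  rcases h0.eq_or_lt with h | h
  · rw [← h]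
    exact Real.iSup_nonneg fun v => div_nonneg (sq_nonneg _) (S.pos q v.1 v.2).le
  · obtain ⟨v, hv, hg⟩ := hX.exists_of_coeff hq w
    have hv0 : v ≠ 0 := by
      rintro rfl
      rw [map_zero] at hg
      exact h.ne hg
    refine le_trans (le_of_eq ?_) (le_ciSup ⟨_, forall_mem_range.2 hle⟩ (⟨v, hv0⟩ : {v : S.Δ q // v ≠ 0}))
    simp only
    rw [hv, hg, pairing_sum]
    have : ∑ k, w k * pairing q p (X k q) = ∑ k, w k ^ 2 :=
      Finset.sum_congr rfl fun k _ => by rw [sq]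
    rw [this, sq, mul_div_cancel_right₀ _ h.ne']

variable {ψ : OpenPartialHomeomorph M (Coord n)}

theorem IsFrame.chartHamiltonian_eq (hX : IsFrame S U X) {y : Coord n} (hy : ψ.symm y ∈ U)
    (ξ : Coord n →L[ℝ] ℝ) :
    chartHamiltonian S ψ y ξ = 1 / 2 * ∑ k, ξ (inCoord ψ (X k) y) ^ 2 :=
  hX.hamiltonian_eq hy _

theorem IsFrame.fderiv_chartHamiltonian_mom (hX : IsFrame S U X) {y : Coord n}
    (hy : ψ.symm y ∈ U) (ξ α : Coord n →L[ℝ] ℝ) :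
    fderiv ℝ (fun ξ => chartHamiltonian S ψ y ξ) ξ α =
      α (∑ k, ξ (inCoord ψ (X k) y) • inCoord ψ (X k) y) := by
  have h1 : (fun ξ => chartHamiltonian S ψ y ξ) =
      fun ξ => 1 / 2 * ∑ k, ξ (inCoord ψ (X k) y) ^ 2 := funext (hX.chartHamiltonian_eq hy)
  have h2 : HasFDerivAt (fun ξ : Coord n →L[ℝ] ℝ => 1 / 2 * ∑ k, ξ (inCoord ψ (X k) y) ^ 2)
      ((1 / 2 : ℝ) • ∑ k, (2 * ξ (inCoord ψ (X k) y)) •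
        ContinuousLinearMap.apply ℝ ℝ (inCoord ψ (X k) y)) ξ := by
    refine (HasFDerivAt.fun_sum fun k _ => ?_).const_mul _
    have := ((ContinuousLinearMap.apply ℝ ℝ (inCoord ψ (X k) y)).hasFDerivAt (x := ξ)).pow 2
    simpa using this
  rw [h1, h2.fderiv]
  simp only [smul_apply, sum_apply,
    ContinuousLinearMap.apply_apply, smul_eq_mul, map_sum, map_smul, Finset.mul_sum]
  exact Finset.sum_congr rfl fun k _ => by ring

theorem IsFrame.fderiv_chartHamiltonian_pos (hψ : ψ ∈ IsManifold.maximalAtlas 𝓘(ℝ, Coord n) ∞ M)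
    (hU : IsOpen U) (hX : IsFrame S U X) {y : Coord n} (hy0 : y ∈ ψ.target)
    (hy : ψ.symm y ∈ U) (ξ : Coord n →L[ℝ] ℝ) :
    fderiv ℝ (fun y => chartHamiltonian S ψ y ξ) y =
      ∑ k, ξ (inCoord ψ (X k) y) • ξ.comp (fderiv ℝ (inCoord ψ (X k)) y) := by
  have h1 : (fun y => chartHamiltonian S ψ y ξ) =ᶠ[𝓝 y]
      fun y => 1 / 2 * ∑ k, ξ (inCoord ψ (X k) y) ^ 2 := by
    filter_upwards [(ψ.symm.isOpen_inter_preimage hU).mem_nhds ⟨hy0, hy⟩] with y' hy'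
    exact hX.chartHamiltonian_eq hy'.2 ξ
  have h2 : HasFDerivAt (fun y => 1 / 2 * ∑ k, ξ (inCoord ψ (X k) y) ^ 2)
      ((1 / 2 : ℝ) • ∑ k, (2 * ξ (inCoord ψ (X k) y)) •
        ξ.comp (fderiv ℝ (inCoord ψ (X k)) y)) y := by
    refine (HasFDerivAt.fun_sum fun k _ => ?_).const_mul _
    have := ((ξ.hasFDerivAt (x := inCoord ψ (X k) y)).comp y
      ((contDiffAt_inCoord hψ hU (hX.smooth k) hy0 hy).differentiableAt (by simp)).hasFDerivAt).pow 2
    simpa using this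
  rw [h1.fderiv_eq, h2.fderiv, Finset.smul_sum]
  refine Finset.sum_congr rfl fun k _ => ?_
  rw [smul_smul]
  congr 1
  ring

end Hamiltonian
end
end ContactSR

namespace ContactSR
noncomputable section

set_option linter.unusedSectionVars false

/-! ### Covariance of the Hamilton equations under changes of coordinates. -/

section FrameField

variable {V : Type*} [NormedAddCommGroup V] [NormedSpace ℝ V] {κ : Type*} [Fintype κ]

/-- The Hamiltonian vector field of `½ ∑ ξ(A_k)²`. -/
def frameField (A : κ → V → V) (z : V × (V →L[ℝ] ℝ)) : V × (V →L[ℝ] ℝ) :=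
  (∑ k, z.2 (A k z.1) • A k z.1, -∑ k, z.2 (A k z.1) • z.2.comp (fderiv ℝ (A k) z.1))

theorem contDiffAt_frameField {A : κ → V → V} {z : V × (V →L[ℝ] ℝ)}
    (hA : ∀ k, ContDiffAt ℝ ∞ (A k) z.1) : ContDiffAt ℝ 1 (frameField A) z := by
  have h1 : ∀ k, ContDiffAt ℝ 1 (fun z : V × (V →L[ℝ] ℝ) => A k z.1) z := fun k =>
    ((hA k).of_le (by simp)).comp z contDiffAt_fst
  have h2 : ∀ k, ContDiffAt ℝ 1 (fun z : V × (V →L[ℝ] ℝ) => fderiv ℝ (A k) z.1) z := fun k =>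
    ((hA k).fderiv_right (m := 1) (by norm_cast)).comp z contDiffAt_fst
  refine ContDiffAt.prodMk (ContDiffAt.sum fun k _ => ?_) (ContDiffAt.sum fun k _ => ?_).neg
  · exact (contDiffAt_snd.clm_apply (h1 k)).smul (h1 k)
  · exact (contDiffAt_snd.clm_apply (h1 k)).smul (contDiffAt_snd.clm_comp (h2 k))

/-- Transport of the momentum equation by a change of coordinates `Θ`, with `A = Θ_* B`. -/
theorem frameField_transport {A B : κ → V → V} {Θ : V → V} {w : V} (hΘ : ContDiffAt ℝ ∞ Θ w)
    (hA : ∀ k, DifferentiableAt ℝ (A k) (Θ w)) (hB : ∀ k, DifferentiableAt ℝ (B k) w)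
    (h : ∀ k, ∀ᶠ w' in 𝓝 w, A k (Θ w') = fderiv ℝ Θ w' (B k w')) (ξ : V →L[ℝ] ℝ) :
    (frameField A (Θ w, ξ)).2.comp (fderiv ℝ Θ w) +
      ξ.comp (fderiv ℝ (fderiv ℝ Θ) w (frameField B (w, ξ.comp (fderiv ℝ Θ w))).1) =
    (frameField B (w, ξ.comp (fderiv ℝ Θ w))).2 := by
  have hd : DifferentiableAt ℝ (fderiv ℝ Θ) w :=
    (hΘ.fderiv_right (m := 1) (by norm_cast)).differentiableAt (by simp)
  have hsymm : IsSymmSndFDerivAt ℝ Θ w := hΘ.isSymmSndFDerivAt (by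
    rw [minSmoothness_of_isRCLikeNormedField]
    exact (WithTop.coe_le_coe.2 le_top : ((2 : ℕ∞) : WithTop ℕ∞) ≤ ((⊤ : ℕ∞) : WithTop ℕ∞)))
  have key : ∀ k v, fderiv ℝ (A k) (Θ w) (fderiv ℝ Θ w v) =
      fderiv ℝ (fderiv ℝ Θ) w v (B k w) + fderiv ℝ Θ w (fderiv ℝ (B k) w v) := fun k v => by
    have h1 := (hA k).hasFDerivAt.comp w (hΘ.differentiableAt (by simp)).hasFDerivAt
    have h2 := hd.hasFDerivAt.clm_apply (hB k).hasFDerivAt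
    have h3 := (h1.congr_of_eventuallyEq (EventuallyEq.symm (h k))).unique h2
    have h4 := DFunLike.congr_fun h3 v
    simpa [add_comm] using h4
  ext v
  have h0 : ∀ k, A k (Θ w) = fderiv ℝ Θ w (B k w) := fun k => (h k).self_of_nhds
  -- The second derivative of the coordinate change appears once from the transported momentum and
  -- once from the transported frame; its symmetry makes the two cancel.
  have e1 : fderiv ℝ (fderiv ℝ Θ) w (∑ k, ξ (fderiv ℝ Θ w (B k w)) • B k w) v =
      ∑ k, ξ (fderiv ℝ Θ w (B k w)) • fderiv ℝ (fderiv ℝ Θ) w v (B k w) := by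
    simp only [map_sum, map_smul, sum_apply, smul_apply]
    exact Finset.sum_congr rfl fun k _ => by rw [hsymm.eq]
  simp only [frameField, add_apply, ContinuousLinearMap.comp_apply, neg_apply, sum_apply,
    smul_apply, h0, key, map_add, smul_eq_mul, e1, mul_add, Finset.sum_add_distrib]
  simp only [map_sum, map_smul, smul_eq_mul]
  ring

end FrameField

/-! ### Existence and uniqueness of normal extremals from a single chart. -/

section Extremals

variable {n : ℕ} {M : Type*} [TopologicalSpace M] [ChartedSpace (Coord n) M]
  [IsManifold 𝓘(ℝ, Coord n) ∞ M] {S : HorizontalMetric n M}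
  {X : HIdx n → ∀ q : M, TangentSpace 𝓘(ℝ, Coord n) q}
  {φ : OpenPartialHomeomorph M (Coord n)}

/-- The curve in `T^* M` with given coordinates in the chart `φ`. -/
def ofChart (φ : OpenPartialHomeomorph M (Coord n)) (y : ℝ → Coord n)
    (ξ : ℝ → Coord n →L[ℝ] ℝ) (t : ℝ) : M × (Coord n →L[ℝ] ℝ) :=
  (φ.symm (y t), (ξ t).comp (chartDiff φ (φ.symm (y t))))

/-- Solutions of the Hamilton equations in one chart are normal extremals. -/
theorem isNormalExtremal_ofChart (hφ : φ ∈ IsManifold.maximalAtlas 𝓘(ℝ, Coord n) ∞ M)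
    (hX : IsFrame S φ.source X) {y : ℝ → Coord n} {ξ : ℝ → Coord n →L[ℝ] ℝ} {s : Set ℝ}
    (hmem : ∀ t ∈ s, y t ∈ φ.target)
    (hy : ∀ t ∈ s, HasDerivWithinAt y (frameField (fun k => inCoord φ (X k)) (y t, ξ t)).1 s t)
    (hξ : ∀ t ∈ s, HasDerivWithinAt ξ (frameField (fun k => inCoord φ (X k)) (y t, ξ t)).2 s t) :
    IsNormalExtremal S (ofChart φ y ξ) s := by
  have hsmooth : ∀ ψ ∈ IsManifold.maximalAtlas 𝓘(ℝ, Coord n) ∞ M, ∀ y ∈ ψ.target,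
      ψ.symm y ∈ φ.source → ∀ k, ContDiffAt ℝ ∞ (inCoord ψ (X k)) y := fun ψ hψ y h1 h2 k =>
    contDiffAt_inCoord hψ φ.open_source (hX.smooth k) h1 h2
  -- Momenta pull back by the transition map from ψ to φ, the direction opposite to positions.
  have hmom : ∀ ψ ∈ IsManifold.maximalAtlas 𝓘(ℝ, Coord n) ∞ M, ∀ t ∈ s, φ.symm (y t) ∈ ψ.source →
      chartMom ψ (ofChart φ y ξ) t =
        (ξ t).comp (fderiv ℝ (fun w => φ (ψ.symm w)) (ψ (φ.symm (y t)))) := fun ψ hψ t ht h => by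
    have h1 : ψ.symm (ψ (φ.symm (y t))) = φ.symm (y t) := ψ.left_inv h
    rw [(hasFDerivAt_transition hψ hφ (ψ.map_source h)
      (by rw [h1]; exact φ.map_target (hmem t ht))).fderiv, h1]
    rfl
  have hvel : ∀ ψ ∈ IsManifold.maximalAtlas 𝓘(ℝ, Coord n) ∞ M, ∀ t ∈ s, φ.symm (y t) ∈ ψ.source →
      HasDerivWithinAt (chartPos ψ (ofChart φ y ξ)) (frameField (fun k => inCoord ψ (X k))
        (ψ (φ.symm (y t)), chartMom ψ (ofChart φ y ξ) t)).1 s t := fun ψ hψ t ht h => by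
    have h1 : ψ.symm (ψ (φ.symm (y t))) = φ.symm (y t) := ψ.left_inv h
    have h2 := ((contDiffAt_transition hφ hψ (hmem t ht) h).differentiableAt
      (by simp)).hasFDerivAt.comp_hasDerivWithinAt t (hy t ht)
    refine h2.congr_deriv ?_
    simp only [frameField, map_sum, map_smul, hmom ψ hψ t ht h]
    refine Finset.sum_congr rfl fun k _ => ?_
    rw [← inCoord_transition hφ hψ _ (hmem t ht) h, ContinuousLinearMap.comp_apply,
      ← inCoord_transition hψ hφ _ (ψ.map_source h) (by rw [h1]; exact φ.map_target (hmem t ht)),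
      h1, φ.right_inv (hmem t ht)]
  refine ⟨fun t ht => ?_, fun ψ hψ t ht h => ⟨_, hvel ψ hψ t ht h, fun α => ?_⟩,
    fun ψ hψ t ht h => ?_⟩
  · exact ((φ.symm.continuousAt (hmem t ht)).comp_continuousWithinAt (hy t ht).continuousWithinAt)
  · rw [hX.fderiv_chartHamiltonian_mom]
    · rfl
    · exact (ψ.left_inv h).symm ▸ φ.map_target (hmem t ht)
  · have h : φ.symm (y t) ∈ ψ.source := h
    have h1 : ψ.symm (ψ (φ.symm (y t))) = φ.symm (y t) := ψ.left_inv h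
    have h2 : ψ.symm (ψ (φ.symm (y t))) ∈ φ.source := by rw [h1]; exact φ.map_target (hmem t ht)
    have hΘ := contDiffAt_transition hψ hφ (ψ.map_source h) h2
    have hd : DifferentiableAt ℝ (fderiv ℝ fun w => φ (ψ.symm w)) (ψ (φ.symm (y t))) :=
      (hΘ.fderiv_right (m := 1) (by norm_cast)).differentiableAt (by simp)
    have h3 := (hξ t ht).clm_comp (hd.hasFDerivAt.comp_hasDerivWithinAt t (hvel ψ hψ t ht h))
    have h4 : chartMom ψ (ofChart φ y ξ) =ᶠ[𝓝[s] t] fun t =>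
        (ξ t).comp (fderiv ℝ (fun w => φ (ψ.symm w)) (ψ (φ.symm (y t)))) := by
      have h5 : ContinuousWithinAt (fun t => φ.symm (y t)) s t :=
        (φ.symm.continuousAt (hmem t ht)).comp_continuousWithinAt (hy t ht).continuousWithinAt
      filter_upwards [h5 (ψ.open_source.mem_nhds h), self_mem_nhdsWithin] with t' h6 h7
      exact hmom ψ hψ t' h7 h6
    refine (h3.congr_of_eventuallyEq h4 (hmom ψ hψ t ht h)).congr_deriv ?_
    have h8 : φ (ψ.symm (ψ (φ.symm (y t)))) = y t := by rw [h1, φ.right_inv (hmem t ht)]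
    have h9 := frameField_transport (A := fun k => inCoord φ (X k)) (B := fun k => inCoord ψ (X k))
      hΘ (fun k => (hsmooth φ hφ _ (by rw [h8]; exact hmem t ht)
        (by rw [h8]; exact φ.map_target (hmem t ht)) k).differentiableAt (by simp))
      (fun k => (hsmooth ψ hψ _ (ψ.map_source h) h2 k).differentiableAt (by simp))
      (fun k => by
        filter_upwards [(ψ.symm.isOpen_inter_preimage φ.open_source).mem_nhds
          ⟨ψ.map_source h, h2⟩] with w hw
        exact inCoord_transition hψ hφ _ hw.1 hw.2) (ξ t)
    rw [hmom ψ hψ t ht h]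
    refine Eq.trans ?_ (h9.trans ?_)
    · rw [h8]
      rfl
    · refine (congrArg Neg.neg (hX.fderiv_chartHamiltonian_pos hψ φ.open_source
        (ψ.map_source h) h2 _)).symm

theorem ext_of_forms {v w : Coord n} (h : ∀ α : Coord n →L[ℝ] ℝ, α v = α w) : v = w := by
  ext o
  exact h (EuclideanSpace.proj (𝕜 := ℝ) o)

/-- Normal extremals solve the Hamilton equations of the frame in its chart. -/
theorem IsNormalExtremal.hasDerivWithinAt (hφ : φ ∈ IsManifold.maximalAtlas 𝓘(ℝ, Coord n) ∞ M)
    (hX : IsFrame S φ.source X) {c : ℝ → M × (Coord n →L[ℝ] ℝ)} {s : Set ℝ}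
    (hc : IsNormalExtremal S c s) {t : ℝ} (ht : t ∈ s) (h : (c t).1 ∈ φ.source) :
    HasDerivWithinAt (fun t => (chartPos φ c t, chartMom φ c t))
      (frameField (fun k => inCoord φ (X k)) (chartPos φ c t, chartMom φ c t)) s t := by
  have h2 : φ.symm (chartPos φ c t) ∈ φ.source := by
    rw [chartPos, φ.left_inv h]; exact h
  obtain ⟨v, hv, hα⟩ := hc.position φ hφ t ht h
  refine HasDerivWithinAt.prodMk (hv.congr_deriv ?_) ((hc.momentum φ hφ t ht h).congr_deriv ?_)
  · refine ext_of_forms fun α => ?_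
    rw [hα α, hX.fderiv_chartHamiltonian_mom h2]
  · exact congrArg Neg.neg
      (hX.fderiv_chartHamiltonian_pos hφ φ.open_source (φ.map_source h) h2 _)

/-- Uniqueness of normal extremals. -/
theorem IsNormalExtremal.eqOn [T2Space M] (hφ : φ ∈ IsManifold.maximalAtlas 𝓘(ℝ, Coord n) ∞ M)
    (hX : IsFrame S φ.source X) {c c' : ℝ → M × (Coord n →L[ℝ] ℝ)} {T : ℝ}
    (hc : IsNormalExtremal S c (Icc 0 T)) (hc' : IsNormalExtremal S c' (Icc 0 T))
    (h0 : c 0 = c' 0) (hmem : ∀ t ∈ Icc 0 T, (c t).1 ∈ φ.source) :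
    ∀ t ∈ Icc 0 T, (c t).1 = (c' t).1 := by
  set Z : Set ℝ := {t | (c t).1 = (c' t).1} with hZ
  -- Continuation argument: this set of times is closed, by Hausdorffness for the positions and then
  -- continuity of the momenta, and it extends to the right by local uniqueness.
  set s : Set ℝ := {t | (c t).1 = (c' t).1 ∧ chartMom φ c t = chartMom φ c' t} with hs
  have hmem' : ∀ t ∈ Icc 0 T ∩ Z, (c' t).1 ∈ φ.source := fun t ht => ht.2 ▸ hmem t ht.1
  have hZc : IsClosed (Icc 0 T ∩ Z) :=
    (hc.continuousOn.prodMk hc'.continuousOn).preimage_isClosed_of_isClosed isClosed_Icc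
      isClosed_diagonal
  have hsc : IsClosed (s ∩ Icc 0 T) := by
    have h1 : ContinuousOn (fun t => (chartMom φ c t, chartMom φ c' t)) (Icc 0 T ∩ Z) := by
      refine ContinuousOn.prodMk (fun t ht => ?_) (fun t ht => ?_)
      · exact (hc.momentum φ hφ t ht.1 (hmem t ht.1)).continuousWithinAt.mono inter_subset_left
      · exact (hc'.momentum φ hφ t ht.1 (hmem' t ht)).continuousWithinAt.mono inter_subset_left
    have h2 := h1.preimage_isClosed_of_isClosed hZc isClosed_diagonal
    convert h2 using 1
    ext t
    simp only [hs, hZ, mem_inter_iff, mem_ofPred_eq, mem_preimage, mem_diagonal_iff]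
    tauto
  have hsub : Icc 0 T ⊆ s := by
    refine hsc.Icc_subset_of_forall_mem_nhdsWithin ⟨by rw [h0], ?_⟩ fun t ⟨ht, ht'⟩ => ?_
    · simp only [chartMom, chartPos, h0]
    have htI : t ∈ Icc 0 T := ⟨ht'.1, ht'.2.le⟩
    have hsrc : (c' t).1 ∈ φ.source := hmem' t ⟨htI, ht.1⟩
    have hIcc : Icc 0 T ∈ 𝓝[≥] t := Icc_mem_nhdsGE_of_mem ht'
    set u : ℝ → Coord n × (Coord n →L[ℝ] ℝ) := fun t => (chartPos φ c t, chartMom φ c t) with hu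
    set u' : ℝ → Coord n × (Coord n →L[ℝ] ℝ) := fun t => (chartPos φ c' t, chartMom φ c' t) with hu'
    have huu : u t = u' t := by
      simp only [hu, hu', chartPos, ht.1, ht.2]
    have htar : (u t).1 ∈ φ.target := φ.map_source (hmem t htI)
    obtain ⟨K, N, hN, hK⟩ := (contDiffAt_frameField (A := fun k => inCoord φ (X k)) (z := u t)
      (fun k => contDiffAt_inCoord hφ φ.open_source (hX.smooth k) htar
        (φ.map_target htar))).exists_lipschitzOnWith
    have hd : ∀ τ ∈ Icc 0 T, HasDerivWithinAt u
        (frameField (fun k => inCoord φ (X k)) (u τ)) (Icc 0 T) τ := fun τ hτ =>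
      hc.hasDerivWithinAt hφ hX hτ (hmem τ hτ)
    have hd' : ∀ τ ∈ Icc 0 T, (c' τ).1 ∈ φ.source → HasDerivWithinAt u'
        (frameField (fun k => inCoord φ (X k)) (u' τ)) (Icc 0 T) τ := fun τ hτ h =>
      hc'.hasDerivWithinAt hφ hX hτ h
    have e1 : ∀ᶠ τ in 𝓝[≥] t, u τ ∈ N :=
      ((hd t htI).continuousWithinAt.mono_of_mem_nhdsWithin hIcc) hN
    have e2 : ∀ᶠ τ in 𝓝[≥] t, u' τ ∈ N :=
      ((hd' t htI hsrc).continuousWithinAt.mono_of_mem_nhdsWithin hIcc) (huu ▸ hN)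
    have e3 : ∀ᶠ τ in 𝓝[≥] t, (c' τ).1 ∈ φ.source :=
      ((hc'.continuousOn t htI).mono_of_mem_nhdsWithin hIcc) (φ.open_source.mem_nhds hsrc)
    obtain ⟨d, hd0, hsubd⟩ : ∃ d ∈ Ioc t T, Icc t d ⊆ {τ | u τ ∈ N ∧ u' τ ∈ N ∧
        (c' τ).1 ∈ φ.source ∧ τ ∈ Icc 0 T} := by
      obtain ⟨d, hd0, hsubd⟩ := (mem_nhdsGE_iff_exists_mem_Ioc_Ico_subset ht'.2).1
        (e1.and (e2.and (e3.and hIcc)))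
      exact ⟨(t + d) / 2, ⟨by linarith [hd0.1], by linarith [hd0.1, hd0.2]⟩,
        fun τ hτ => hsubd ⟨hτ.1, by linarith [hτ.2, hd0.1]⟩⟩
    have htd : t ≤ d := le_of_lt hd0.1
    have hmono : ∀ τ ∈ Ico t d, Icc 0 T ∈ 𝓝[≥] τ := fun τ hτ =>
      Icc_mem_nhdsGE_of_mem ⟨ht'.1.trans hτ.1, hτ.2.trans_le hd0.2⟩
    have key := ODE_solution_unique_of_mem_Icc_right
      (v := fun _ => frameField fun k => inCoord φ (X k)) (s := fun _ => N) (K := K) (f := u)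
      (g := u') (a := t) (b := d) (fun _ _ => hK)
      (fun τ hτ => ((hd τ (hsubd hτ).2.2.2).continuousWithinAt.mono
        (Icc_subset_Icc ht'.1 hd0.2)))
      (fun τ hτ => (hd τ (hsubd ⟨hτ.1, hτ.2.le⟩).2.2.2).mono_of_mem_nhdsWithin (hmono τ hτ))
      (fun τ hτ => (hsubd ⟨hτ.1, hτ.2.le⟩).1)
      (fun τ hτ => ((hd' τ (hsubd hτ).2.2.2 (hsubd hτ).2.2.1).continuousWithinAt.mono
        (Icc_subset_Icc ht'.1 hd0.2)))
      (fun τ hτ => (hd' τ (hsubd ⟨hτ.1, hτ.2.le⟩).2.2.2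
        (hsubd ⟨hτ.1, hτ.2.le⟩).2.2.1).mono_of_mem_nhdsWithin (hmono τ hτ))
      (fun τ hτ => (hsubd ⟨hτ.1, hτ.2.le⟩).2.1) huu
    filter_upwards [Ioc_mem_nhdsGT hd0.1] with τ hτ
    have hτ' : τ ∈ Icc t d := ⟨hτ.1.le, hτ.2⟩
    have h3 := key hτ'
    refine ⟨?_, congrArg Prod.snd h3⟩
    exact φ.injOn (hmem τ (hsubd hτ').2.2.2) (hsubd hτ').2.2.1 (congrArg Prod.fst h3)
  exact fun t ht => (hsub ht).1

/-- `expMap` is defined by choosing an extremal; by uniqueness any extremal which stays in the chart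
computes it. -/
theorem expMap_eq [T2Space M] (hφ : φ ∈ IsManifold.maximalAtlas 𝓘(ℝ, Coord n) ∞ M)
    (hX : IsFrame S φ.source X) {q₀ : M} {p : Coord n →L[ℝ] ℝ}
    {c : ℝ → M × (Coord n →L[ℝ] ℝ)} {T : ℝ} (hT : 0 ≤ T) (h0 : c 0 = (q₀, p))
    (hc : IsNormalExtremal S c (Icc 0 T)) (hmem : ∀ t ∈ Icc 0 T, (c t).1 ∈ φ.source) :
    expMap S q₀ T p = (c T).1 := by
  have hdef : ExpDefined S q₀ T p := ⟨c, h0, hc⟩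
  rw [expMap, dif_pos hdef]
  obtain ⟨h1, h2⟩ := hdef.choose_spec
  exact (hc.eqOn hφ hX h2 (h0.trans h1.symm) hmem T ⟨hT, le_rfl⟩).symm

end Extremals
end
end ContactSR

namespace ContactSR
noncomputable section

set_option linter.unusedSectionVars false

/-! ### Anisotropic dilations of vector fields. -/

section Dilation

variable {n : ℕ}

/-- The projection onto the vertical axis. -/
def vertProj : Coord n →L[ℝ] Coord n :=
  (EuclideanSpace.proj (𝕜 := ℝ) none).smulRight (EuclideanSpace.single none 1)

/-- The linear map `(x, z) ↦ (x, ε z)`. -/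
def vertScale (ε : ℝ) : Coord n →L[ℝ] Coord n :=
  (ContinuousLinearMap.id ℝ (Coord n) - vertProj) + ε • vertProj

/-- The dilation `(x, z) ↦ (ε x, ε² z)`. -/
def dil (ε : ℝ) : Coord n →L[ℝ] Coord n := ε • vertScale ε

@[simp] theorem vertScale_some (ε : ℝ) (y : Coord n) (k : HIdx n) :
    vertScale ε y (some k) = y (some k) := by
  simp [vertScale, vertProj]

@[simp] theorem vertScale_none (ε : ℝ) (y : Coord n) : vertScale ε y none = ε * y none := by
  simp [vertScale, vertProj]

@[simp] theorem dil_some (ε : ℝ) (y : Coord n) (k : HIdx n) :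
    dil ε y (some k) = ε * y (some k) := by
  simp [dil]

@[simp] theorem dil_none (ε : ℝ) (y : Coord n) : dil ε y none = ε ^ 2 * y none := by
  simp [dil, sq, mul_assoc]

theorem dil_zero : (dil 0 : Coord n →L[ℝ] Coord n) = 0 :=
  ContinuousLinearMap.ext fun y => Coord.ext (fun k => by simp) (by simp)

theorem dil_inv_dil {ε : ℝ} (hε : ε ≠ 0) (y : Coord n) : dil ε⁻¹ (dil ε y) = y :=
  Coord.ext (fun k => by simp [hε]) (by simp [hε])

theorem dil_dil_inv {ε : ℝ} (hε : ε ≠ 0) (y : Coord n) : dil ε (dil ε⁻¹ y) = y :=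
  Coord.ext (fun k => by simp [hε]) (by simp [hε])

theorem contDiff_vertScale : ContDiff ℝ ∞ (vertScale : ℝ → Coord n →L[ℝ] Coord n) :=
  contDiff_const.add (contDiff_id.smul contDiff_const)

theorem contDiff_dil : ContDiff ℝ ∞ (dil : ℝ → Coord n →L[ℝ] Coord n) :=
  contDiff_id.smul contDiff_vertScale

/-- The vector field `ε δ_ε^* A`, extended smoothly to `ε = 0`. -/
def dilField (A : Coord n → Coord n) (hA : ContDiff ℝ ∞ fun v => A v none) (P : ℝ × Coord n) :
    Coord n :=
  vertScale 0 (A (dil P.1 P.2)) +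
    hadamard ⟨fun v => A v none, hA.continuous⟩ hA (dil P.1 P.2) (vertScale P.1 P.2) •
      EuclideanSpace.single none 1

theorem contDiff_dilField {A : Coord n → Coord n} (hA : ContDiff ℝ ∞ A)
    (hA' : ContDiff ℝ ∞ fun v => A v none) : ContDiff ℝ ∞ (dilField A hA') := by
  have h1 : ContDiff ℝ ∞ fun P : ℝ × Coord n => dil P.1 P.2 :=
    (contDiff_dil.comp contDiff_fst).clm_apply contDiff_snd
  have h2 : ContDiff ℝ ∞ fun P : ℝ × Coord n => vertScale P.1 P.2 :=
    (contDiff_vertScale.comp contDiff_fst).clm_apply contDiff_snd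
  have h3 : ContDiff ℝ ∞ fun P : ℝ × Coord n =>
      hadamard ⟨fun v => A v none, hA'.continuous⟩ hA' (dil P.1 P.2) (vertScale P.1 P.2) :=
    ((contDiff_hadamard _ hA').comp h1).clm_apply h2
  exact ((vertScale 0 : Coord n →L[ℝ] Coord n).contDiff.comp (hA.comp h1)).add
    (h3.smul contDiff_const)

/-- As `dil ε` is ε times `vertScale ε`, Hadamard's lemma extracts the factor ε from the vertical
component, which vanishes at 0. This replaces the division by ε and leaves a field that is smooth at
ε = 0. -/
theorem dil_dilField {A : Coord n → Coord n} (hA : ContDiff ℝ ∞ fun v => A v none)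
    (h0 : A 0 none = 0) (ε : ℝ) (y : Coord n) :
    dil ε (dilField A hA (ε, y)) = ε • A (dil ε y) := by
  refine Coord.ext (fun k => ?_) ?_
  · simp [dilField]
  · have h1 := hadamard_apply_self ⟨fun v => A v none, hA.continuous⟩ hA (dil ε y)
    have h2 : (dil ε y : Coord n) = ε • vertScale ε y := rfl
    rw [ContinuousMap.coe_mk, h0, sub_zero] at h1
    have h3 : ε * hadamard ⟨fun v => A v none, hA.continuous⟩ hA (dil ε y) (vertScale ε y) =
        A (dil ε y) none := by
      rw [← smul_eq_mul, ← map_smul]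
      exact h1
    rw [dil_none, PiLp.smul_apply, smul_eq_mul, ← h3]
    simp only [dilField, PiLp.add_apply, vertScale_none, zero_mul, zero_add, PiLp.smul_apply,
      PiLp.single_apply, if_true, smul_eq_mul, mul_one]
    ring

/-- Nilpotent approximation: only the horizontal value at 0 and the horizontal linear part of the
vertical component survive. -/
theorem dilField_zero {A : Coord n → Coord n} (hA : ContDiff ℝ ∞ fun v => A v none)
    (y : Coord n) :
    dilField A hA (0, y) = vertScale 0 (A 0) +
      fderiv ℝ (fun v => A v none) 0 (vertScale 0 y) • EuclideanSpace.single none 1 := by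
  simp only [dilField, dil_zero, zero_apply]
  rw [hadamard_zero]
  rfl

end Dilation

/-- Maps which are smooth near a point agree near this point with globally smooth maps. -/
theorem exists_contDiff_extension {E F : Type*} [NormedAddCommGroup E] [InnerProductSpace ℝ E]
    [FiniteDimensional ℝ E] [NormedAddCommGroup F] [NormedSpace ℝ F] {U : Set E} (hU : IsOpen U)
    {x : E} (hx : x ∈ U) :
    ∃ r > 0, Metric.ball x r ⊆ U ∧ ∀ f : E → F, (∀ y ∈ U, ContDiffAt ℝ ∞ f y) →
      ∃ g : E → F, ContDiff ℝ ∞ g ∧ ∀ y ∈ Metric.ball x r, g y = f y := by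
  obtain ⟨R, hR, hsub⟩ := Metric.nhds_basis_closedBall.mem_iff.1 (hU.mem_nhds hx)
  set χ : ContDiffBump x := ⟨R / 2, R, half_pos hR, half_lt_self hR⟩ with hχ
  refine ⟨R / 2, half_pos hR, (Metric.ball_subset_closedBall.trans
    (Metric.closedBall_subset_closedBall (half_le_self hR.le))).trans hsub, fun f hf =>
    ⟨fun y => χ y • f y, contDiff_iff_contDiffAt.2 fun y => ?_, fun y hy => ?_⟩⟩
  · by_cases hy : y ∈ U
    · exact χ.contDiff.contDiffAt.smul (hf y hy)
    · have h1 : y ∉ tsupport χ := fun h => hy (hsub (by rwa [χ.tsupport_eq] at h))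
      refine contDiffAt_const (c := (0 : F)) |>.congr_of_eventuallyEq ?_
      filter_upwards [notMem_tsupport_iff_eventuallyEq.1 h1] with y' hy'
      rw [hy']
      simp
  · simp only
    rw [χ.one_of_mem_closedBall (Metric.ball_subset_closedBall hy), one_smul]

/-! ### The normal form as a deformation of the nilpotent frame. -/

section NormalForm

variable {n : ℕ} {M : Type*} [TopologicalSpace M] [ChartedSpace (Coord n) M]
  [IsManifold 𝓘(ℝ, Coord n) ∞ M] {S : HorizontalMetric n M} {q₀ : M} {b : Fin n → ℝ}
  {X : HIdx n → ∀ q : M, TangentSpace 𝓘(ℝ, Coord n) q}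
  {φ : OpenPartialHomeomorph M (Coord n)}

/-- The frame in normal form, dilated. -/
theorem IsNormalForm.exists_dilated (hφ : IsNormalForm S q₀ b φ X) :
    ∃ Y : HIdx n → ℝ × Coord n → Coord n, IsNilpotentDeformation b Y ∧
      ∃ r > 0, Metric.ball 0 r ⊆ φ.target ∧ ∀ k ε y, dil ε y ∈ Metric.ball (0 : Coord n) r →
        dil ε (Y k (ε, y)) = ε • inCoord φ (X k) (dil ε y) := by
  have h0 : (0 : Coord n) ∈ φ.target := hφ.map_base ▸ φ.map_source hφ.mem_source
  -- The frame lives only on the chart. A cutoff makes it global, as the flow theory requires,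
  -- without changing it on a ball which will contain the trajectories.
  obtain ⟨r, hr, hsub, hext⟩ := exists_contDiff_extension (F := Coord n) φ.open_target h0
  choose A hA hAX using fun k => hext (inCoord φ (X k)) fun y hy =>
    contDiffAt_inCoord hφ.chart φ.open_source (hφ.frame.smooth k) hy (φ.map_target hy)
  have hAn : ∀ k, ContDiff ℝ ∞ fun v => A k v none := fun k =>
    (EuclideanSpace.proj (𝕜 := ℝ) none : Coord n →L[ℝ] ℝ).contDiff.comp (hA k)
  have hA0 : ∀ k, A k 0 = EuclideanSpace.single (some k) 1 := fun k =>
    (hAX k 0 (Metric.mem_ball_self hr)).trans (hφ.frame_base k)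
  have hd : ∀ k, fderiv ℝ (fun v => A k v none) 0 =
      fderiv ℝ (fun v => inCoord φ (X k) v none) 0 := fun k => by
    refine EventuallyEq.fderiv_eq ?_
    filter_upwards [Metric.ball_mem_nhds (0 : Coord n) hr] with y hy
    rw [hAX k y hy]
  have hv : ∀ k, vertScale 0 (A k 0) = EuclideanSpace.single (some k) 1 := fun k => by
    rw [hA0]
    exact Coord.ext (fun l => by simp) (by simp)
  refine ⟨fun k => dilField (A k) (hAn k), ⟨fun k => contDiff_dilField (hA k) (hAn k),
    fun i y => ?_, fun i y => ?_⟩, r, hr, hsub, fun k ε y hy => ?_⟩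
  · rw [dilField_zero, hv, hd, hφ.vertical_odd, vertScale_some]
  · rw [dilField_zero, hv, hd, hφ.vertical_even, vertScale_some]
  · rw [dil_dilField (hAn k) (by rw [hA0]; simp), hAX k _ hy]

end NormalForm
end
end ContactSR

namespace ContactSR
noncomputable section

set_option linter.unusedSectionVars false

/-! ### Dilated trajectories which remain in the chart. -/

section Trajectory

variable {n : ℕ} {b : Fin n → ℝ} {Y : HIdx n → ℝ × Coord n → Coord n}
  (hY : IsNilpotentDeformation b Y)

/-- The trajectory of the dilated Hamiltonian flow. -/
def dilPath (P : ℝ × Coord n) (t : ℝ) : PhaseSpace (Coord n) :=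
  extendPath (flowPath (hamMap Y hY.smooth) (initPt P)) t

theorem dilPath_one (P : ℝ × Coord n) : (dilPath hY P 1).2.1 = endPos hY P := by
  rw [dilPath, extendPath_of_mem _ (right_mem_Icc.2 zero_le_one)]
  rfl

variable {hY} {P : ℝ × Coord n}

theorem dilPath_zero (hP : P ∈ endDomain hY) : dilPath hY P 0 = initPt P := by
  rw [dilPath, extendPath_of_mem _ (left_mem_Icc.2 zero_le_one)]
  exact initial_of_defect (defect_flowPath hP)

theorem hasDerivWithinAt_dilPath (hP : P ∈ endDomain hY) {t : ℝ} (ht : t ∈ Icc (0 : ℝ) 1) :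
    HasDerivWithinAt (dilPath hY P) (hamField Y (dilPath hY P t)) (Icc 0 1) t :=
  hasDerivWithinAt_of_defect (defect_flowPath hP) ht

theorem dilPath_param (hP : P ∈ endDomain hY) {t : ℝ} (ht : t ∈ Icc (0 : ℝ) 1) :
    (dilPath hY P t).1 = P.1 := by
  have h1 : ∀ t ∈ Icc (0 : ℝ) 1, HasDerivWithinAt (fun t => (dilPath hY P t).1) 0 (Icc 0 1) t :=
    fun t ht => ((ContinuousLinearMap.fst ℝ ℝ (Coord n × (Coord n →L[ℝ] ℝ))).hasFDerivAt
      (x := dilPath hY P t)).comp_hasDerivWithinAt t (hasDerivWithinAt_dilPath hP ht)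
  have h2 := constant_of_has_deriv_right_zero (fun t ht => (h1 t ht).continuousWithinAt)
    (fun t ht => (h1 t ⟨ht.1, ht.2.le⟩).mono_of_mem_nhdsWithin (Icc_mem_nhdsGE_of_mem ht)) t ht
  rw [h2, dilPath_zero hP]
  rfl

variable (hY) in
/-- The parameters for which the dilated trajectory stays in the ball of radius `r`. -/
def goodDomain (r : ℝ) : Set (ℝ × Coord n) :=
  {P | P ∈ endDomain hY ∧ ∀ t : unitInterval, dil P.1 (dilPath hY P t).2.1 ∈ Metric.ball 0 r}

theorem zero_mem_goodDomain {r : ℝ} (hr : 0 < r) (q : Coord n) : ((0, q) : ℝ × Coord n) ∈ goodDomain hY r :=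
  ⟨zero_mem_endDomain hY q, fun t => by simpa [dil_zero] using hr⟩

/-- The trajectory depends continuously on the data jointly with time, and the time interval is
compact. -/
theorem isOpen_goodDomain (r : ℝ) : IsOpen (goodDomain hY r) := by
  rw [isOpen_iff_mem_nhds]
  rintro P ⟨hP, hr⟩
  have h1 : ∀ᶠ P' in 𝓝 P, ∀ t ∈ (univ : Set unitInterval),
      dil P'.1 (dilPath hY P' t).2.1 ∈ Metric.ball 0 r := by
    refine isCompact_univ.eventually_forall_of_forall_eventually fun t _ => ?_
    have h2 : ContinuousAt (fun z : (ℝ × Coord n) × unitInterval =>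
        flowPath (hamMap Y hY.smooth) (initPt z.1) z.2) (P, t) := by
      have h3 : ContinuousAt (fun z : (ℝ × Coord n) × unitInterval =>
          (flowPath (hamMap Y hY.smooth) (initPt z.1), z.2)) (P, t) :=
        (ContinuousAt.comp (f := Prod.fst) (x := (P, t))
          (contDiffAt_flowPath_initPt hY hP).continuousAt continuousAt_fst).prodMk continuousAt_snd
      exact ContinuousAt.comp (f := fun z : (ℝ × Coord n) × unitInterval =>
          (flowPath (hamMap Y hY.smooth) (initPt z.1), z.2)) continuous_eval.continuousAt h3
    have h4 : ContinuousAt (fun z : (ℝ × Coord n) × unitInterval =>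
        dil z.1.1 (flowPath (hamMap Y hY.smooth) (initPt z.1) z.2).2.1) (P, t) :=
      (contDiff_dil.continuous.continuousAt.comp
        (continuousAt_fst.comp continuousAt_fst)).clm_apply (continuousAt_fst.comp
          (continuousAt_snd.comp h2))
    have h5 : ∀ z : (ℝ × Coord n) × unitInterval, (dilPath hY z.1 z.2).2.1 =
        (flowPath (hamMap Y hY.smooth) (initPt z.1) z.2).2.1 := fun z => by
      rw [dilPath, extendPath_of_mem _ z.2.2]
    have h6 := h4.eventually (Metric.isOpen_ball.mem_nhds (by
      have := hr t
      rwa [h5 (P, t)] at this))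
    exact h6.mono fun z hz => by rw [h5 z]; exact hz
  filter_upwards [(isOpen_endDomain hY).mem_nhds hP, h1] with P' h2 h3
  exact ⟨h2, fun t => h3 t (mem_univ t)⟩

end Trajectory

/-! ### Hamilton equations under linear scalings. -/

section Transport

/-- The Hamilton equations are compatible with linear changes of coordinates and scalings. -/
theorem frameField_linear {V κ : Type*} [NormedAddCommGroup V] [NormedSpace ℝ V] [Fintype κ]
    {Y : κ → ℝ × V → V} {A : κ → V → V} {D D' : V →L[ℝ] V} (hD : ∀ v, D' (D v) = v)
    (hD' : ∀ v, D (D' v) = v) {ε : ℝ} (hε : ε ≠ 0) {y : V}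
    (hAd : ∀ k, DifferentiableAt ℝ (A k) (D y)) (hYd : ∀ k, DifferentiableAt ℝ (Y k) (ε, y))
    (hA : ∀ k, ∀ᶠ y' in 𝓝 y, D (Y k (ε, y')) = ε • A k (D y')) (ξ : V →L[ℝ] ℝ) :
    frameField A (D y, ε • ξ.comp D') =
      (ε⁻¹ • D (∑ k, ξ (Y k (ε, y)) • Y k (ε, y)),
        (-∑ k, ξ (Y k (ε, y)) • ξ.comp (posDeriv (Y k) (ε, y))).comp D') := by
  have h0 : ∀ k, D (Y k (ε, y)) = ε • A k (D y) := fun k => (hA k).self_of_nhds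
  have h1 : ∀ k, (ε • ξ.comp D') (A k (D y)) = ξ (Y k (ε, y)) := fun k => by
    rw [smul_apply, ContinuousLinearMap.comp_apply, ← map_smul, ← map_smul, ← h0, hD]
  have h2 : ∀ k v, D (posDeriv (Y k) (ε, y) v) = ε • fderiv ℝ (A k) (D y) (D v) := fun k v => by
    have e1 : HasFDerivAt (fun y => D (Y k (ε, y))) (D.comp (posDeriv (Y k) (ε, y))) y := by
      have e2 : HasFDerivAt (fun y : V => ((ε, y) : ℝ × V))
          (ContinuousLinearMap.inr ℝ ℝ V) y := hasFDerivAt_prodMk_right ε y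
      exact D.hasFDerivAt.comp y ((hYd k).hasFDerivAt.comp y e2)
    have e3 : HasFDerivAt (fun y => ε • A k (D y)) (ε • (fderiv ℝ (A k) (D y)).comp D) y :=
      ((hAd k).hasFDerivAt.comp y D.hasFDerivAt).const_smul ε
    exact DFunLike.congr_fun ((e1.congr_of_eventuallyEq (EventuallyEq.symm (hA k))).unique e3) v
  refine Prod.ext ?_ ?_
  · simp only [frameField, h1, map_sum, map_smul, h0, Finset.smul_sum]
    refine Finset.sum_congr rfl fun k _ => ?_
    rw [smul_comm, smul_smul ε⁻¹, inv_mul_cancel₀ hε, one_smul]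
  · simp only [frameField, h1]
    ext v
    simp only [neg_apply, sum_apply, smul_apply, ContinuousLinearMap.comp_apply, smul_eq_mul]
    congr 1
    refine Finset.sum_congr rfl fun k _ => ?_
    congr 1
    have h3 := h2 k (D' v)
    rw [hD'] at h3
    rw [← smul_eq_mul, ← map_smul, ← map_smul, ← h3, hD]

end Transport

/-! ### The exponential map and its critical points in dilated coordinates. -/

section Exponential

variable {n : ℕ} {M : Type*} [TopologicalSpace M] [T2Space M] [ChartedSpace (Coord n) M]
  [IsManifold 𝓘(ℝ, Coord n) ∞ M] {S : HorizontalMetric n M} {q₀ : M} {b : Fin n → ℝ}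
  {X : HIdx n → ∀ q : M, TangentSpace 𝓘(ℝ, Coord n) q}
  {φ : OpenPartialHomeomorph M (Coord n)}

theorem bijective_covOf : Function.Bijective (covOf : Coord n →L[ℝ] (Coord n →L[ℝ] ℝ)) := by
  refine ⟨fun q q' h => ?_, fun ξ => ⟨covComp ξ, covOf_covComp ξ⟩⟩
  ext o
  rw [← covOf_single q, ← covOf_single q', h]

/-- The covector at `q₀` whose trajectory on `[0, ε]` is the dilation of the trajectory with
initial covector `q`. -/
def dilCov (φ : OpenPartialHomeomorph M (Coord n)) (q₀ : M) (ε : ℝ) (q : Coord n) :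
    Coord n →L[ℝ] ℝ :=
  (ε • (covOf q).comp (dil ε⁻¹)).comp (chartDiff φ q₀)

/-- The dilation leaves horizontal components unchanged and multiplies the vertical one by ε. With
h₀ = 1/η and ε = ητ the latter becomes τ: rescaled time turns into a covector component. -/
theorem covector_eq_dilCov (φ : OpenPartialHomeomorph M (Coord n)) (q₀ : M) {ε : ℝ} (hε : ε ≠ 0)
    (h : HIdx n → ℝ) (h₀ : ℝ) :
    covector φ q₀ h h₀ = dilCov φ q₀ ε (coordMk h (ε * h₀)) := by
  rw [covector, dilCov]
  congr 1
  ext v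
  rw [covOf_coordMk]
  simp only [smul_apply, ContinuousLinearMap.comp_apply, linForm_apply, dil_some, dil_none,
    smul_eq_mul, mul_add, Finset.mul_sum]
  congr 1
  · exact Finset.sum_congr rfl fun k _ => by field_simp
  · field_simp

/-- The parametrization of covectors at `q₀` by their dilated components. -/
theorem exists_dilCovEquiv (hφ : IsNormalForm S q₀ b φ X) {ε : ℝ} (hε : ε ≠ 0) :
    ∃ L : Coord n ≃L[ℝ] (Coord n →L[ℝ] ℝ), ∀ q, L q = dilCov φ q₀ ε q := by
  have h1 := chartSymmDiff_comp_chartDiff hφ.chart hφ.mem_source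
  have h2 := chartDiff_comp_chartSymmDiff hφ.chart (φ.map_source hφ.mem_source)
  rw [φ.left_inv hφ.mem_source] at h2
  let f : Coord n →ₗ[ℝ] (Coord n →L[ℝ] ℝ) :=
    { toFun := dilCov φ q₀ ε
      map_add' := fun q q' => by simp [dilCov, ContinuousLinearMap.add_comp, smul_add]
      map_smul' := fun a q => by
        simp [dilCov, ContinuousLinearMap.smul_comp, smul_smul, mul_comm] }
  have hf : Function.Bijective f := by
    constructor
    · rw [injective_iff_map_eq_zero]
      intro q hq
      apply bijective_covOf.1
      rw [map_zero]
      ext v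
      have h3 := DFunLike.congr_fun hq (chartSymmDiff φ (φ q₀) (dil ε v))
      have h4 := DFunLike.congr_fun h2 (dil ε v)
      simp only [ContinuousLinearMap.comp_apply] at h4
      have h5 : (ε • (covOf q).comp (dil ε⁻¹)) (chartDiff φ q₀ (chartSymmDiff φ (φ q₀) (dil ε v))) =
        0 := h3
      rw [h4] at h5
      simp only [ContinuousLinearMap.id_apply, smul_apply, ContinuousLinearMap.comp_apply,
        dil_inv_dil hε, smul_eq_mul, mul_eq_zero, hε, false_or] at h5
      simpa using h5
    · intro p
      obtain ⟨q, hq⟩ := bijective_covOf.2 (ε⁻¹ • (p.comp (chartSymmDiff φ (φ q₀))).comp (dil ε))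
      refine ⟨q, ?_⟩
      ext v
      have h4 := DFunLike.congr_fun h1 v
      simp only [ContinuousLinearMap.comp_apply, ContinuousLinearMap.id_apply] at h4
      have h5 : f q v = ε * covOf q (dil ε⁻¹ (chartDiff φ q₀ v)) := rfl
      rw [h5, hq]
      simp only [smul_apply, ContinuousLinearMap.comp_apply, dil_dil_inv hε, h4, smul_eq_mul]
      rw [← mul_assoc, mul_inv_cancel₀ hε, one_mul]
  exact ⟨(LinearEquiv.ofBijective f hf).toContinuousLinearEquiv, fun q => rfl⟩

variable {Y : HIdx n → ℝ × Coord n → Coord n} {hY : IsNilpotentDeformation b Y} {r : ℝ}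

/-- The exponential map in normal coordinates. -/
theorem expMap_dilCov (hφ : IsNormalForm S q₀ b φ X)
    (hr : Metric.ball 0 r ⊆ φ.target)
    (hYX : ∀ k ε y, dil ε y ∈ Metric.ball (0 : Coord n) r →
      dil ε (Y k (ε, y)) = ε • inCoord φ (X k) (dil ε y)) 
    {P : ℝ × Coord n} (hP : P ∈ goodDomain hY r) (hε : 0 < P.1) :
    ExpDefined S q₀ P.1 (dilCov φ q₀ P.1 P.2) ∧
      expMap S q₀ P.1 (dilCov φ q₀ P.1 P.2) = φ.symm (dil P.1 (endPos hY P)) ∧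
      dil P.1 (endPos hY P) ∈ φ.target := by
  obtain ⟨ε, q⟩ := P
  simp only at hε ⊢
  have hε0 := hε.ne'
  have hmaps : MapsTo (fun t : ℝ => ε⁻¹ * t) (Icc 0 ε) (Icc 0 1) := fun t ht =>
    ⟨by have := ht.1; positivity, by rw [inv_mul_le_iff₀ hε]; simpa using ht.2⟩
  set y : ℝ → Coord n := fun t => dil ε (dilPath hY (ε, q) (ε⁻¹ * t)).2.1 with hy
  set ξ : ℝ → Coord n →L[ℝ] ℝ := fun t =>
    ε • (dilPath hY (ε, q) (ε⁻¹ * t)).2.2.comp (dil ε⁻¹) with hξ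
  have hball : ∀ t ∈ Icc 0 ε, y t ∈ Metric.ball (0 : Coord n) r := fun t ht =>
    hP.2 ⟨ε⁻¹ * t, hmaps ht⟩
  have hd : ∀ t ∈ Icc 0 ε, HasDerivWithinAt (fun t => dilPath hY (ε, q) (ε⁻¹ * t))
      (ε⁻¹ • hamField Y (dilPath hY (ε, q) (ε⁻¹ * t))) (Icc 0 ε) t := fun t ht => by
    have h1 : HasDerivWithinAt (fun t : ℝ => ε⁻¹ * t) ε⁻¹ (Icc 0 ε) t := by
      simpa using ((hasDerivAt_id t).const_mul ε⁻¹).hasDerivWithinAt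
    exact (hasDerivWithinAt_dilPath hP.1 (hmaps ht)).scomp t h1 hmaps
  have hfield : ∀ t ∈ Icc 0 ε, frameField (fun k => inCoord φ (X k)) (y t, ξ t) =
      (ε⁻¹ • dil ε (hamField Y (dilPath hY (ε, q) (ε⁻¹ * t))).2.1,
        ((hamField Y (dilPath hY (ε, q) (ε⁻¹ * t))).2.2.comp (dil ε⁻¹) : Coord n →L[ℝ] ℝ)) :=
    fun t ht => by
    have h1 : dilPath hY (ε, q) (ε⁻¹ * t) = (ε, (dilPath hY (ε, q) (ε⁻¹ * t)).2.1,
        (dilPath hY (ε, q) (ε⁻¹ * t)).2.2) := by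
      conv_lhs => rw [← Prod.mk.eta (p := dilPath hY (ε, q) (ε⁻¹ * t)),
        dilPath_param hP.1 (hmaps ht)]
    rw [h1]
    have h2 := hball t ht
    have hnear : ∀ᶠ y' in 𝓝 (dilPath hY (ε, q) (ε⁻¹ * t)).2.1,
        dil ε y' ∈ Metric.ball (0 : Coord n) r :=
      (dil ε).continuous.continuousAt.eventually (Metric.isOpen_ball.mem_nhds h2)
    exact frameField_linear (A := fun k => inCoord φ (X k)) (dil_inv_dil hε0) (dil_dil_inv hε0) hε0
      (fun k => (contDiffAt_inCoord hφ.chart φ.open_source (hφ.frame.smooth k) (hr h2)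
        (φ.map_target (hr h2))).differentiableAt (by simp))
      (fun k => (hY.smooth k).differentiable (by simp) _)
      (fun k => hnear.mono fun y' hy' => hYX k ε y' hy') _
  have hext : IsNormalExtremal S (ofChart φ y ξ) (Icc 0 ε) := by
    refine isNormalExtremal_ofChart hφ.chart hφ.frame (fun t ht => hr (hball t ht)) (fun t ht => ?_)
      fun t ht => ?_
    · rw [hfield t ht]
      have h1 := (((dil ε).comp ((ContinuousLinearMap.fst ℝ (Coord n) (Coord n →L[ℝ] ℝ)).comp
        (ContinuousLinearMap.snd ℝ ℝ (Coord n × (Coord n →L[ℝ] ℝ))))).hasFDerivAt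
          (x := dilPath hY (ε, q) (ε⁻¹ * t))).comp_hasDerivWithinAt t (hd t ht)
      refine h1.congr_deriv ?_
      rw [map_smul]
      rfl
    · rw [hfield t ht]
      have h1 := ((ContinuousLinearMap.snd ℝ (Coord n) (Coord n →L[ℝ] ℝ)).comp
        (ContinuousLinearMap.snd ℝ ℝ (Coord n × (Coord n →L[ℝ] ℝ)))).hasFDerivAt
          (x := dilPath hY (ε, q) (ε⁻¹ * t)) |>.comp_hasDerivWithinAt t (hd t ht)
      have h2 := (h1.clm_comp (hasDerivWithinAt_const t _ (dil ε⁻¹ : Coord n →L[ℝ] Coord n))).const_smul ε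
      refine h2.congr_deriv ?_
      rw [map_smul, ContinuousLinearMap.comp_zero, add_zero, ContinuousLinearMap.smul_comp,
        smul_smul, mul_inv_cancel₀ hε0, one_smul]
      rfl
  have h0 : ofChart φ y ξ 0 = (q₀, dilCov φ q₀ ε q) := by
    have h1 : dilPath hY (ε, q) (ε⁻¹ * 0) = (ε, 0, covOf q) := by
      rw [mul_zero, dilPath_zero hP.1]
      rfl
    have h2 : φ.symm (y 0) = q₀ := by
      rw [hy]
      simp only [h1, map_zero]
      rw [← hφ.map_base, φ.left_inv hφ.mem_source]
    rw [ofChart, h2, hξ]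
    simp only [h1]
    rfl
  have hmem : ∀ t ∈ Icc 0 ε, (ofChart φ y ξ t).1 ∈ φ.source := fun t ht =>
    φ.map_target (hr (hball t ht))
  have hlast : y ε = dil ε (endPos hY (ε, q)) := by
    rw [hy]
    simp only
    rw [inv_mul_cancel₀ hε0, dilPath_one]
  refine ⟨⟨_, h0, hext⟩, ?_, ?_⟩
  · rw [expMap_eq hφ.chart hφ.frame hε.le h0 hext hmem, ← hlast]
    rfl
  · rw [← hlast]
    exact hr (hball ε ⟨hε.le, le_rfl⟩)

/-- Conjugate times are the zeros of the Jacobian determinant. -/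
theorem mem_conjugateTimes_iff (hφ : IsNormalForm S q₀ b φ X)
    (hr : Metric.ball 0 r ⊆ φ.target)
    (hYX : ∀ k ε y, dil ε y ∈ Metric.ball (0 : Coord n) r →
      dil ε (Y k (ε, y)) = ε • inCoord φ (X k) (dil ε y)) 
    {P : ℝ × Coord n} (hP : P ∈ goodDomain hY r) (hε : 0 < P.1) :
    P.1 ∈ conjugateTimes S q₀ (dilCov φ q₀ P.1 P.2) ↔ (jac hY P).det = 0 := by
  obtain ⟨L, hL⟩ := exists_dilCovEquiv hφ hε.ne'
  -- Openness of `goodDomain` gives the formula for all nearby covectors, so it can be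
  -- differentiated.
  have hev : expMap S q₀ P.1 =ᶠ[𝓝 (dilCov φ q₀ P.1 P.2)]
      fun p => φ.symm (dil P.1 (endPos hY (P.1, L.symm p))) := by
    have h1 : ContinuousAt (fun p => ((P.1, L.symm p) : ℝ × Coord n)) (dilCov φ q₀ P.1 P.2) :=
      continuousAt_const.prodMk L.symm.continuous.continuousAt
    have h2 : ∀ᶠ p in 𝓝 (dilCov φ q₀ P.1 P.2), ((P.1, L.symm p) : ℝ × Coord n) ∈
        goodDomain hY r := h1 ((isOpen_goodDomain r).mem_nhds (by
          simp only [← hL, L.symm_apply_apply]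
          exact hP))
    filter_upwards [h2] with p hp
    have h3 := (expMap_dilCov hφ hr hYX hp hε).2.1
    rw [← h3]
    simp only
    rw [← hL, L.apply_symm_apply]
  have hd : HasFDerivAt (fun p => dil P.1 (endPos hY (P.1, L.symm p)))
      ((dil P.1).comp (((fderiv ℝ (endPos hY) P).comp
        (ContinuousLinearMap.inr ℝ ℝ (Coord n))).comp (L.symm : (Coord n →L[ℝ] ℝ) →L[ℝ] Coord n)))
      (dilCov φ q₀ P.1 P.2) := by
    have h1 : L.symm (dilCov φ q₀ P.1 P.2) = P.2 := by rw [← hL, L.symm_apply_apply]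
    have h2 : HasFDerivAt (endPos hY) (fderiv ℝ (endPos hY) P)
        ((P.1, L.symm (dilCov φ q₀ P.1 P.2)) : ℝ × Coord n) := by
      rw [h1]
      exact ((contDiffAt_endPos hY hP.1).differentiableAt (by simp)).hasFDerivAt
    have h3 := h2.comp _ (hasFDerivAt_prodMk_right P.1 (L.symm (dilCov φ q₀ P.1 P.2)))
    have h4 := h3.comp (dilCov φ q₀ P.1 P.2)
      (L.symm : (Coord n →L[ℝ] ℝ) →L[ℝ] Coord n).hasFDerivAt
    exact (dil P.1).hasFDerivAt.comp _ h4
  obtain ⟨hdef, -, htar⟩ := expMap_dilCov hφ hr hYX hP hε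
  have hval : dil P.1 (endPos hY (P.1, L.symm (dilCov φ q₀ P.1 P.2))) = dil P.1 (endPos hY P) := by
    rw [← hL, L.symm_apply_apply]
  have hmf : HasMFDerivAt 𝓘(ℝ, Coord n →L[ℝ] ℝ) 𝓘(ℝ, Coord n) (expMap S q₀ P.1)
      (dilCov φ q₀ P.1 P.2) ((chartSymmDiff φ (dil P.1 (endPos hY P))).comp
        ((dil P.1).comp (((fderiv ℝ (endPos hY) P).comp
        (ContinuousLinearMap.inr ℝ ℝ (Coord n))).comp
          (L.symm : (Coord n →L[ℝ] ℝ) →L[ℝ] Coord n)))) := by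
    have h1 := ((mdifferentiable_of_mem_maximalAtlas hφ.chart).mdifferentiableAt_symm
      htar).hasMFDerivAt
    rw [← hval] at h1 ⊢
    exact (HasMFDerivAt.comp (f := fun p => dil P.1 (endPos hY (P.1, L.symm p)))
      (dilCov φ q₀ P.1 P.2) h1 hd.hasMFDerivAt).congr_of_eventuallyEq hev
  -- The chart differential, the dilation and the parametrization of covectors are bijective, so
  -- only the covector derivative of `endPos` can fail to be surjective.
  have hsurj : Function.Surjective (mfderiv 𝓘(ℝ, Coord n →L[ℝ] ℝ) 𝓘(ℝ, Coord n)
      (expMap S q₀ P.1) (dilCov φ q₀ P.1 P.2)) ↔ (jac hY P).det ≠ 0 := by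
    rw [hmf.mfderiv]
    have hb1 : Function.Bijective (chartSymmDiff φ (dil P.1 (endPos hY P))) :=
      (mdifferentiable_of_mem_maximalAtlas hφ.chart).symm.mfderiv_bijective htar
    have hb2 : Function.Bijective (dil P.1 : Coord n →L[ℝ] Coord n) :=
      Function.bijective_iff_has_inverse.2 ⟨dil P.1⁻¹, dil_inv_dil hε.ne', dil_dil_inv hε.ne'⟩
    set D : Coord n → Coord n := fun v => fderiv ℝ (endPos hY) P (0, v) with hD
    have hcomp : Function.Surjective (fun p : Coord n →L[ℝ] ℝ =>
        chartSymmDiff φ (dil P.1 (endPos hY P)) (dil P.1 (D (L.symm p)))) ↔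
        Function.Surjective D := by
      have e1 := (hb1.comp hb2).surjective.of_comp_left
      constructor
      · intro h v
        obtain ⟨p, hp⟩ := h (chartSymmDiff φ (dil P.1 (endPos hY P)) (dil P.1 v))
        exact ⟨L.symm p, (hb1.comp hb2).1 hp⟩
      · intro h
        exact (hb1.comp hb2).2.comp (h.comp L.symm.surjective)
    refine Iff.trans ?_ (hcomp.trans ?_)
    · exact Iff.rfl
    · rw [← isUnit_iff_ne_zero, ← Matrix.isUnit_iff_isUnit_det,
        ← Matrix.mulVec_surjective_iff_isUnit]
      constructor
      · intro h w
        obtain ⟨v, hv⟩ := h (WithLp.toLp 2 w)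
        refine ⟨v, funext fun o => ?_⟩
        rw [jac_mulVec]
        exact congrArg (fun v : Coord n => v o) hv
      · intro h w
        obtain ⟨v, hv⟩ := h w
        refine ⟨WithLp.toLp 2 v, ?_⟩
        ext o
        rw [← hv]
        exact (jac_mulVec hY P (WithLp.toLp 2 v) o).symm
  rw [conjugateTimes, mem_ofPred_eq, hsurj, not_not]
  exact ⟨fun h => h.2.2, fun h => ⟨hε, hdef, h⟩⟩

end Exponential
end
end ContactSR

/-! ### Expansion of the exponential map in powers of √η. -/

namespace ContactSR
noncomputable section

set_option linter.unusedSectionVars false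

/-- Mixed third-order expansion along `s ↦ (s² τ, q + s v)`. -/
theorem param_expansion {E F : Type*} [NormedAddCommGroup E] [NormedSpace ℝ E]
    [NormedAddCommGroup F] [NormedSpace ℝ F] {f : ℝ × E → F} {q : E}
    (hf : ContDiffAt ℝ ∞ f (0, q)) (v : E) {τ : ℝ} (hτ : 0 < τ) :
    (fun s : ℝ => f (s ^ 2 * τ, q + s • v) - f (0, q + s • v) -
      (s ^ 2 * τ) • (fderiv ℝ f (0, q) (1, 0) +
        s • fderiv ℝ (fun P => fderiv ℝ f P (1, 0)) (0, q) (0, v)))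
      =o[𝓝 0] fun s : ℝ => s ^ 3 := by
  set g : ℝ × E → F := fun P => fderiv ℝ f P (1, 0) with hg
  set G := fderiv ℝ g (0, q) with hG
  have hgd : HasFDerivAt g G (0, q) :=
    (((hf.fderiv_right (m := 1) (by norm_cast)).clm_apply contDiffAt_const).differentiableAt
      (by simp)).hasFDerivAt
  have hfd : ∀ᶠ P in 𝓝 ((0, q) : ℝ × E), DifferentiableAt ℝ f P := by
    filter_upwards [(hf.of_le (m := 1) (by norm_cast)).eventually (by simp)] with P hP
    exact hP.differentiableAt (by simp)
  rw [Asymptotics.isLittleO_iff]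
  intro c hc
  set κ := c / τ with hκ
  have hκ0 : 0 < κ := by positivity
  set c₁ := κ / (2 * (τ + ‖v‖)) with hc₁
  have hc₁0 : 0 < c₁ := by positivity
  obtain ⟨r, hr, hball⟩ := Metric.eventually_nhds_iff_ball.1
    (hfd.and ((Asymptotics.isLittleO_iff.1 hgd.isLittleO) hc₁0))
  have e1 : ∀ᶠ s : ℝ in 𝓝 0, |s| * (τ * ‖G (1, 0)‖) < κ / 2 := by
    have : Continuous fun s : ℝ => |s| * (τ * ‖G (1, 0)‖) := by fun_prop
    exact this.continuousAt.eventually (gt_mem_nhds (by simpa using half_pos hκ0))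
  have e2 : ∀ᶠ s : ℝ in 𝓝 0, |s| * (τ + ‖v‖) < r := by
    have : Continuous fun s : ℝ => |s| * (τ + ‖v‖) := by fun_prop
    exact this.continuousAt.eventually (gt_mem_nhds (by simpa using hr))
  have e3 : ∀ᶠ s : ℝ in 𝓝 0, |s| < 1 :=
    continuous_abs.continuousAt.eventually (gt_mem_nhds (by simp))
  filter_upwards [e1, e2, e3] with s h1 h2 h3
  have hs2 : s ^ 2 = |s| * |s| := by rw [← sq, sq_abs]
  have hs0 := abs_nonneg s
  have hle : 0 ≤ s ^ 2 * τ := by positivity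
  have hnorm : ∀ ε ∈ Icc 0 (s ^ 2 * τ), ‖((ε, q + s • v) : ℝ × E) - (0, q)‖ ≤ |s| * (τ + ‖v‖) := by
    intro ε hε
    have h4 : ((ε, q + s • v) : ℝ × E) - (0, q) = (ε, s • v) := by simp
    rw [h4, Prod.norm_def, norm_smul, Real.norm_eq_abs, Real.norm_eq_abs, abs_of_nonneg hε.1]
    refine max_le ?_ ?_
    · have : |s| * |s| * τ ≤ |s| * 1 * τ := by gcongr
      have := norm_nonneg v
      nlinarith [hε.2]
    · nlinarith
  -- The mean value inequality in the parameter alone, at fixed q + s v: the derivative in ε is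
  -- approximated to o(s) on an interval of length s²τ, which gives o(s³).
  have key := norm_image_sub_le_of_norm_deriv_le_segment' (a := 0) (b := s ^ 2 * τ)
    (f := fun ε : ℝ => f (ε, q + s • v) - ε • (g (0, q) + s • G (0, v)))
    (f' := fun ε => g (ε, q + s • v) - (g (0, q) + s • G (0, v))) (C := κ * |s|)
    (fun ε hε => by
      have h4 : DifferentiableAt ℝ f (ε, q + s • v) :=
        (hball _ (by rw [mem_ball_iff_norm]; exact (hnorm ε hε).trans_lt h2)).1
      have h5 : HasDerivAt (fun ε : ℝ => ((ε, q + s • v) : ℝ × E)) (1, 0) ε :=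
        (hasDerivAt_id ε).prodMk (hasDerivAt_const _ _)
      have h6 := (h4.hasFDerivAt.comp_hasDerivAt ε h5).sub
        ((hasDerivAt_id ε).smul_const (g (0, q) + s • G (0, v)))
      rw [one_smul] at h6
      exact h6.hasDerivWithinAt)
    (fun ε hε => by
      have hε' : ε ∈ Icc 0 (s ^ 2 * τ) := ⟨hε.1, hε.2.le⟩
      have h4 := (hball _ (by rw [mem_ball_iff_norm]; exact (hnorm ε hε').trans_lt h2)).2
      have h5 : g (ε, q + s • v) - (g (0, q) + s • G (0, v)) =
          (g (ε, q + s • v) - g (0, q) - G ((ε, q + s • v) - (0, q))) + ε • G (1, 0) := by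
        have h6 : ((ε, q + s • v) : ℝ × E) - (0, q) = ε • ((1, 0) : ℝ × E) + s • ((0, v) : ℝ × E) := by
          simp
        rw [h6, map_add, map_smul, map_smul]
        abel
      rw [h5]
      refine (norm_add_le _ _).trans ?_
      rw [norm_smul, Real.norm_eq_abs, abs_of_nonneg hε.1]
      have h7 : c₁ * ‖((ε, q + s • v) : ℝ × E) - (0, q)‖ ≤ κ / 2 * |s| := by
        calc c₁ * ‖((ε, q + s • v) : ℝ × E) - (0, q)‖ ≤ c₁ * (|s| * (τ + ‖v‖)) := by
              gcongr; exact hnorm ε hε'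
          _ = κ / 2 * |s| := by rw [hc₁]; field_simp
      have h8 : ε * ‖G (1, 0)‖ ≤ κ / 2 * |s| := by
        calc ε * ‖G (1, 0)‖ ≤ (s ^ 2 * τ) * ‖G (1, 0)‖ := by gcongr; exact hε.2.le
          _ = |s| * (|s| * (τ * ‖G (1, 0)‖)) := by rw [hs2]; ring
          _ ≤ |s| * (κ / 2) := by gcongr
          _ = κ / 2 * |s| := by ring
      linarith)
    (s ^ 2 * τ) ⟨hle, le_rfl⟩
  have h9 : f (s ^ 2 * τ, q + s • v) - f (0, q + s • v) -
      (s ^ 2 * τ) • (g (0, q) + s • G (0, v)) =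
      f (s ^ 2 * τ, q + s • v) - (s ^ 2 * τ) • (g (0, q) + s • G (0, v)) -
        (f (0, q + s • v) - (0 : ℝ) • (g (0, q) + s • G (0, v))) := by
    rw [zero_smul, sub_zero]
    abel
  rw [h9]
  refine key.trans (le_of_eq ?_)
  rw [Real.norm_eq_abs, abs_pow, sub_zero, hs2, hκ]
  field_simp

section Expansion

variable {n : ℕ} [NeZero n] {b : Fin n → ℝ} {Y : HIdx n → ℝ × Coord n → Coord n}
  (hY : IsNilpotentDeformation b Y)

/-- The coefficients of the expansion of the exponential map in powers of `√η`. -/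
def expCoeff (k : ℕ) (τ : ℝ) (h : HIdx n → ℝ) : Coord n :=
  match k with
  | 2 => τ • vertScale 0 (endPos hY (scaledPt h (0, τ)))
  | 3 => τ • vertScale 0 (fderiv ℝ (endPos hY) (scaledPt h (0, τ)) (0, firstPair h))
  | 4 => τ ^ 2 • vertScale 0 (fderiv ℝ (endPos hY) (scaledPt h (0, τ)) (1, 0)) +
      τ ^ 2 • vertProj (endPos hY (scaledPt h (0, τ)))
  | 5 => τ ^ 2 • vertScale 0 (fderiv ℝ (fun P => fderiv ℝ (endPos hY) P (1, 0))
        (scaledPt h (0, τ)) (0, firstPair h)) +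
      τ ^ 2 • vertProj (fderiv ℝ (endPos hY) (scaledPt h (0, τ)) (0, firstPair h))
  | _ => 0

/-- For the nilpotent problem the horizontal position is linear in the horizontal momentum. -/
theorem endPos_nil_hor (q v : Coord n) (hv : v none = 0) (s : ℝ) :
    vertScale 0 (endPos hY (0, q + s • v)) = vertScale 0 (endPos hY (0, q)) +
      s • vertScale 0 (fderiv ℝ (endPos hY) (0, q) (0, v)) := by
  have hlin : ∀ s : ℝ, vertScale 0 (endPos hY (0, q + s • v)) = vertScale 0 (endPos hY (0, q)) +
      s • coordMk (nilHor b (fun k => v (some k)) (q none) 1) 0 := fun s => by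
    rw [endPos_nil, endPos_nil]
    refine Coord.ext (fun k => ?_) (by simp)
    simp only [vertScale_some, coordMk_some, PiLp.add_apply, PiLp.smul_apply, hv,
      smul_eq_mul, mul_zero, add_zero, nilHor]
    split_ifs <;> ring
  have h1 : HasDerivAt (fun s : ℝ => vertScale 0 (endPos hY (0, q + s • v)))
      (vertScale 0 (fderiv ℝ (endPos hY) (0, q) (0, v))) 0 := by
    have h2 : HasDerivAt (fun s : ℝ => ((0, q + s • v) : ℝ × Coord n)) (0, v) 0 :=
      (hasDerivAt_const _ _).prodMk (by simpa using ((hasDerivAt_id (0 : ℝ)).smul_const v).const_add q)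
    have h3 : HasFDerivAt (endPos hY) (fderiv ℝ (endPos hY) (0, q))
        ((0, q + (0 : ℝ) • v) : ℝ × Coord n) := by
      rw [zero_smul, add_zero]
      exact ((contDiffAt_endPos hY (zero_mem_endDomain hY q)).differentiableAt (by simp)).hasFDerivAt
    have h5 := h3.comp_hasDerivAt (0 : ℝ) h2
    exact (vertScale 0).hasFDerivAt.comp_hasDerivAt (0 : ℝ) h5
  have h4 : HasDerivAt (fun s : ℝ => vertScale 0 (endPos hY (0, q + s • v)))
      (coordMk (nilHor b (fun k => v (some k)) (q none) 1) 0) 0 := by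
    rw [funext hlin]
    simpa using ((hasDerivAt_id (0 : ℝ)).smul_const
      (coordMk (nilHor b (fun k => v (some k)) (q none) 1) 0 : Coord n)).const_add
        (vertScale 0 (endPos hY (0, q)))
  rw [h1.unique h4, hlin s]

/-- The dilation weighs horizontal components by s²τ and vertical ones by s⁴τ². Order five therefore
needs the horizontal end point up to s³ but the vertical one only up to s. -/
theorem dil_endPos_expansion (h : HIdx n → ℝ) {τ : ℝ} (hτ : 0 < τ) :
    (fun s : ℝ => dil (s ^ 2 * τ) (endPos hY (scaledPt h (s, τ))) -
      ∑ k ∈ Finset.range (5 + 1), s ^ k • expCoeff hY k τ h) =o[𝓝 0] fun s : ℝ => s ^ 5 := by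
  set q := (scaledPt h (0, τ)).2 with hq
  set v := firstPair h with hv
  have hP0 : scaledPt h (0, τ) = (0, q) := by rw [hq, scaledPt_zero]
  have hP : ∀ s, scaledPt h (s, τ) = (s ^ 2 * τ, q + s • v) := fun s => by
    rw [scaledPt_eq, hP0]
    simp [hv]
  have hsm := contDiffAt_endPos hY (zero_mem_endDomain hY q)
  have h1 := param_expansion hsm v hτ
  set err₁ : ℝ → Coord n := fun s => endPos hY (s ^ 2 * τ, q + s • v) - endPos hY (0, q + s • v) -
      (s ^ 2 * τ) • (fderiv ℝ (endPos hY) (0, q) (1, 0) +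
        s • fderiv ℝ (fun P => fderiv ℝ (endPos hY) P (1, 0)) (0, q) (0, v)) with herr₁
  set err₂ : ℝ → Coord n := fun s => endPos hY (s ^ 2 * τ, q + s • v) - endPos hY (0, q) -
    s • fderiv ℝ (endPos hY) (0, q) (0, v) with herr₂
  have h2 : err₂ =o[𝓝 0] fun s : ℝ => s := by
    have h3 : HasDerivAt (fun s : ℝ => ((s ^ 2 * τ, q + s • v) : ℝ × Coord n)) (0, v) 0 := by
      refine HasDerivAt.prodMk ?_ ?_
      · simpa using ((hasDerivAt_id (0 : ℝ)).pow 2).mul_const τ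
      · simpa using ((hasDerivAt_id (0 : ℝ)).smul_const v).const_add q
    have h4 : HasFDerivAt (endPos hY) (fderiv ℝ (endPos hY) (0, q))
        (((0 : ℝ) ^ 2 * τ, q + (0 : ℝ) • v) : ℝ × Coord n) := by
      simpa using (hsm.differentiableAt (by simp)).hasFDerivAt
    have h5 := (h4.comp_hasDerivAt (0 : ℝ) h3).isLittleO
    simpa [herr₂, Function.comp_def] using h5
  have h3 : ∀ s, dil (s ^ 2 * τ) (endPos hY (scaledPt h (s, τ))) -
      ∑ k ∈ Finset.range (5 + 1), s ^ k • expCoeff hY k τ h =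
      (s ^ 2 * τ) • vertScale 0 (err₁ s) + (s ^ 4 * τ ^ 2) • vertProj (err₂ s) := fun s => by
    have e1 : ∀ y : Coord n, dil (s ^ 2 * τ) y =
        (s ^ 2 * τ) • vertScale 0 y + (s ^ 4 * τ ^ 2) • vertProj y := fun y =>
      Coord.ext (fun k => by simp [vertProj]) (by simp [vertProj]; left; ring)
    -- At ε = 0 the horizontal part is exactly affine in s, so no pure s² or s³ terms occur.
    have e2 := endPos_nil_hor hY q v rfl s
    simp only [Finset.sum_range_succ, Finset.sum_range_zero, expCoeff, smul_zero, zero_add, hP0, e1,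
      hP s, herr₁, herr₂, map_sub, map_add, map_smul, e2, ← hv]
    module
  rw [funext h3]
  refine Asymptotics.IsLittleO.add ?_ ?_
  · have h4 : (fun s => vertScale 0 (err₁ s)) =o[𝓝 0] fun s : ℝ => s ^ 3 :=
      ((vertScale 0 : Coord n →L[ℝ] Coord n).isBigO_comp err₁ _).trans_isLittleO h1
    have h5 : (fun s : ℝ => s ^ 2 * τ) =O[𝓝 0] fun s : ℝ => s ^ 2 := by
      simpa [mul_comm] using (Asymptotics.isBigO_refl (fun s : ℝ => s ^ 2) (𝓝 0)).const_mul_left τ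
    refine (h5.smul_isLittleO h4).congr_right fun s => ?_
    rw [smul_eq_mul]
    ring
  · have h4 : (fun s => vertProj (err₂ s)) =o[𝓝 0] fun s : ℝ => s :=
      ((vertProj : Coord n →L[ℝ] Coord n).isBigO_comp err₂ _).trans_isLittleO h2
    have h5 : (fun s : ℝ => s ^ 4 * τ ^ 2) =O[𝓝 0] fun s : ℝ => s ^ 4 := by
      simpa [mul_comm] using (Asymptotics.isBigO_refl (fun s : ℝ => s ^ 4) (𝓝 0)).const_mul_left (τ ^ 2)
    refine (h5.smul_isLittleO h4).congr_right fun s => ?_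
    rw [smul_eq_mul]
    ring

theorem contDiff_scaledPt_zero (τ : ℝ) :
    ContDiff ℝ ∞ fun h : HIdx n → ℝ => scaledPt h (0, τ) := by
  simp only [scaledPt_zero]
  refine contDiff_const.prodMk (contDiff_euclidean.2 fun o => ?_)
  rcases o with _ | k
  · exact contDiff_const
  · simp only [coordMk_some]
    split_ifs
    · exact contDiff_const
    · exact contDiff_apply ℝ ℝ k

/-- The direction `(h_1, h_2, 0, …, 0)` as a linear map. -/
def firstPairMap : (HIdx n → ℝ) →L[ℝ] Coord n :=
  ∑ a : Fin 2, (ContinuousLinearMap.proj (R := ℝ) (φ := fun _ : HIdx n => ℝ) (0, a)).smulRight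
    (EuclideanSpace.single (some (0, a)) 1)

theorem firstPairMap_apply (h : HIdx n → ℝ) : firstPairMap h = firstPair h := by
  refine Coord.ext (fun k => ?_) ?_
  · obtain ⟨i, a⟩ := k
    simp only [firstPairMap, firstPair, Fin.sum_univ_two, coordMk_some]
    by_cases hi : i = 0
    · subst hi
      fin_cases a <;> simp
    · simp [hi]
  · simp [firstPairMap, firstPair]

theorem differentiable_expCoeff_five (τ : ℝ) : Differentiable ℝ (expCoeff hY 5 τ) := by
  intro h
  have hP : scaledPt h (0, τ) ∈ endDomain hY := scaledPt_zero_mem hY h τ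
  have h1 : ContDiffAt ℝ 2 (fderiv ℝ (endPos hY)) (scaledPt h (0, τ)) :=
    (contDiffAt_endPos hY hP).fderiv_right (by norm_cast)
  have h2 : ContDiffAt ℝ 1 (fderiv ℝ fun P => fderiv ℝ (endPos hY) P (1, 0)) (scaledPt h (0, τ)) :=
    (h1.clm_apply contDiffAt_const).fderiv_right (by norm_num)
  have h3 := ((contDiff_scaledPt_zero τ).contDiffAt (x := h)).of_le
    (show (1 : WithTop ℕ∞) ≤ ∞ by norm_cast)
  have h4 : ContDiffAt ℝ 1 (fun h : HIdx n → ℝ => ((0, firstPair h) : ℝ × Coord n)) h := by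
    simp only [← firstPairMap_apply]
    exact contDiffAt_const.prodMk firstPairMap.contDiff.contDiffAt
  have h5 := (h2.comp h h3).clm_apply h4
  have h6 := ((h1.of_le (by norm_num)).comp h h3).clm_apply h4
  exact ((((vertScale 0).contDiff.contDiffAt.comp h h5).const_smul (τ ^ 2)).add
    ((vertProj.contDiff.contDiffAt.comp h h6).const_smul (τ ^ 2))).differentiableAt (by simp)

/-- The base point at s = 0 ignores h₁ and h₂, so the coefficient is affine in them and its gradient
is a mixed derivative, first in ε and then in the covector. Symmetry of second derivatives turns it
into the ε-derivative of the Jacobian entry; the vertical terms do not contribute. -/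
theorem gradG_expCoeff (h : HIdx n → ℝ) :
    gradG (expCoeff hY 5 (2 * Real.pi / b 0)) h = gammaMat hY h := by
  set τ := 2 * Real.pi / b 0 with hτ
  funext i j
  have hP : scaledPt h (0, τ) ∈ endDomain hY := scaledPt_zero_mem hY h τ
  set B := fderiv ℝ (fun P => fderiv ℝ (endPos hY) P (1, 0)) (scaledPt h (0, τ)) with hB
  set C := fderiv ℝ (endPos hY) (scaledPt h (0, τ)) with hC
  set e : HIdx n → ℝ := Pi.single (0, j) 1 with he
  have hpair : firstPair e = EuclideanSpace.single (some (0, j)) 1 := by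
    refine Coord.ext (fun k => ?_) (by simp [firstPair])
    obtain ⟨l, a⟩ := k
    simp only [firstPair, coordMk_some, he, Pi.single_apply, PiLp.single_apply, Option.some.injEq]
    by_cases hl : l = 0
    · simp [hl]
    · simp [hl]
  have hpt : ∀ r : ℝ, scaledPt (h + r • e) (0, τ) = scaledPt h (0, τ) := fun r => by
    rw [scaledPt_zero, scaledPt_zero]
    congr 2
    funext k
    split_ifs with hk
    · rfl
    · have : k ≠ (0, j) := fun h => hk (by rw [h])
      simp [he, this]
  have hline : ∀ r : ℝ, expCoeff hY 5 τ (h + r • e) = expCoeff hY 5 τ h +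
      r • (τ ^ 2 • vertScale 0 (B (0, firstPair e)) + τ ^ 2 • vertProj (C (0, firstPair e))) :=
    fun r => by
    have h1 : ((0, firstPair (h + r • e)) : ℝ × Coord n) =
        (0, firstPair h) + r • (0, firstPair e) := by
      rw [← firstPairMap_apply, map_add, map_smul, firstPairMap_apply, firstPairMap_apply]
      simp
    simp only [expCoeff, hpt, h1, map_add, map_smul, ← hB, ← hC]
    module
  have hd1 : HasDerivAt (fun r : ℝ => expCoeff hY 5 τ (h + r • e))
      (fderiv ℝ (expCoeff hY 5 τ) h e) 0 := by
    have h2 : HasDerivAt (fun r : ℝ => h + r • e) e 0 := by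
      simpa using ((hasDerivAt_id (0 : ℝ)).smul_const e).const_add h
    have h3 : HasFDerivAt (expCoeff hY 5 τ) (fderiv ℝ (expCoeff hY 5 τ) h) (h + (0 : ℝ) • e) := by
      rw [zero_smul, add_zero]
      exact (differentiable_expCoeff_five hY τ h).hasFDerivAt
    exact h3.comp_hasDerivAt (0 : ℝ) h2
  have hd2 : HasDerivAt (fun r : ℝ => expCoeff hY 5 τ (h + r • e))
      (τ ^ 2 • vertScale 0 (B (0, firstPair e)) + τ ^ 2 • vertProj (C (0, firstPair e))) 0 := by
    rw [funext hline]
    simpa using ((hasDerivAt_id (0 : ℝ)).smul_const (τ ^ 2 • vertScale 0 (B (0, firstPair e)) +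
      τ ^ 2 • vertProj (C (0, firstPair e)))).const_add (expCoeff hY 5 τ h)
  have h4 : gradG (expCoeff hY 5 τ) h i j = τ ^ 2 * B (0, firstPair e) (some (0, i)) := by
    rw [gradG, ← he, hd1.unique hd2]
    simp [vertProj]
  rw [h4, gammaMat, ← hτ, hpair]
  congr 1
  have hsm := contDiffAt_endPos hY hP
  have hdd : DifferentiableAt ℝ (fderiv ℝ (endPos hY)) (scaledPt h (0, τ)) :=
    (hsm.fderiv_right (m := 1) (by norm_cast)).differentiableAt (by simp)
  have hsymm : IsSymmSndFDerivAt ℝ (endPos hY) (scaledPt h (0, τ)) := hsm.isSymmSndFDerivAt (by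
    rw [minSmoothness_of_isRCLikeNormedField]
    exact (WithTop.coe_le_coe.2 le_top : ((2 : ℕ∞) : WithTop ℕ∞) ≤ ((⊤ : ℕ∞) : WithTop ℕ∞)))
  have hd3 : ∀ v w : ℝ × Coord n, fderiv ℝ (fun P => fderiv ℝ (endPos hY) P v) (scaledPt h (0, τ)) w =
      fderiv ℝ (fderiv ℝ (endPos hY)) (scaledPt h (0, τ)) w v := fun v w => by
    have h5 := (hdd.hasFDerivAt.clm_apply (hasFDerivAt_const v (scaledPt h (0, τ)))).fderiv
    rw [h5]
    simp
  have hd4 : fderiv ℝ (fun P => jac hY P (some (0, i)) (some (0, j))) (scaledPt h (0, τ)) (1, 0) =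
      fderiv ℝ (fun P => fderiv ℝ (endPos hY) P (0, EuclideanSpace.single (some (0, j)) 1))
        (scaledPt h (0, τ)) (1, 0) (some (0, i)) := by
    have h5 := ((EuclideanSpace.proj (𝕜 := ℝ) (some ((0 : Fin n), i)) : Coord n →L[ℝ] ℝ).hasFDerivAt.comp
      (scaledPt h (0, τ)) (hdd.clm_apply (differentiableAt_const
        ((0, EuclideanSpace.single (some (0, j)) 1) : ℝ × Coord n))).hasFDerivAt).fderiv
    have h6 := DFunLike.congr_fun h5 (1, 0)
    exact h6
  rw [hd4, hB, hd3, hd3, hsymm.eq]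

end Expansion
end
end ContactSR

namespace ContactSR
noncomputable section

set_option linter.unusedSectionVars false

/-! ### The polynomial P as a characteristic polynomial. -/

section Quadratic

variable {n : ℕ} [NeZero n] {b : Fin n → ℝ} {Y : HIdx n → ℝ × Coord n → Coord n}
  (hY : IsNilpotentDeformation b Y) {h : HIdx n → ℝ}

/-- The determinant of γ minus a multiple of h hᵀ has no term quadratic in that multiple, since h hᵀ
has rank one; multiplication by −K therefore clears all denominators. -/
theorem polyP_eq (hK : constK b h ≠ 0) (x : ℝ) :
    polyP b h (gammaMat hY h) x =
      -constK b h * (x ^ 2 + (limitMat hY h).trace * x + (limitMat hY h).det) := by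
  rw [Matrix.trace_fin_two, Matrix.det_fin_two]
  simp only [polyP, coeffOne, coeffZero, limitMat, Matrix.of_apply]
  field_simp
  ring

theorem discP_eq (hK : constK b h ≠ 0) :
    discP b h (gammaMat hY h) =
      constK b h ^ 2 * ((limitMat hY h).trace ^ 2 - 4 * (limitMat hY h).det) := by
  rw [Matrix.trace_fin_two, Matrix.det_fin_two]
  simp only [discP, discrim, coeffOne, coeffZero, limitMat, Matrix.of_apply]
  field_simp
  ring

theorem exists_roots {t d : ℝ} (hD : 0 ≤ t ^ 2 - 4 * d) :
    ∃ δ δ' : ℝ, δ ≤ δ' ∧ t = -(δ + δ') ∧ d = δ * δ' := by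
  have h := Real.sqrt_nonneg (t ^ 2 - 4 * d)
  have h2 := Real.sq_sqrt hD
  exact ⟨(-t - √(t ^ 2 - 4 * d)) / 2, (-t + √(t ^ 2 - 4 * d)) / 2, by linarith, by ring,
    by linarith⟩

end Quadratic

/-! ### Conjugate times of the blown-up covectors. -/

section ConjugateTime

variable {n : ℕ} [NeZero n] {M : Type*} [TopologicalSpace M] [T2Space M] [ChartedSpace (Coord n) M]
  [IsManifold 𝓘(ℝ, Coord n) ∞ M] {S : HorizontalMetric n M} {q₀ : M} {b : Fin n → ℝ}
  {X : HIdx n → ∀ q : M, TangentSpace 𝓘(ℝ, Coord n) q}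
  {φ : OpenPartialHomeomorph M (Coord n)}
  {Y : HIdx n → ℝ × Coord n → Coord n} {hY : IsNilpotentDeformation b Y} {r : ℝ}

theorem scaledPt_sqrt (h : HIdx n → ℝ) {η : ℝ} (hη : 0 < η) (τ : ℝ) :
    scaledPt h (√η, τ) = (η * τ, coordMk (blowup h η) τ) := by
  rw [scaledPt]
  simp only [Real.sq_sqrt hη.le]
  rfl

/-- The left side does not involve τ: one covector is represented by a different dilated covector
for each time ητ at which its trajectory is observed. -/
theorem covector_blowup (φ : OpenPartialHomeomorph M (Coord n)) (q₀ : M) (h : HIdx n → ℝ) {η τ : ℝ}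
    (hη : 0 < η) (hτ : 0 < τ) :
    covector φ q₀ (blowup h η) η⁻¹ =
      dilCov φ q₀ (scaledPt h (√η, τ)).1 (scaledPt h (√η, τ)).2 := by
  rw [scaledPt_sqrt h hη, covector_eq_dilCov φ q₀ (mul_pos hη hτ).ne']
  congr 2
  field_simp

theorem blowupExp_eq (hφ : IsNormalForm S q₀ b φ X) (hr : Metric.ball 0 r ⊆ φ.target)
    (hYX : ∀ k ε y, dil ε y ∈ Metric.ball (0 : Coord n) r →
      dil ε (Y k (ε, y)) = ε • inCoord φ (X k) (dil ε y)) {h : HIdx n → ℝ} {η τ : ℝ}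
    (hη : 0 < η) (hτ : 0 < τ) (hP : scaledPt h (√η, τ) ∈ goodDomain hY r) :
    blowupExp S q₀ φ τ h η = dil (√η ^ 2 * τ) (endPos hY (scaledPt h (√η, τ))) := by
  have h1 : 0 < (scaledPt h (√η, τ)).1 := by
    rw [scaledPt_sqrt h hη]; exact mul_pos hη hτ
  obtain ⟨-, h2, h3⟩ := expMap_dilCov hφ hr hYX hP h1
  have h4 : (scaledPt h (√η, τ)).1 = η * τ := by rw [scaledPt_sqrt h hη]
  rw [blowupExp, covector_blowup φ q₀ h hη hτ, ← h4, h2, φ.right_inv h3]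
  rfl

theorem mem_conjugateTimes_blowup (hφ : IsNormalForm S q₀ b φ X) (hr : Metric.ball 0 r ⊆ φ.target)
    (hYX : ∀ k ε y, dil ε y ∈ Metric.ball (0 : Coord n) r →
      dil ε (Y k (ε, y)) = ε • inCoord φ (X k) (dil ε y)) {h : HIdx n → ℝ} {η τ : ℝ}
    (hη : 0 < η) (hτ : 0 < τ) (hP : scaledPt h (√η, τ) ∈ goodDomain hY r) :
    η * τ ∈ conjugateTimes S q₀ (covector φ q₀ (blowup h η) η⁻¹) ↔
      (jac hY (scaledPt h (√η, τ))).det = 0 := by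
  have h1 : 0 < (scaledPt h (√η, τ)).1 := by
    rw [scaledPt_sqrt h hη]; exact mul_pos hη hτ
  have h4 : (scaledPt h (√η, τ)).1 = η * τ := by rw [scaledPt_sqrt h hη]
  rw [covector_blowup φ q₀ h hη hτ, ← h4]
  exact mem_conjugateTimes_iff hφ hr hYX hP h1

theorem scaledPt_zero_mem_goodDomain (hr : 0 < r) (h : HIdx n → ℝ) (τ : ℝ) :
    scaledPt h (0, τ) ∈ goodDomain hY r := by
  rw [scaledPt_zero]
  exact zero_mem_goodDomain hr _

theorem tendsto_sqrt_nhdsGT : Tendsto (fun η : ℝ => √η) (𝓝[>] 0) (𝓝[>] 0) := by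
  refine tendsto_nhdsWithin_iff.2 ⟨?_, ?_⟩
  · have : Tendsto (fun η : ℝ => √η) (𝓝 0) (𝓝 0) := by
      simpa using Real.continuous_sqrt.tendsto 0
    exact this.mono_left nhdsWithin_le_nhds
  · filter_upwards [self_mem_nhdsWithin] with η hη
    exact Real.sqrt_pos.2 hη

theorem hasHalfPowerExpansion_blowupExp (hφ : IsNormalForm S q₀ b φ X) (hr0 : 0 < r)
    (hr : Metric.ball 0 r ⊆ φ.target)
    (hYX : ∀ k ε y, dil ε y ∈ Metric.ball (0 : Coord n) r →
      dil ε (Y k (ε, y)) = ε • inCoord φ (X k) (dil ε y)) (h : HIdx n → ℝ) {τ : ℝ} (hτ : 0 < τ) :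
    HasHalfPowerExpansion (blowupExp S q₀ φ τ h) (fun k => expCoeff hY k τ h) 5 := by
  have h1 := (dil_endPos_expansion hY h hτ).comp_tendsto
    (tendsto_nhds_of_tendsto_nhdsWithin tendsto_sqrt_nhdsGT)
  refine h1.congr' ?_ EventuallyEq.rfl
  have h2 : ∀ᶠ s in 𝓝 (0 : ℝ), scaledPt h (s, τ) ∈ goodDomain hY r :=
    ((continuous_scaledPt h).comp (by fun_prop : Continuous fun s : ℝ => (s, τ))).continuousAt.eventually
      ((isOpen_goodDomain r).mem_nhds (scaledPt_zero_mem_goodDomain hr0 h τ))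
  filter_upwards [(tendsto_nhds_of_tendsto_nhdsWithin tendsto_sqrt_nhdsGT).eventually h2,
    self_mem_nhdsWithin] with η h3 hη
  rw [Function.comp_apply, blowupExp_eq hφ hr hYX hη hτ h3]

/-- The first conjugate time when there is a root. -/
theorem eventually_isLeast_conjugateTimes (hφ : IsNormalForm S q₀ b φ X) (hr0 : 0 < r)
    (hr : Metric.ball 0 r ⊆ φ.target)
    (hYX : ∀ k ε y, dil ε y ∈ Metric.ball (0 : Coord n) r →
      dil ε (Y k (ε, y)) = ε • inCoord φ (X k) (dil ε y)) {h : HIdx n → ℝ}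
    (hb_pos : ∀ i, 0 < b i) (hb : StrictAnti b)
    (hne : ∃ k : HIdx n, k.1 ≠ 0 ∧ h k ≠ 0) {δ δ' : ℝ} (hle : δ ≤ δ')
    (htr : (limitMat hY h).trace = -(δ + δ')) (hdt : (limitMat hY h).det = δ * δ')
    {ε : ℝ} (hε : 0 < ε) :
    ∀ᶠ η in 𝓝[>] (0 : ℝ), ∃ τ ∈ Icc (2 * Real.pi / b 0 + η * (δ - ε))
        (2 * Real.pi / b 0 + η * (δ + ε)),
      IsLeast (conjugateTimes S q₀ (covector φ q₀ (blowup h η) η⁻¹)) (η * τ) := by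
  have hb0 := hb_pos 0
  have h1 := first_root_of_nonneg hY h hb_pos hb hne hle htr hdt hε
  set α := 2 * Real.pi / b 0 with hα
  have hα0 : 0 < α := by positivity
  have h2 := eventually_forall_scaledPt h (isOpen_goodDomain (hY := hY) r) (T := 0) (T' := α + 1)
    fun τ _ => scaledPt_zero_mem_goodDomain hr0 h τ
  have hc : ∀ c : ℝ, Tendsto (fun η : ℝ => α + η * c) (𝓝[>] 0) (𝓝 α) := fun c => by
    have : Continuous fun η : ℝ => α + η * c := by fun_prop
    exact (by simpa using this.tendsto 0 : Tendsto _ (𝓝 (0 : ℝ)) (𝓝 α)).mono_left nhdsWithin_le_nhds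
  filter_upwards [tendsto_sqrt_nhdsGT.eventually h1,
    (tendsto_nhds_of_tendsto_nhdsWithin tendsto_sqrt_nhdsGT).eventually h2, self_mem_nhdsWithin,
    (hc (δ - ε)).eventually (lt_mem_nhds hα0),
    (hc (δ + ε)).eventually (gt_mem_nhds (show α < α + 1 by linarith))] with η e1 e2 hη e3 e4
  have hη : (0 : ℝ) < η := hη
  rw [Real.sq_sqrt hη.le] at e1
  obtain ⟨hno, τ₁, hτ₁, hroot⟩ := e1
  -- The zeros in the window form a nonempty compact set, whose minimum is the first conjugate time
  -- because there are no earlier zeros. Hence the infimum is attained.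
  set Z : Set ℝ := Icc (α + η * (δ - ε)) (α + η * (δ + ε)) ∩
    (fun τ => (jac hY (scaledPt h (√η, τ))).det) ⁻¹' {0} with hZ
  have hcont : ContinuousOn (fun τ => (jac hY (scaledPt h (√η, τ))).det)
      (Icc (α + η * (δ - ε)) (α + η * (δ + ε))) := fun τ hτ => by
    have f1 : scaledPt h (√η, τ) ∈ endDomain hY := (e2 τ ⟨e3.le.trans hτ.1, hτ.2.trans e4.le⟩).1
    have f2 : ContinuousAt (fun τ => scaledPt h (√η, τ)) τ :=
      ((continuous_scaledPt h).comp (by fun_prop : Continuous fun τ : ℝ => (√η, τ))).continuousAt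
    have f3 : ContinuousAt (fun τ => jac hY (scaledPt h (√η, τ))) τ :=
      ContinuousAt.comp (f := fun τ => scaledPt h (√η, τ)) (continuousAt_jac hY f1) f2
    exact ((continuous_id.matrix_det).continuousAt.comp f3).continuousWithinAt
  have hZc : IsCompact Z := isCompact_Icc.of_isClosed_subset
    (hcont.preimage_isClosed_of_isClosed isClosed_Icc isClosed_singleton) inter_subset_left
  obtain ⟨τ, hτZ, hτmin⟩ := hZc.exists_isLeast ⟨τ₁, hτ₁, hroot⟩
  have hτ0 : 0 < τ := e3.trans_le hτZ.1.1
  refine ⟨τ, hτZ.1, (mem_conjugateTimes_blowup hφ hr hYX hη hτ0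
    (e2 τ ⟨hτ0.le, hτZ.1.2.trans e4.le⟩)).2 hτZ.2, fun t ht => ?_⟩
  by_contra! hlt
  have ht0 : 0 < t := ht.1
  have g1 : η * (t / η) = t := by field_simp
  have g2 : 0 < t / η := div_pos ht0 hη
  have g3 : t / η < τ := by rw [div_lt_iff₀ hη]; linarith
  have g4 : (jac hY (scaledPt h (√η, t / η))).det = 0 := by
    rw [← mem_conjugateTimes_blowup hφ hr hYX hη g2
      (e2 _ ⟨g2.le, (g3.le.trans hτZ.1.2).trans e4.le⟩), g1]
    exact ht
  rcases le_total (t / η) (α + η * (δ - ε)) with g5 | g5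
  · exact hno _ ⟨g2.le, g5⟩ g4
  · exact absurd (hτmin ⟨⟨g5, g3.le.trans hτZ.1.2⟩, g4⟩) (not_le.2 g3)

theorem rescaledConjugateTime_of_isLeast {h : HIdx n → ℝ} {η τ : ℝ} (hη : 0 < η)
    (hl : IsLeast (conjugateTimes S q₀ (covector φ q₀ (blowup h η) η⁻¹)) (η * τ)) :
    (rescaledConjugateTime S q₀ φ h η).toReal = τ := by
  have h1 : IsLeast ((fun t : ℝ => (t : EReal)) ''
      conjugateTimes S q₀ (covector φ q₀ (blowup h η) η⁻¹)) ((η * τ : ℝ) : EReal) :=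
    ⟨mem_image_of_mem _ hl.1, forall_mem_image.2 fun t ht => EReal.coe_le_coe_iff.2 (hl.2 ht)⟩
  rw [rescaledConjugateTime, firstConjugateTime, h1.isGLB.sInf_eq, ← EReal.coe_div, EReal.toReal_coe]
  field_simp

/-- The first conjugate time stays away from the nilpotent one when there is no root. -/
theorem limsup_pos_of_neg (hφ : IsNormalForm S q₀ b φ X) (hr0 : 0 < r)
    (hr : Metric.ball 0 r ⊆ φ.target)
    (hYX : ∀ k ε y, dil ε y ∈ Metric.ball (0 : Coord n) r →
      dil ε (Y k (ε, y)) = ε • inCoord φ (X k) (dil ε y)) {h : HIdx n → ℝ}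
    (hb_pos : ∀ i, 0 < b i) (hb : StrictAnti b)
    (hne : ∃ k : HIdx n, k.1 ≠ 0 ∧ h k ≠ 0)
    (hD : (limitMat hY h).trace ^ 2 < 4 * (limitMat hY h).det) :
    0 < limsup (fun η : ℝ =>
      (rescaledConjugateTime S q₀ φ h η - ((2 * Real.pi / b 0 : ℝ) : EReal)).abs) (𝓝[>] (0 : ℝ)) := by
  obtain ⟨ρ, hρ, h1⟩ := no_root_of_neg hY h hb_pos hb hne hD
  set α := 2 * Real.pi / b 0 with hα
  have h2 := eventually_forall_scaledPt h (isOpen_goodDomain (hY := hY) r) (T := 0) (T' := α + ρ)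
    fun τ _ => scaledPt_zero_mem_goodDomain hr0 h τ
  have h3 : ∀ᶠ η in 𝓝[>] (0 : ℝ), ENNReal.ofReal ρ ≤
      (rescaledConjugateTime S q₀ φ h η - (α : EReal)).abs := by
    filter_upwards [tendsto_sqrt_nhdsGT.eventually h1,
      (tendsto_nhds_of_tendsto_nhdsWithin tendsto_sqrt_nhdsGT).eventually h2, self_mem_nhdsWithin]
      with η e1 e2 hη
    have hη : (0 : ℝ) < η := hη
    -- The lower bound includes the case without conjugate times, where the infimum of the empty set
    -- is +∞.
    have h4 : ((α + ρ : ℝ) : EReal) ≤ rescaledConjugateTime S q₀ φ h η := by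
      rw [rescaledConjugateTime, EReal.le_div_iff_mul_le (by exact_mod_cast hη) (EReal.coe_ne_top η),
        ← EReal.coe_mul, firstConjugateTime]
      refine le_sInf (forall_mem_image.2 fun t ht => EReal.coe_le_coe_iff.2 ?_)
      by_contra! hlt
      have ht0 : 0 < t := ht.1
      have g1 : η * (t / η) = t := by field_simp
      have g2 : 0 < t / η := div_pos ht0 hη
      have g3 : t / η ≤ α + ρ := by rw [div_le_iff₀ hη]; exact hlt.le
      refine e1 _ ⟨g2.le, g3⟩ ?_
      rw [← mem_conjugateTimes_blowup hφ hr hYX hη g2 (e2 _ ⟨g2.le, g3⟩), g1]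
      exact ht
    generalize rescaledConjugateTime S q₀ φ h η = x at h4
    induction x with
    | bot => exact absurd h4 (by simp)
    | coe x =>
      have h5 := EReal.coe_le_coe_iff.1 h4
      rw [← EReal.coe_sub, EReal.abs_def]
      exact ENNReal.ofReal_le_ofReal ((by linarith : ρ ≤ x - α).trans (le_abs_self _))
    | top => simp
  refine (ENNReal.ofReal_pos.2 hρ).trans_le ?_
  calc ENNReal.ofReal ρ = limsup (fun _ : ℝ => ENNReal.ofReal ρ) (𝓝[>] (0 : ℝ)) := limsup_const _ |>.symm
    _ ≤ _ := limsup_le_limsup h3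

end ConjugateTime
end
end ContactSR

/-! ### The theorem. -/

open ContactSR in
theorem propositionP {n : ℕ} [NeZero n] {M : Type*} [TopologicalSpace M] [T2Space M]
    [ChartedSpace (Coord n) M] [IsManifold 𝓘(ℝ, Coord n) ∞ M]
    (S : HorizontalMetric n M) (hS : IsContact S) (q₀ : M)
    (b : Fin n → ℝ) (hb_pos : ∀ i, 0 < b i) (hb : StrictAnti b)
    (φ : OpenPartialHomeomorph M (Coord n))
    (X : HIdx n → ∀ q : M, TangentSpace 𝓘(ℝ, Coord n) q)
    (hφ : IsNormalForm S q₀ b φ X)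
    (hbar : HIdx n → ℝ) (hbar_ne : ∃ k : HIdx n, k.1 ≠ 0 ∧ hbar k ≠ 0) :
    ∃ Gc : ℕ → ℝ → (HIdx n → ℝ) → Coord n,
      (∀ τ > 0, ∀ h : HIdx n → ℝ,
        HasHalfPowerExpansion (blowupExp S q₀ φ τ h) (fun k => Gc k τ h) 5) ∧
      Differentiable ℝ (Gc 5 (2 * Real.pi / b 0)) ∧
      (0 ≤ discP b hbar (gradG (Gc 5 (2 * Real.pi / b 0)) hbar) →
        ∃ δ : ℝ, IsLeast {x | polyP b hbar (gradG (Gc 5 (2 * Real.pi / b 0)) hbar) x = 0} δ ∧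
        (∀ᶠ η in 𝓝[>] (0 : ℝ), ∃ t,
          IsLeast (conjugateTimes S q₀ (covector φ q₀ (blowup hbar η) η⁻¹)) t) ∧
        (fun η : ℝ => (rescaledConjugateTime S q₀ φ hbar η).toReal
          - (2 * Real.pi / b 0 + η * δ)) =o[𝓝[>] 0] fun η : ℝ => η) ∧
      (discP b hbar (gradG (Gc 5 (2 * Real.pi / b 0)) hbar) < 0 →
        0 < limsup (fun η : ℝ =>
          (rescaledConjugateTime S q₀ φ hbar η - ((2 * Real.pi / b 0 : ℝ) : EReal)).abs)
          (𝓝[>] (0 : ℝ))) := by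
  obtain ⟨Y, hY, r, hr0, hr, hYX⟩ := hφ.exists_dilated
  have hK := constK_pos hbar hb_pos hb hbar_ne
  refine ⟨expCoeff hY, fun τ hτ h => hasHalfPowerExpansion_blowupExp hφ hr0 hr hYX h hτ,
    differentiable_expCoeff_five hY _, ?_, ?_⟩
  · rw [gradG_expCoeff, discP_eq hY hK.ne']
    intro hD
    obtain ⟨δ, δ', hle, htr, hdt⟩ := exists_roots (nonneg_of_mul_nonneg_right hD (pow_pos hK 2))
    have hleast := fun ε (hε : 0 < ε) =>
      eventually_isLeast_conjugateTimes hφ hr0 hr hYX hb_pos hb hbar_ne hle htr hdt hε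
    -- As K > 0, P is a genuine quadratic with the roots δ ≤ δ' of det(x·1 + N), so its smallest
    -- root is δ.
    have hpoly : ∀ x, polyP b hbar (gammaMat hY hbar) x = -constK b hbar * ((x - δ) * (x - δ')) :=
      fun x => by
        rw [polyP_eq hY hK.ne', htr, hdt]
        ring
    refine ⟨δ, ⟨?_, fun x hx => ?_⟩, ?_, ?_⟩
    · rw [Set.mem_ofPred_eq, hpoly]
      ring
    · rw [Set.mem_ofPred_eq, hpoly] at hx
      rcases mul_eq_zero.1 ((mul_eq_zero.1 hx).resolve_left (neg_ne_zero.2 hK.ne')) with h | h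
      · linarith
      · linarith
    · exact (hleast 1 one_pos).mono fun η ⟨τ, _, h⟩ => ⟨η * τ, h⟩
    · rw [Asymptotics.isLittleO_iff]
      intro c hc
      filter_upwards [hleast c hc, self_mem_nhdsWithin] with η ⟨τ, hτ, h⟩ hη
      have hη : (0 : ℝ) < η := hη
      rw [rescaledConjugateTime_of_isLeast hη h, Real.norm_eq_abs, Real.norm_eq_abs,
        abs_of_pos hη, abs_le]
      constructor <;> nlinarith [hτ.1, hτ.2]
  · rw [gradG_expCoeff, discP_eq hY hK.ne']
    intro hD
    exact limsup_pos_of_neg hφ hr0 hr hYX hb_pos hb hbar_ne (by nlinarith [pow_pos hK 2])
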